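/- Let $\mathbb D=\{z\in\mathbb C:|z|<1\}$. Let $\hat H$ be the class of harmonic mappings $f=h+\overline g$ on $\mathbb D$, where $h(z)=z+\sum_{n\ge2}A_nz^n$ and $g(z)=\sum_{n\ge1}B_nz^n$ are analytic in $\mathbb D$ and $|B_1|<1$. Let $K_{\hat H^o}$ be the class of those $f=h+\overline g\in\hat H$ that are univalent and sense-preserving ($|g'|<|h'|$) in $\mathbb D$, satisfy $g'(0)=0$, and map $\mathbb D$ onto a convex domain. For $0\le\alpha<1$ let $HK(\alpha)$ be the class of those $f\in\hat H$ such that, for every $0<r<1$ and every real $\theta$, $\frac{\partial}{\partial\theta}f(re^{i\theta})\ne0$ and $$\frac{\partial}{\partial\theta}\arg\Big(\frac{\partial}{\partial\theta}f(re^{i\theta})\Big)>\alpha ,$$ where $\arg$ denotes a differentiable branch of the argument along the circle $|z|=r$ (as a function of $\theta\in\mathbb R$). For $i=1,2$ let $\alpha_i,\gamma_i>0$, $\beta_i,\delta_i\ge0$ with $\beta_i+\delta_i>0$, and let $$W_i(z)=z\,\Gamma(\alpha_i)\Gamma(\gamma_i)\sum_{n=0}^\infty\frac{z^n}{\Gamma(\alpha_i+n\beta_i)\Gamma(\gamma_i+n\delta_i)},\qquad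 z\in\mathbb C,$$ be the normalized four-parameter Wright function. Let $\sigma\in\mathbb C$ with $|\sigma|<1$, and for $f=h+\overline g\in\hat H$ put $L(f)=h*W_1+\overline{\sigma\,(g*W_2)}$, where $*$ is the Hadamard product (convolution) $\big(\sum p_nz^n\big)*\big(\sum q_nz^n\big)=\sum p_nq_nz^n$. Theorem. Let $0\le\alpha<1$ and $f=h+\overline g\in K_{\hat H^o}$. If $$\Big(W_1'''(1)+(4-\alpha)W_1''(1)+2(1-\alpha)\big(W_1'(1)-1\big)\Big)+|\sigma|\Big(W_2'''(1)+(2+\alpha)W_2''(1)\Big)\le 2(1-\alpha),$$ then $L(f)\in HK(\alpha)$. -/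

import Mathlib

open Complex Metric Set
open scoped ComplexConjugate

noncomputable section

/-- `f` is a normalized harmonic mapping of the open unit disc with analytic part `h` and
co-analytic part `g`: on the disc `f = h + conj g`, where `h` and `g` are analytic with
`h(z) = z + ∑_{n ≥ 2} a_n z^n`, `g(z) = ∑_{n ≥ 1} b_n z^n` and `|b_1| < 1`. -/
structure IsHarmonicDecomposition (f h g : ℂ → ℂ) : Prop where
  analytic_h : DifferentiableOn ℂ h (ball 0 1)
  analytic_g : DifferentiableOn ℂ g (ball 0 1)
  h_zero : h 0 = 0
  deriv_h_zero : deriv h 0 = 1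
  g_zero : g 0 = 0
  norm_deriv_g_zero : ‖deriv g 0‖ < 1
  eq_on_disc : ∀ z ∈ ball (0 : ℂ) 1, f z = h z + conj (g z)

/-- The class of normalized harmonic mappings of the unit disc. -/
def ClassH : Set (ℂ → ℂ) :=
  {f | ∃ h g, IsHarmonicDecomposition f h g}

/-- The normalized harmonic mappings that are sense-preserving (`|g'| < |h'|` on the disc),
univalent on the disc and satisfy `g'(0) = 0`. -/
def ClassSHo : Set (ℂ → ℂ) :=
  {f | InjOn f (ball 0 1) ∧ ∃ h g, IsHarmonicDecomposition f h g ∧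
    (∀ z ∈ ball (0 : ℂ) 1, ‖deriv g z‖ < ‖deriv h z‖) ∧ deriv g 0 = 0}

/-- The convex harmonic mappings with `g'(0) = 0`: those that map the unit disc onto a
convex domain. -/
def ClassKHo : Set (ℂ → ℂ) :=
  {f | f ∈ ClassSHo ∧ Convex ℝ (f '' ball 0 1)}

/-- The tangent vector `∂/∂θ f(r e^{iθ})`. -/
def circleTangent (f : ℂ → ℂ) (r θ : ℝ) : ℂ :=
  deriv (fun t : ℝ => f (r * exp (t * I))) θ

/-- Harmonic convex functions of order `a`: on each circle `|z| = r`, `0 < r < 1`, the tangent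
vector does not vanish and has a differentiable argument `φ`, with `φ'(θ) > a` for every `θ`. -/
def ClassHK (a : ℝ) : Set (ℂ → ℂ) :=
  {f | f ∈ ClassH ∧ ∀ r : ℝ, 0 < r → r < 1 →
    (∀ θ : ℝ, circleTangent f r θ ≠ 0) ∧
    ∃ φ : ℝ → ℝ, Differentiable ℝ φ ∧
      (∀ θ : ℝ, circleTangent f r θ = ‖circleTangent f r θ‖ * exp (φ θ * I)) ∧
      ∀ θ : ℝ, a < deriv φ θ}

/-- The four-parameter Wright function `∑ z^n / (Γ(α + nβ) Γ(γ + nδ))`. -/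
def wright (α β γ δ : ℝ) (z : ℂ) : ℂ :=
  ∑' n : ℕ, z ^ n / ((Real.Gamma (α + n * β) * Real.Gamma (γ + n * δ) : ℝ) : ℂ)

/-- The normalized Wright function `z Γ(α) Γ(γ) ∑ z^n / (Γ(α + nβ) Γ(γ + nδ))`. -/
def wrightNormalized (α β γ δ : ℝ) (z : ℂ) : ℂ :=
  z * Real.Gamma α * Real.Gamma γ * wright α β γ δ z

/-- The `n`-th Taylor coefficient at the origin. -/
def taylorCoeffZero (p : ℂ → ℂ) (n : ℕ) : ℂ :=
  iteratedDeriv n p 0 / (n.factorial : ℂ)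

/-- The convolution (Hadamard product) of two power series centred at the origin. -/
def hadamardConv (p q : ℂ → ℂ) (z : ℂ) : ℂ :=
  ∑' n : ℕ, taylorCoeffZero p n * taylorCoeffZero q n * z ^ n

/-- For `f = h + conj g`, the map `L(f) = h * W₁ + conj (σ (g * W₂))`, where `*` is convolution. -/
def convOperator (W₁ W₂ : ℂ → ℂ) (σ : ℂ) (h g : ℂ → ℂ) (z : ℂ) : ℂ :=
  hadamardConv h W₁ z + conj (σ * hadamardConv g W₂ z)

end

/-!
Let `f = h + conj g` be convex. The sets `{Re f > c}` and `{Re f < c}` in the disc are convex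
images pulled back by a homeomorphism, hence connected. After exhausting `f(𝔻)` by bounded convex
sets and uniformizing their preimages, `Re (h + g)` becomes a bounded harmonic function whose
boundary values cannot interlace, since two crossing paths in the disc would meet. So the boundary
values increase on one arc and decrease on the complementary one, which by Poisson's formula says
`Im ((l + 2 b z + conj l * z²) (h + g)'(z)) ≥ 0` for some `|l| = 1` and `|b| ≤ 1`. Applying this to
all rotations of `f` and choosing the rotation suitably, Carathéodory's inequality for functions of
positive real part yields `|a_n| ≤ (n + 1) / 2` and `|b_n| ≤ (n - 1) / 2`.

On the other hand `∑ n (n - a) |a_n| + n (n + a) |b_n| ≤ 2 (1 - a)` is sufficient for membership in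
`ClassHK a`. For the convolution with `W₁` and `W₂` the two bounds leave the sums of
`n (n + 1) (n - a) w_n` and `n (n - 1) (n + a) w_n`, and expanding these weights in falling
factorials turns the sums into combinations of derivatives of `W₁` and `W₂` at `1`.
-/

open Filter Topology
open scoped ComplexOrder

/-- Radial limits at the boundary of the unit disc: `u (r e^{iθ}) → y` as `r ↑ 1`. -/
def HasRadialLimit {X : Type*} [TopologicalSpace X] (u : ℂ → X) (θ : ℝ) (y : X) : Prop :=
  Tendsto (fun r : ℝ => u (r * exp (θ * I))) (𝓝[<] 1) (𝓝 y)

/-! ### Crossing paths in the closed disc -/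

lemma arg_one_sub_exp_mul_I {τ : ℝ} (h0 : 0 < τ) (h1 : τ < 2 * Real.pi) :
    (1 - exp (τ * I)).arg = (τ - Real.pi) / 2 := by
  have hsin : 0 < Real.sin (τ / 2) := Real.sin_pos_of_pos_of_lt_pi (by linarith) (by linarith)
  have hcos_two : Real.cos τ = 1 - 2 * Real.sin (τ / 2) ^ 2 := by
    have := Real.cos_two_mul (τ / 2)
    rw [mul_div_cancel₀ τ two_ne_zero] at this
    linarith [Real.sin_sq_add_cos_sq (τ / 2)]
  have hsin_two : Real.sin τ = 2 * Real.sin (τ / 2) * Real.cos (τ / 2) := by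
    rw [← Real.sin_two_mul, mul_div_cancel₀ τ two_ne_zero]
  have hpolar : 1 - exp (τ * I) = ((2 * Real.sin (τ / 2) : ℝ) : ℂ) *
      (cos (((τ - Real.pi) / 2 : ℝ) : ℂ) + sin (((τ - Real.pi) / 2 : ℝ) : ℂ) * I) := by
    rw [sub_div, exp_mul_I, ← ofReal_cos, ← ofReal_sin, ← ofReal_cos, ← ofReal_sin,
      Real.cos_sub_pi_div_two, Real.sin_sub_pi_div_two, hcos_two, hsin_two]
    push_cast
    ring
  rw [hpolar, arg_mul_cos_add_sin_mul_I (by linarith) ⟨by linarith, by linarith⟩]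

lemma arg_one_sub_exp_neg_mul_I {τ : ℝ} (h0 : 0 < τ) (h1 : τ < 2 * Real.pi) :
    (1 - exp ((-τ : ℝ) * I)).arg = (Real.pi - τ) / 2 := by
  have hperiod : exp ((-τ : ℝ) * I) = exp ((2 * Real.pi - τ : ℝ) * I) := by
    rw [← exp_periodic ((-τ : ℝ) * I)]
    congr 1
    push_cast
    ring
  rw [hperiod, arg_one_sub_exp_mul_I (by linarith) (by linarith)]
  ring

lemma exp_mul_I_ne_of_lt_of_lt_add_two_pi {θ φ : ℝ} (h : θ < φ) (h' : φ < θ + 2 * Real.pi) :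
    exp (θ * I) ≠ exp (φ * I) := by
  rw [Ne, exp_eq_exp_iff_exists_int]
  rintro ⟨n, hn⟩
  have hθφ : θ = φ + n * (2 * Real.pi) := by simpa using congrArg im hn
  have hlt : -1 < (n : ℝ) := by nlinarith [Real.pi_pos]
  have hgt : (n : ℝ) < 0 := by nlinarith [Real.pi_pos]
  norm_cast at hlt hgt
  lia

lemma conj_exp_mul_exp_mul_I (θ φ : ℝ) :
    conj (exp (θ * I)) * exp (φ * I) = exp ((φ - θ : ℝ) * I) := by
  rw [← exp_conj, ← exp_add]
  congr 1
  simp only [map_mul, conj_ofReal, conj_I, ofReal_sub]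
  ring

lemma one_sub_conj_mul_mem_slitPlane {p w : ℂ} (hp : ‖p‖ = 1) (hw : ‖w‖ ≤ 1) (hne : w ≠ p) :
    1 - conj p * w ∈ slitPlane := by
  have hnorm : ‖conj p * w‖ ≤ 1 := by simpa [hp] using hw
  have hre : (conj p * w).re ≠ 1 := by
    intro hre
    have him : (conj p * w).im = 0 := by
      rw [← abs_re_eq_norm, hre, abs_one]
      exact le_antisymm (hre ▸ re_le_norm _) hnorm
    have hone : conj p * w = 1 := Complex.ext hre him
    refine hne ?_
    calc w = p * conj p * w := by rw [mul_conj, normSq_eq_norm_sq, hp]; simp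
      _ = p := by rw [mul_assoc, hone, mul_one]
  left
  simpa using lt_of_le_of_ne ((re_le_norm _).trans hnorm) hre

lemma continuous_log_sub_eq {p κ : ℂ} (hp : ‖p‖ = 1) {w l : ℝ → ℂ}
    (hw : Continuous w) (hl : Continuous l) (hw1 : ∀ t, ‖w t‖ ≤ 1) (hwp : ∀ t, w t ≠ p)
    (hexp : ∀ t, exp (l t) = κ * (1 - conj p * w t)) (a b : ℝ) :
    l b - l a = log (1 - conj p * w b) - log (1 - conj p * w a) := by
  have hslit (t : ℝ) : 1 - conj p * w t ∈ slitPlane :=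
    one_sub_conj_mul_mem_slitPlane hp (hw1 t) (hwp t)
  have hne (t : ℝ) : 1 - conj p * w t ≠ 0 := slitPlane_ne_zero (hslit t)
  have hcont : Continuous fun t => l t - log (1 - conj p * w t) :=
    hl.sub ((continuous_const.sub (continuous_const.mul hw)).clog hslit)
  have hconst : l a - log (1 - conj p * w a) = l b - log (1 - conj p * w b) :=
    isCoveringMap_exp.const_of_comp hcont (fun s t => by
      ext
      simp only [exp_sub, exp_log (hne _), hexp]
      rw [mul_div_cancel_right₀ _ (hne _), mul_div_cancel_right₀ _ (hne _)]) a b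
  linear_combination -hconst

lemma isSimplyConnected_of_convex {E : Type*} [AddCommGroup E] [Module ℝ E] [TopologicalSpace E]
    [ContinuousAdd E] [ContinuousSMul ℝ E] {s : Set E} (hs : Convex ℝ s) (hne : s.Nonempty) :
    IsSimplyConnected s := by
  have := hs.contractibleSpace hne
  exact inferInstanceAs (SimplyConnectedSpace s)

section Interlacing

variable {θ₁ θ₂ θ₃ θ₄ : ℝ}

/- Otherwise `γ s - η t` has a continuous logarithm on the plane, hence no winding around the unit
square; but the four sides contribute changes of argument adding up to `±2π`. -/
theorem exists_eq_of_interlacing (h12 : θ₁ < θ₂) (h23 : θ₂ < θ₃) (h34 : θ₃ < θ₄)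
    (h41 : θ₄ < θ₁ + 2 * Real.pi) {γ η : ℝ → ℂ} (hγ : Continuous γ) (hη : Continuous η)
    (hγ1 : ∀ t, ‖γ t‖ ≤ 1) (hη1 : ∀ t, ‖η t‖ ≤ 1)
    (hγ0 : γ 0 = exp (θ₁ * I)) (hγe : γ 1 = exp (θ₃ * I))
    (hη0 : η 0 = exp (θ₂ * I)) (hηe : η 1 = exp (θ₄ * I)) : ∃ s t, γ s = η t := by
  by_contra! hne
  obtain ⟨L, hLc, hL⟩ := exists_continuousOn_eqOn_exp_comp (X := ℝ × ℝ) (U := univ)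
    (isSimplyConnected_of_convex convex_univ univ_nonempty) isOpen_univ
    (g := fun x => γ x.1 - η x.2) (by fun_prop)
    (by rintro ⟨x, -, hx⟩; exact hne _ _ (sub_eq_zero.1 hx))
  rw [continuousOn_univ] at hLc
  have hexp (s t : ℝ) : exp (L (s, t)) = γ s - η t := hL (mem_univ (s, t))
  have hone (θ : ℝ) : exp (θ * I) * conj (exp (θ * I)) = 1 := by
    rw [mul_comm, conj_exp_mul_exp_mul_I, sub_self, ofReal_zero, zero_mul, exp_zero]
  have left := continuous_log_sub_eq (κ := exp (θ₁ * I)) (norm_exp_ofReal_mul_I θ₁) hη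
    (l := fun t => L (0, t)) (by fun_prop) hη1 (fun t h => hne 0 t (by rw [hγ0, h]))
    (fun t => by rw [hexp, hγ0]; linear_combination (η t) * hone θ₁) 0 1
  have top := continuous_log_sub_eq (κ := -exp (θ₄ * I)) (norm_exp_ofReal_mul_I θ₄) hγ
    (l := fun s => L (s, 1)) (by fun_prop) hγ1 (fun s h => hne s 1 (by rw [hηe, h]))
    (fun s => by rw [hexp, hηe]; linear_combination -(γ s) * hone θ₄) 0 1
  have right := continuous_log_sub_eq (κ := exp (θ₃ * I)) (norm_exp_ofReal_mul_I θ₃) hη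
    (l := fun t => L (1, t)) (by fun_prop) hη1 (fun t h => hne 1 t (by rw [hγe, h]))
    (fun t => by rw [hexp, hγe]; linear_combination (η t) * hone θ₃) 0 1
  have bottom := continuous_log_sub_eq (κ := -exp (θ₂ * I)) (norm_exp_ofReal_mul_I θ₂) hγ
    (l := fun s => L (s, 0)) (by fun_prop) hγ1 (fun s h => hne s 0 (by rw [hη0, h]))
    (fun s => by rw [hexp, hη0]; linear_combination -(γ s) * hone θ₂) 0 1
  simp only [hγ0, hγe, hη0, hηe, conj_exp_mul_exp_mul_I] at left top right bottom
  have hwinding := congrArg im (show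
    (L (0, 1) - L (0, 0)) + (L (1, 1) - L (0, 1)) = (L (1, 0) - L (0, 0)) + (L (1, 1) - L (1, 0))
    by ring)
  rw [left, top, right, bottom] at hwinding
  simp only [add_im, sub_im, log_im] at hwinding
  rw [← neg_sub θ₄ θ₃, ← neg_sub θ₄ θ₁, ← neg_sub θ₂ θ₁, ← neg_sub θ₃ θ₂] at hwinding
  rw [arg_one_sub_exp_neg_mul_I, arg_one_sub_exp_neg_mul_I, arg_one_sub_exp_neg_mul_I,
    arg_one_sub_exp_neg_mul_I, arg_one_sub_exp_mul_I, arg_one_sub_exp_mul_I,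
    arg_one_sub_exp_mul_I, arg_one_sub_exp_mul_I] at hwinding <;> linarith [Real.pi_pos]

lemma exists_segment_subset_of_hasRadialLimit {X : Type*} [TopologicalSpace X] {u : ℂ → X}
    {S : Set X} (hS : IsOpen S) {θ : ℝ} {y : X} (hθ : HasRadialLimit u θ y) (hy : y ∈ S) :
    ∃ z ∈ ball (0 : ℂ) 1, u z ∈ S ∧
      segment ℝ z (exp (θ * I)) ⊆ {x ∈ ball (0 : ℂ) 1 | u x ∈ S} ∪ {exp (θ * I)} := by
  obtain ⟨a, ha1, ha⟩ := mem_nhdsLT_iff_exists_Ioo_subset.1 (hθ (hS.mem_nhds hy))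
  obtain ⟨b, hb, hb1⟩ := exists_between (max_lt (mem_Iio.1 ha1) one_pos)
  have hmem {r : ℝ} (hbr : b ≤ r) (hr1 : r < 1) :
      (r : ℂ) * exp (θ * I) ∈ {x ∈ ball (0 : ℂ) 1 | u x ∈ S} := by
    have har := hb.trans_le hbr
    refine ⟨?_, ha ⟨(le_max_left _ _).trans_lt har, hr1⟩⟩
    simpa [norm_exp_ofReal_mul_I, abs_of_pos ((le_max_right a 0).trans_lt har)] using hr1
  refine ⟨b * exp (θ * I), (hmem le_rfl hb1).1, (hmem le_rfl hb1).2, ?_⟩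
  rintro x ⟨s, t, hs, ht, hst, rfl⟩
  have hx : s • ((b : ℂ) * exp (θ * I)) + t • exp (θ * I) =
      ((s * b + t : ℝ) : ℂ) * exp (θ * I) := by
    simp only [real_smul]
    push_cast
    ring
  rw [hx]
  rcases hs.eq_or_lt with rfl | hs
  · right
    simp [show t = 1 by linarith]
  · exact Or.inl (hmem (by nlinarith) (by nlinarith))

lemma joinedIn_of_hasRadialLimit {X : Type*} [TopologicalSpace X] {u : ℂ → X} {S : Set X}
    (hS : IsOpen S)
    (hj : ∀ z ∈ {x ∈ ball (0 : ℂ) 1 | u x ∈ S}, ∀ w ∈ {x ∈ ball (0 : ℂ) 1 | u x ∈ S},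
      JoinedIn {x ∈ ball (0 : ℂ) 1 | u x ∈ S} z w)
    {θ φ : ℝ} {y y' : X}
    (hθ : HasRadialLimit u θ y) (hφ : HasRadialLimit u φ y') (hy : y ∈ S) (hy' : y' ∈ S) :
    JoinedIn ({x ∈ ball (0 : ℂ) 1 | u x ∈ S} ∪ {exp (θ * I), exp (φ * I)})
      (exp (θ * I)) (exp (φ * I)) := by
  obtain ⟨z, hz, hzS, hzθ⟩ := exists_segment_subset_of_hasRadialLimit hS hθ hy
  obtain ⟨w, hw, hwS, hwφ⟩ := exists_segment_subset_of_hasRadialLimit hS hφ hy'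
  exact ((JoinedIn.of_segment_subset (hzθ.trans
      (union_subset_union_right _ (by simp)))).symm.trans
    ((hj z ⟨hz, hzS⟩ w ⟨hw, hwS⟩).mono subset_union_left)).trans
    (JoinedIn.of_segment_subset (hwφ.trans (union_subset_union_right _ (by simp))))

theorem not_interlacing_radial_limits {u : ℂ → ℝ} (c : ℝ)
    (hup : ∀ z ∈ {x ∈ ball (0 : ℂ) 1 | c < u x}, ∀ w ∈ {x ∈ ball (0 : ℂ) 1 | c < u x},
      JoinedIn {x ∈ ball (0 : ℂ) 1 | c < u x} z w)
    (hlo : ∀ z ∈ {x ∈ ball (0 : ℂ) 1 | u x < c}, ∀ w ∈ {x ∈ ball (0 : ℂ) 1 | u x < c},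
      JoinedIn {x ∈ ball (0 : ℂ) 1 | u x < c} z w)
    (h12 : θ₁ < θ₂) (h23 : θ₂ < θ₃) (h34 : θ₃ < θ₄) (h41 : θ₄ < θ₁ + 2 * Real.pi) {v : ℝ → ℝ}
    (hv : ∀ θ ∈ ({θ₁, θ₂, θ₃, θ₄} : Set ℝ), HasRadialLimit u θ (v θ))
    (h1 : c < v θ₁) (h2 : v θ₂ < c) (h3 : c < v θ₃) (h4 : v θ₄ < c) : False := by
  obtain ⟨γ, hγ⟩ := joinedIn_of_hasRadialLimit (S := Ioi c) isOpen_Ioi hup (θ := θ₁) (φ := θ₃)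
    (hv _ (by simp)) (hv _ (by simp)) h1 h3
  obtain ⟨η, hη⟩ := joinedIn_of_hasRadialLimit (S := Iio c) isOpen_Iio hlo (θ := θ₂) (φ := θ₄)
    (hv _ (by simp)) (hv _ (by simp)) h2 h4
  have hle {S : Set ℝ} {θ φ : ℝ} {x : ℂ}
      (hx : x ∈ {x ∈ ball (0 : ℂ) 1 | u x ∈ S} ∪ {exp (θ * I), exp (φ * I)}) : ‖x‖ ≤ 1 := by
    rcases hx with hx | rfl | rfl
    · exact (mem_ball_zero_iff.1 hx.1).le
    · exact (norm_exp_ofReal_mul_I _).le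
    · exact (norm_exp_ofReal_mul_I _).le
  have hγ_ext (t : ℝ) := hγ (projIcc 0 1 zero_le_one t)
  have hη_ext (t : ℝ) := hη (projIcc 0 1 zero_le_one t)
  obtain ⟨s, t, hst⟩ := exists_eq_of_interlacing h12 h23 h34 h41 γ.continuous_extend
    η.continuous_extend (fun t => hle (hγ_ext t)) (fun t => hle (hη_ext t))
    (by simp) (by simp) (by simp) (by simp)
  have hnot (θ : ℝ) : exp (θ * I) ∉ ball (0 : ℂ) 1 := by simp [norm_exp_ofReal_mul_I]
  have hγs : γ.extend s ∈ _ := hγ_ext s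
  have hηt : η.extend t ∈ _ := hη_ext t
  rw [hst] at hγs
  rcases hγs with hγs | hγs | hγs <;> rcases hηt with hηt | hηt | hηt
  · exact lt_asymm (mem_Ioi.1 hγs.2) (mem_Iio.1 hηt.2)
  · exact hnot _ (hηt ▸ hγs.1)
  · exact hnot _ (hηt ▸ hγs.1)
  · exact hnot _ (hγs ▸ hηt.1)
  · exact exp_mul_I_ne_of_lt_of_lt_add_two_pi h12 (by linarith) (hγs.symm.trans hηt)
  · exact exp_mul_I_ne_of_lt_of_lt_add_two_pi (by linarith) h41 (hγs.symm.trans hηt)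
  · exact hnot _ (hγs ▸ hηt.1)
  · exact exp_mul_I_ne_of_lt_of_lt_add_two_pi h23 (by linarith) (hηt.symm.trans hγs)
  · exact exp_mul_I_ne_of_lt_of_lt_add_two_pi h34 (by linarith) (hγs.symm.trans hηt)

end Interlacing

/-! ### Theorems of Hurwitz and Montel -/

lemma le_norm_of_forall_mem_sphere_le_norm {F : ℂ → ℂ} {z₀ : ℂ} {r m : ℝ} (hr : 0 < r) (hm : 0 < m)
    (hd : DifferentiableOn ℂ F (closedBall z₀ r)) (hne : ∀ z ∈ closedBall z₀ r, F z ≠ 0)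
    (hle : ∀ z ∈ sphere z₀ r, m ≤ ‖F z‖) : m ≤ ‖F z₀‖ := by
  have hinv : DiffContOnCl ℂ (fun z => (F z)⁻¹) (ball z₀ r) := by
    refine DifferentiableOn.diffContOnCl ?_
    rw [closure_ball _ hr.ne']
    exact hd.inv hne
  have hmax : ‖(F z₀)⁻¹‖ ≤ m⁻¹ := by
    refine norm_le_of_forall_mem_frontier_norm_le isBounded_ball hinv (fun z hz => ?_)
      (subset_closure (mem_ball_self hr))
    rw [frontier_ball _ hr.ne'] at hz
    rw [norm_inv]
    exact inv_anti₀ hm (hle z hz)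
  rw [norm_inv] at hmax
  exact (inv_le_inv₀ (norm_pos_iff.2 (hne z₀ (mem_closedBall_self hr.le))) hm).1 hmax

section Hurwitz

variable {ι : Type*} {l : Filter ι} [l.NeBot] {U : Set ℂ} {F : ι → ℂ → ℂ} {f : ℂ → ℂ}

/- At an isolated zero of `f`, the minimum modulus principle on a small circle bounds `F i` from
below. -/
theorem ne_zero_of_tendstoLocallyUniformlyOn (hU : IsOpen U) (hc : IsPreconnected U)
    (hF : TendstoLocallyUniformlyOn F f l U) (hd : ∀ i, DifferentiableOn ℂ (F i) U)
    (hne : ∀ i, ∀ z ∈ U, F i z ≠ 0) (hf : ∃ z ∈ U, f z ≠ 0) : ∀ z ∈ U, f z ≠ 0 := by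
  intro z₀ hz₀ hfz
  have hfd : DifferentiableOn ℂ f U := hF.differentiableOn (.of_forall hd) hU
  rcases (hfd.analyticAt (hU.mem_nhds hz₀)).eventually_eq_zero_or_eventually_ne_zero with h | h
  · obtain ⟨z, hz, hz'⟩ := hf
    exact hz' ((hfd.analyticOnNhd hU).eqOn_zero_of_preconnected_of_eventuallyEq_zero hc hz₀ h hz)
  obtain ⟨r, hr, hball⟩ := nhds_basis_closedBall.mem_iff.1
    (inter_mem (eventually_nhdsWithin_iff.1 h) (hU.mem_nhds hz₀))
  have hsub : closedBall z₀ r ⊆ U := fun z hz => (hball hz).2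
  obtain ⟨x, hx, hxmin⟩ := (isCompact_sphere z₀ r).exists_isMinOn
    (NormedSpace.sphere_nonempty.2 hr.le)
    (hfd.continuousOn.mono (sphere_subset_closedBall.trans hsub)).norm
  have hfx : 0 < ‖f x‖ :=
    norm_pos_iff.2 ((hball (sphere_subset_closedBall hx)).1 (ne_of_mem_sphere hx hr.ne'))
  have hunif := (tendstoLocallyUniformlyOn_iff_forall_isCompact hU).1 hF _ hsub
    (isCompact_closedBall z₀ r)
  obtain ⟨i, hi⟩ := (Metric.tendstoUniformlyOn_iff.1 hunif _ (half_pos hfx)).exists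
  have hsmall : ‖F i z₀‖ < ‖f x‖ / 2 := by
    simpa [hfz] using hi z₀ (mem_closedBall_self hr.le)
  refine hsmall.not_ge (le_norm_of_forall_mem_sphere_le_norm hr (half_pos hfx) ((hd i).mono hsub)
    (fun z hz => hne i z (hsub hz)) fun z hz => ?_)
  have hmin : ‖f x‖ ≤ ‖f z‖ := hxmin hz
  have hdist : ‖f z‖ - ‖F i z‖ ≤ dist (f z) (F i z) := by
    rw [dist_eq_norm]
    exact norm_sub_norm_le _ _
  linarith [hi z (sphere_subset_closedBall hz)]

theorem injOn_of_tendstoLocallyUniformlyOn (hU : IsOpen U) (hc : IsPreconnected U)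
    (hF : TendstoLocallyUniformlyOn F f l U) (hd : ∀ i, DifferentiableOn ℂ (F i) U)
    (hinj : ∀ i, InjOn (F i) U) (hf : ∃ z ∈ U, ∃ w ∈ U, f z ≠ f w) : InjOn f U := by
  intro z hz w hw hzw
  by_contra hne
  have hfd : DifferentiableOn ℂ f U := hF.differentiableOn (.of_forall hd) hU
  obtain ⟨r, hr, hrU⟩ := Metric.isOpen_iff.1 hU z hz
  have hρ : 0 < min r (dist z w) := lt_min hr (dist_pos.2 hne)
  have hsub : ball z (min r (dist z w)) ⊆ U := (ball_subset_ball (min_le_left _ _)).trans hrU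
  have hwn : w ∉ ball z (min r (dist z w)) := by
    rw [mem_ball, dist_comm, not_lt]
    exact min_le_right _ _
  have hsubF : TendstoLocallyUniformlyOn (fun i x => F i x - F i w) (fun x => f x - f w) l
      (ball z (min r (dist z w))) := by
    have hconst : TendstoLocallyUniformlyOn (fun i (_ : ℂ) => F i w) (fun _ => f w) l
        (ball z (min r (dist z w))) :=
      ((hF.tendsto_at hw).tendstoUniformlyOn_const _).tendstoLocallyUniformlyOn
    simpa [Pi.sub_def] using! (hF.mono hsub).sub hconst
  refine ne_zero_of_tendstoLocallyUniformlyOn isOpen_ball (convex_ball z _).isPreconnected hsubF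
    (fun i => ((hd i).mono hsub).sub_const _) (fun i x hx h0 => ?_) ?_ z (mem_ball_self hρ)
    (by rw [hzw, sub_self])
  · exact hwn (hinj i (hsub hx) hw (sub_eq_zero.1 h0) ▸ hx)
  · by_contra! hall
    obtain ⟨a, ha, b, hb, hab⟩ := hf
    have han : AnalyticOnNhd ℂ (fun x => f x - f w) U := (hfd.sub_const (f w)).analyticOnNhd hU
    have hconst := han.eqOn_zero_of_preconnected_of_eventuallyEq_zero hc hz
      (mem_of_superset (ball_mem_nhds z hρ) hall)
    exact hab ((sub_eq_zero.1 (hconst ha)).trans (sub_eq_zero.1 (hconst hb)).symm)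

end Hurwitz

section Montel

variable {E : Type*} [NormedAddCommGroup E] [ProperSpace E]

theorem isCompact_setOf_norm_le_of_dist_le {X : Type*} [PseudoMetricSpace X] {R K : X → ℝ}
    (hR : ∀ x, 0 < R x) (M : ℝ) :
    IsCompact {g : C(X, E) | (∀ x, ‖g x‖ ≤ M) ∧
      ∀ x y, dist y x < R x → dist (g y) (g x) ≤ K x * dist y x} := by
  have hlim (x : X) : Tendsto (fun y => K x * dist y x) (𝓝 x) (𝓝 0) := by
    have hcont : Continuous fun y => K x * dist y x := by fun_prop
    simpa using hcont.tendsto x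
  refine ArzelaAscoli.isCompact_of_equicontinuous _ ?_ fun x => ?_
  · have himage : ContinuousMap.toFun '' {g : C(X, E) | (∀ x, ‖g x‖ ≤ M) ∧
          ∀ x y, dist y x < R x → dist (g y) (g x) ≤ K x * dist y x} =
        univ.pi (fun _ => closedBall (0 : E) M) ∩
          ⋂ x, ⋂ y, ⋂ (_ : dist y x < R x), {g : X → E | dist (g y) (g x) ≤ K x * dist y x} := by
      ext g
      simp only [mem_image, mem_ofPred_eq, mem_inter_iff, Set.mem_pi, mem_univ, true_implies,
        mem_closedBall_zero_iff, mem_iInter]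
      refine ⟨?_, fun hg => ⟨⟨g, continuous_iff_continuousAt.2 fun x => ?_⟩, hg, rfl⟩⟩
      · rintro ⟨g, hg, rfl⟩
        exact hg
      · rw [ContinuousAt, tendsto_iff_dist_tendsto_zero]
        exact squeeze_zero' (.of_forall fun _ => dist_nonneg)
          (Filter.mem_of_superset (ball_mem_nhds x (hR x)) fun y hy => hg.2 x y hy) (hlim x)
    rw [himage]
    refine (isCompact_univ_pi fun _ => isCompact_closedBall _ _).inter_right
      (isClosed_iInter fun x => isClosed_iInter fun y => isClosed_iInter fun _ => ?_)
    exact isClosed_le (by fun_prop) continuous_const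
  · rw [Metric.equicontinuousAt_iff_right]
    intro ε hε
    filter_upwards [ball_mem_nhds x (hR x), (hlim x).eventually_lt_const hε] with y hy hyε g
    rw [dist_comm]
    exact (g.2.2 x y hy).trans_lt hyε

/- The Schwarz lemma makes a bounded family locally uniformly Lipschitz. -/
theorem exists_tendstoLocallyUniformlyOn_of_norm_le [NormedSpace ℂ E] {ι : Type*} {l₀ : Filter ι}
    [l₀.NeBot] {U : Set ℂ} (hU : IsOpen U) {F : ι → ℂ → E} {M : ℝ}
    (hd : ∀ i, DifferentiableOn ℂ (F i) U) (hb : ∀ i, ∀ z ∈ U, ‖F i z‖ ≤ M) :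
    ∃ (l : Ultrafilter ι) (f : ℂ → E), (l : Filter ι) ≤ l₀ ∧
      TendstoLocallyUniformlyOn F f l U := by
  choose R hR hRU using fun x : U => Metric.isOpen_iff.1 hU x x.2
  let G (i : ι) : C(U, E) := ⟨fun x => F i x, (hd i).continuousOn.domRestrict⟩
  have hG (i : ι) : G i ∈ {g : C(U, E) | (∀ x, ‖g x‖ ≤ M) ∧
      ∀ x y, dist y x < R x → dist (g y) (g x) ≤ 2 * M / R x * dist y x} := by
    refine ⟨fun x => hb i x x.2, fun x y hy => ?_⟩
    refine dist_le_div_mul_dist_of_mapsTo_ball ((hd i).mono (hRU x)) (fun z hz => ?_) hy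
    rw [mem_closedBall, dist_eq_norm]
    linarith [norm_sub_le (F i z) (F i x), hb i z (hRU x hz), hb i x x.2]
  obtain ⟨g, -, hg⟩ := (isCompact_setOf_norm_le_of_dist_le hR M).exists_mapClusterPt
    (f := l₀) (u := G) (tendsto_principal.2 (.of_forall hG))
  obtain ⟨l, hl, hlg⟩ := mapClusterPt_iff_ultrafilter.1 hg
  have := hU.locallyCompactSpace
  rw [ContinuousMap.tendsto_iff_tendstoLocallyUniformly] at hlg
  classical
  refine ⟨l, fun z => if h : z ∈ U then g ⟨z, h⟩ else 0, hl, ?_⟩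
  rw [tendstoLocallyUniformlyOn_iff_tendstoLocallyUniformly_comp_coe]
  convert hlg using 1
  · rfl
  · ext z
    simp

end Montel

/-! ### Riemann maps -/

/-- The automorphism of the unit disc that moves `w` to the origin. -/
noncomputable def discMobius (w z : ℂ) : ℂ := (z - w) / (1 - conj w * z)

section DiscMobius

variable {w z : ℂ}

@[simp]
lemma discMobius_self (w : ℂ) : discMobius w w = 0 := by simp [discMobius]

lemma discMobius_zero (w : ℂ) : discMobius w 0 = -w := by simp [discMobius]

lemma norm_one_sub_conj_mul_self (hw : ‖w‖ < 1) : ‖1 - conj w * w‖ = 1 - ‖w‖ ^ 2 := by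
  rw [mul_comm, mul_conj, normSq_eq_norm_sq, ← ofReal_one, ← ofReal_sub, norm_real,
    Real.norm_of_nonneg]
  nlinarith [norm_nonneg w]

lemma one_sub_conj_mul_ne_zero (hw : ‖w‖ < 1) (hz : ‖z‖ < 1) : 1 - conj w * z ≠ 0 := by
  intro h
  have hnorm := congrArg norm (sub_eq_zero.1 h).symm
  rw [norm_mul, RCLike.norm_conj, norm_one] at hnorm
  exact (mul_lt_one_of_nonneg_of_lt_one_left (norm_nonneg w) hw hz.le).ne hnorm

lemma norm_discMobius_lt_one (hw : ‖w‖ < 1) (hz : ‖z‖ < 1) : ‖discMobius w z‖ < 1 := by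
  rw [discMobius, norm_div, div_lt_one (norm_pos_iff.2 (one_sub_conj_mul_ne_zero hw hz))]
  refine lt_of_pow_lt_pow_left₀ 2 (norm_nonneg _) ?_
  have hw2 : ‖w‖ ^ 2 < 1 := by nlinarith [norm_nonneg w]
  have hz2 : ‖z‖ ^ 2 < 1 := by nlinarith [norm_nonneg z]
  rw [← normSq_eq_norm_sq, normSq_apply] at hw2 hz2
  rw [← normSq_eq_norm_sq, ← normSq_eq_norm_sq, normSq_apply, normSq_apply]
  simp only [sub_re, sub_im, one_re, one_im, mul_re, mul_im, conj_re, conj_im]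
  nlinarith

lemma hasDerivAt_discMobius (hw : ‖w‖ < 1) (hz : ‖z‖ < 1) :
    HasDerivAt (discMobius w) ((1 - conj w * w) / (1 - conj w * z) ^ 2) z := by
  refine (((hasDerivAt_id z).sub_const w).div (((hasDerivAt_id z).const_mul (conj w)).const_sub 1)
    (one_sub_conj_mul_ne_zero hw hz)).congr_deriv ?_
  simp only [id]
  ring

lemma injOn_discMobius (hw : ‖w‖ < 1) : InjOn (discMobius w) (ball 0 1) := by
  intro a ha b hb hab
  rw [mem_ball_zero_iff] at ha hb
  rw [discMobius, discMobius, div_eq_div_iff (one_sub_conj_mul_ne_zero hw ha)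
    (one_sub_conj_mul_ne_zero hw hb)] at hab
  have hprod : (1 - conj w * w) * (a - b) = 0 := by linear_combination hab
  exact sub_eq_zero.1 ((mul_eq_zero.1 hprod).resolve_left (one_sub_conj_mul_ne_zero hw hw))

end DiscMobius

lemma hasDerivAt_of_eventually_comp_eq {𝕜 : Type*} [NontriviallyNormedField 𝕜] [CompleteSpace 𝕜]
    {f κ G : 𝕜 → 𝕜} {z f' G' : 𝕜} (hκ : ContinuousAt κ z) (hf : HasStrictDerivAt f f' (κ z))
    (hf' : f' ≠ 0) (hG : HasDerivAt G G' z) (h : ∀ᶠ x in 𝓝 z, f (κ x) = G x) :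
    HasDerivAt κ (f'⁻¹ * G') z := by
  have hinv := (hf.to_localInverse hf').hasDerivAt
  rw [h.self_of_nhds] at hinv
  refine (hinv.comp z hG).congr_of_eventuallyEq ?_
  filter_upwards [h, hκ.eventually (hf.eventually_left_inverse hf')] with x hx hκx
  rw [Function.comp_apply, ← hx, hκx]

/-- `φ` maps `U` conformally onto a subset of the unit disc. Holomorphy is part of `deriv_ne`, since
`deriv` vanishes where the function is not differentiable. -/
structure IsConformalIntoDisc (U : Set ℂ) (φ : ℂ → ℂ) : Prop where
  mapsTo : MapsTo φ U (ball 0 1)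
  injOn : InjOn φ U
  deriv_ne : ∀ z ∈ U, deriv φ z ≠ 0

namespace IsConformalIntoDisc

variable {U : Set ℂ} {φ : ℂ → ℂ}

lemma norm_lt_one (hφ : IsConformalIntoDisc U φ) {z : ℂ} (hz : z ∈ U) : ‖φ z‖ < 1 :=
  mem_ball_zero_iff.1 (hφ.mapsTo hz)

lemma hasDerivAt (hφ : IsConformalIntoDisc U φ) {z : ℂ} (hz : z ∈ U) :
    HasDerivAt φ (deriv φ z) z :=
  (differentiableAt_of_deriv_ne_zero (hφ.deriv_ne z hz)).hasDerivAt

lemma differentiableOn (hφ : IsConformalIntoDisc U φ) : DifferentiableOn ℂ φ U := fun _ hz =>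
  (hφ.hasDerivAt hz).differentiableAt.differentiableWithinAt

lemma hasDerivAt_discMobius_comp (hφ : IsConformalIntoDisc U φ) {w z : ℂ} (hw : ‖w‖ < 1)
    (hz : z ∈ U) : HasDerivAt (discMobius w ∘ φ)
      ((1 - conj w * w) / (1 - conj w * φ z) ^ 2 * deriv φ z) z :=
  (hasDerivAt_discMobius hw (hφ.norm_lt_one hz)).comp z (hφ.hasDerivAt hz)

lemma discMobius_comp (hφ : IsConformalIntoDisc U φ) {w : ℂ} (hw : ‖w‖ < 1) :
    IsConformalIntoDisc U (discMobius w ∘ φ) where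
  mapsTo _ hz := mem_ball_zero_iff.2 (norm_discMobius_lt_one hw (hφ.norm_lt_one hz))
  injOn := (injOn_discMobius hw).comp hφ.injOn hφ.mapsTo
  deriv_ne z hz := by
    rw [(hφ.hasDerivAt_discMobius_comp hw hz).deriv]
    exact mul_ne_zero (div_ne_zero (one_sub_conj_mul_ne_zero hw hw)
      (pow_ne_zero _ (one_sub_conj_mul_ne_zero hw (hφ.norm_lt_one hz)))) (hφ.deriv_ne z hz)

lemma const_mul (hφ : IsConformalIntoDisc U φ) {ε : ℂ} (hε : ‖ε‖ = 1) :
    IsConformalIntoDisc U fun z => ε * φ z where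
  mapsTo z hz := by simpa [hε] using hφ.norm_lt_one hz
  injOn a ha b hb h :=
    hφ.injOn ha hb (mul_left_cancel₀ (norm_ne_zero_iff.1 (hε.trans_ne one_ne_zero)) h)
  deriv_ne z hz := by
    rw [((hφ.hasDerivAt hz).const_mul ε).deriv]
    exact mul_ne_zero (norm_ne_zero_iff.1 (hε.trans_ne one_ne_zero)) (hφ.deriv_ne z hz)

lemma exists_sq_eq (hU : IsOpen U) (hUc : IsSimplyConnected U) (hφ : IsConformalIntoDisc U φ)
    (hne : ∀ z ∈ U, φ z ≠ 0) : ∃ κ, IsConformalIntoDisc U κ ∧ ∀ z, κ z ^ 2 = φ z := by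
  obtain ⟨κ, hκc, hκ⟩ := exists_continuousOn_pow_eq hUc hU hφ.differentiableOn.continuousOn
    (by rintro ⟨z, hz, h⟩; exact hne z hz h) two_ne_zero
  refine ⟨κ, ⟨fun z hz => ?_, fun a ha b hb hab => ?_, fun z hz => ?_⟩, hκ⟩
  · have hsq : ‖κ z‖ ^ 2 < 1 := by
      rw [← norm_pow, hκ z]
      exact hφ.norm_lt_one hz
    exact mem_ball_zero_iff.2 ((sq_lt_one_iff₀ (norm_nonneg _)).1 hsq)
  · exact hφ.injOn ha hb (by rw [← hκ a, ← hκ b, hab])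
  · have hκz : 2 * κ z ≠ 0 := by
      refine mul_ne_zero two_ne_zero fun h => hne z hz ?_
      rw [← hκ z, h, zero_pow two_ne_zero]
    have hsq : HasStrictDerivAt (fun x : ℂ => x ^ 2) (2 * κ z) (κ z) := by
      simpa using hasStrictDerivAt_pow 2 (κ z)
    rw [(hasDerivAt_of_eventually_comp_eq (hκc.continuousAt (hU.mem_nhds hz)) hsq hκz
      (hφ.hasDerivAt hz) (.of_forall hκ)).deriv]
    exact mul_ne_zero (inv_ne_zero hκz) (hφ.deriv_ne z hz)

/- Koebe's trick: a square root composed with disc automorphisms on both sides is expanding. -/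
lemma exists_norm_deriv_lt (hU : IsOpen U) (hUc : IsSimplyConnected U)
    (hφ : IsConformalIntoDisc U φ) {z₀ w : ℂ} (h0 : z₀ ∈ U) (hz₀ : φ z₀ = 0) (hw : ‖w‖ < 1)
    (hwφ : ∀ z ∈ U, φ z ≠ w) :
    ∃ Φ, IsConformalIntoDisc U Φ ∧ Φ z₀ = 0 ∧ ‖deriv φ z₀‖ < ‖deriv Φ z₀‖ := by
  obtain ⟨κ, hκ, hsq⟩ := exists_sq_eq hU hUc (hφ.discMobius_comp hw) fun z hz =>
    div_ne_zero (sub_ne_zero.2 (hwφ z hz)) (one_sub_conj_mul_ne_zero hw (hφ.norm_lt_one hz))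
  have hk1 : ‖κ z₀‖ < 1 := hκ.norm_lt_one h0
  have hkw : ‖κ z₀‖ ^ 2 = ‖w‖ := by
    rw [← norm_pow, hsq, Function.comp_apply, hz₀, discMobius_zero, norm_neg]
  have hk0 : 0 < ‖κ z₀‖ := by
    refine norm_pos_iff.2 fun h => hwφ z₀ h0 ?_
    rw [hz₀, eq_comm, ← norm_eq_zero, ← hkw, h, norm_zero, zero_pow two_ne_zero]
  refine ⟨discMobius (κ z₀) ∘ κ, hκ.discMobius_comp hk1, discMobius_self _, ?_⟩
  have hκ' : 2 * ‖κ z₀‖ * ‖deriv κ z₀‖ = (1 - ‖κ z₀‖ ^ 4) * ‖deriv φ z₀‖ := by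
    have hderiv := ((hκ.hasDerivAt h0).pow 2).unique
      ((hφ.hasDerivAt_discMobius_comp hw h0).congr_of_eventuallyEq (.of_forall hsq))
    simpa [hz₀, norm_one_sub_conj_mul_self hw, ← hkw, ← pow_mul] using congrArg norm hderiv
  have hΦ' : ‖deriv (discMobius (κ z₀) ∘ κ) z₀‖ * (1 - ‖κ z₀‖ ^ 2) = ‖deriv κ z₀‖ := by
    have hpos : 1 - ‖κ z₀‖ ^ 2 ≠ 0 := by nlinarith
    rw [(hκ.hasDerivAt_discMobius_comp hk1 h0).deriv, norm_mul, norm_div, norm_pow,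
      norm_one_sub_conj_mul_self hk1]
    field_simp
  have hφ' : 0 < ‖deriv φ z₀‖ := norm_pos_iff.2 (hφ.deriv_ne z₀ h0)
  have hratio : 2 * ‖κ z₀‖ * ‖deriv (discMobius (κ z₀) ∘ κ) z₀‖ =
      (1 + ‖κ z₀‖ ^ 2) * ‖deriv φ z₀‖ := by
    have hpos : 1 - ‖κ z₀‖ ^ 2 ≠ 0 := by nlinarith
    refine mul_right_cancel₀ hpos ?_
    linear_combination 2 * ‖κ z₀‖ * hΦ' + hκ'
  have hamgm : 2 * ‖κ z₀‖ * ‖deriv φ z₀‖ < (1 + ‖κ z₀‖ ^ 2) * ‖deriv φ z₀‖ := by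
    gcongr
    nlinarith
  exact lt_of_mul_lt_mul_left (hratio ▸ hamgm) (by positivity)

end IsConformalIntoDisc

namespace IsConformalIntoDisc

variable {U : Set ℂ} {φ : ℂ → ℂ} {z₀ : ℂ} {r : ℝ}

lemma norm_deriv_le_one_div (hφ : IsConformalIntoDisc U φ) (hz₀ : φ z₀ = 0) (hr : 0 < r)
    (hrU : ball z₀ r ⊆ U) : ‖deriv φ z₀‖ ≤ 1 / r :=
  norm_deriv_le_div_of_mapsTo_ball (hφ.differentiableOn.mono hrU)
    (fun _ hz => hz₀ ▸ ball_subset_closedBall (hφ.mapsTo (hrU hz))) hr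

lemma of_tendstoLocallyUniformlyOn {ι : Type*} {l : Filter ι} [l.NeBot] {F : ι → ℂ → ℂ}
    (hU : IsOpen U) (hc : IsPreconnected U) (hF : ∀ i, IsConformalIntoDisc U (F i))
    (hlim : TendstoLocallyUniformlyOn F φ l U) (h0 : z₀ ∈ U) (hd0 : deriv φ z₀ ≠ 0) :
    IsConformalIntoDisc U φ := by
  have hd (i : ι) : DifferentiableOn ℂ (F i) U := (hF i).differentiableOn
  have hφ : DifferentiableOn ℂ φ U := hlim.differentiableOn (.of_forall hd) hU
  have hle (z : ℂ) (hz : z ∈ U) : ‖φ z‖ ≤ 1 :=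
    le_of_tendsto (hlim.tendsto_at hz).norm (.of_forall fun i => ((hF i).norm_lt_one hz).le)
  have hnonconst (c : ℂ) : ∃ z ∈ U, φ z ≠ c := by
    by_contra! h
    have hc : φ =ᶠ[𝓝 z₀] fun _ => c := Filter.mem_of_superset (hU.mem_nhds h0) h
    exact hd0 (by rw [hc.deriv_eq, deriv_const])
  refine ⟨fun z hz => mem_ball_zero_iff.2 ((hle z hz).lt_of_ne fun h => ?_), ?_, ?_⟩
  · obtain ⟨y, hy, hyz⟩ := hnonconst (φ z)
    refine hyz (eqOn_of_isPreconnected_of_isMaxOn_norm hc hU hφ hz (fun y hy => ?_) hy)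
    simpa only [Function.comp_apply, mem_ofPred_eq, h] using hle y hy
  · obtain ⟨y, hy, hyz⟩ := hnonconst (φ z₀)
    exact injOn_of_tendstoLocallyUniformlyOn hU hc hlim hd (fun i => (hF i).injOn)
      ⟨y, hy, z₀, h0, hyz⟩
  · exact ne_zero_of_tendstoLocallyUniformlyOn hU hc (hlim.deriv (.of_forall hd) hU)
      (fun i => (hd i).deriv hU) (fun i => (hF i).deriv_ne) ⟨z₀, h0, hd0⟩

lemma exists_forall_norm_deriv_le (hU : IsOpen U) (hc : IsPreconnected U) (h0 : z₀ ∈ U)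
    (hne : ∃ φ, IsConformalIntoDisc U φ) :
    ∃ φ, IsConformalIntoDisc U φ ∧ φ z₀ = 0 ∧
      ∀ Φ, IsConformalIntoDisc U Φ → Φ z₀ = 0 → ‖deriv Φ z₀‖ ≤ ‖deriv φ z₀‖ := by
  obtain ⟨r, hr, hrU⟩ := Metric.isOpen_iff.1 hU z₀ h0
  let A : Set ℝ := {x | ∃ Φ, IsConformalIntoDisc U Φ ∧ Φ z₀ = 0 ∧ ‖deriv Φ z₀‖ = x}
  have hbdd : BddAbove A := by
    refine ⟨1 / r, ?_⟩
    rintro _ ⟨Φ, hΦ, hΦ0, rfl⟩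
    exact hΦ.norm_deriv_le_one_div hΦ0 hr hrU
  obtain ⟨Φ₀, hΦ₀⟩ := hne
  have hΦ₀' : IsConformalIntoDisc U (discMobius (Φ₀ z₀) ∘ Φ₀) :=
    hΦ₀.discMobius_comp (hΦ₀.norm_lt_one h0)
  obtain ⟨x, -, hx, hxA⟩ := exists_seq_tendsto_sSup
    (show A.Nonempty from ⟨_, _, hΦ₀', discMobius_self _, rfl⟩) hbdd
  choose F hF hF0 hFx using hxA
  have hd (n : ℕ) : DifferentiableOn ℂ (F n) U := (hF n).differentiableOn
  obtain ⟨l, φ, hl, hlim⟩ := exists_tendstoLocallyUniformlyOn_of_norm_le (l₀ := atTop) hU hd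
    fun n z hz => ((hF n).norm_lt_one hz).le
  have hderiv : ‖deriv φ z₀‖ = sSup A := by
    refine tendsto_nhds_unique ((hlim.deriv (.of_forall hd) hU).tendsto_at h0).norm
      ((hx.mono_left hl).congr fun n => ?_)
    rw [Function.comp_apply, hFx]
  have hmax (Φ : ℂ → ℂ) (hΦ : IsConformalIntoDisc U Φ) (hΦ0 : Φ z₀ = 0) :
      ‖deriv Φ z₀‖ ≤ ‖deriv φ z₀‖ := hderiv ▸ le_csSup hbdd ⟨Φ, hΦ, hΦ0, rfl⟩
  refine ⟨φ, of_tendstoLocallyUniformlyOn hU hc hF hlim h0 ?_, ?_, hmax⟩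
  · exact norm_pos_iff.1 ((norm_pos_iff.2 (hΦ₀'.deriv_ne z₀ h0)).trans_le
      (hmax _ hΦ₀' (discMobius_self _)))
  · refine tendsto_nhds_unique (hlim.tendsto_at h0) ?_
    simp only [hF0, tendsto_const_nhds]

theorem exists_surjOn (hU : IsOpen U) (hUc : IsSimplyConnected U) (h0 : z₀ ∈ U)
    (hne : ∃ φ, IsConformalIntoDisc U φ) :
    ∃ φ, IsConformalIntoDisc U φ ∧ φ z₀ = 0 ∧ SurjOn φ U (ball 0 1) := by
  obtain ⟨φ, hφ, hφ0, hmax⟩ := exists_forall_norm_deriv_le hU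
    hUc.isPathConnected.isConnected.isPreconnected h0 hne
  refine ⟨φ, hφ, hφ0, fun w hw => ?_⟩
  by_contra hwφ
  obtain ⟨Φ, hΦ, hΦ0, hlt⟩ := hφ.exists_norm_deriv_lt hU hUc h0 hφ0 (mem_ball_zero_iff.1 hw)
    (fun z hz h => hwφ ⟨z, hz, h⟩)
  exact (hmax Φ hΦ hΦ0).not_gt hlt

theorem exists_surjOn_deriv_pos (hU : IsOpen U) (hUc : IsSimplyConnected U) (h0 : z₀ ∈ U)
    (hne : ∃ φ, IsConformalIntoDisc U φ) :
    ∃ φ, IsConformalIntoDisc U φ ∧ φ z₀ = 0 ∧ SurjOn φ U (ball 0 1) ∧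
      ∃ t : ℝ, 0 < t ∧ deriv φ z₀ = t := by
  obtain ⟨φ, hφ, hφ0, hsurj⟩ := exists_surjOn hU hUc h0 hne
  have hd0 := hφ.deriv_ne z₀ h0
  set ε : ℂ := ‖deriv φ z₀‖ / deriv φ z₀ with hε
  have hεn : ‖ε‖ = 1 := by simp [hε, hd0]
  have hε0 : ε ≠ 0 := norm_ne_zero_iff.1 (hεn.trans_ne one_ne_zero)
  refine ⟨fun z => ε * φ z, hφ.const_mul hεn, by simp only [hφ0, mul_zero], fun w hw => ?_,
    ‖deriv φ z₀‖, norm_pos_iff.2 hd0, ?_⟩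
  · obtain ⟨z, hz, hzw⟩ := hsurj (show ε⁻¹ * w ∈ ball 0 1 by simpa [hεn] using hw)
    exact ⟨z, hz, by simp only [hzw, mul_inv_cancel_left₀ hε0]⟩
  · rw [((hφ.hasDerivAt h0).const_mul ε).deriv, hε, div_mul_cancel₀ _ hd0]

lemma exists_inverse (hU : IsOpen U) (hφ : IsConformalIntoDisc U φ)
    (hsurj : SurjOn φ U (ball 0 1)) :
    ∃ ψ : ℂ → ℂ, MapsTo ψ (ball 0 1) U ∧ InvOn ψ φ U (ball 0 1) ∧
      ∀ w ∈ ball (0 : ℂ) 1, HasDerivAt ψ (deriv φ (ψ w))⁻¹ w := by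
  have hinv : InvOn (Function.invFunOn φ U) φ U (ball 0 1) :=
    BijOn.invOn_invFunOn ⟨hφ.mapsTo, hφ.injOn, hsurj⟩
  refine ⟨_, hsurj.mapsTo_invFunOn, hinv, fun w hw => ?_⟩
  have hz := hsurj.mapsTo_invFunOn hw
  have hstrict := ((hφ.differentiableOn.analyticOnNhd hU) _ hz).hasStrictDerivAt
  have := hstrict.to_local_left_inverse (hφ.deriv_ne _ hz)
    (Filter.mem_of_superset (hU.mem_nhds hz) hinv.1)
  rw [hinv.2 hw] at this
  exact this.hasDerivAt

end IsConformalIntoDisc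

open IsConformalIntoDisc in
theorem exists_riemann_map {U : Set ℂ} (hU : IsOpen U) (hUc : IsSimplyConnected U)
    (hne : ∃ φ, IsConformalIntoDisc U φ) {z₀ : ℂ} {r : ℝ} (hr : 0 < r) (hrU : ball z₀ r ⊆ U) :
    ∃ ψ φ : ℂ → ℂ, ContinuousOn φ U ∧ MapsTo ψ (ball 0 1) U ∧ MapsTo φ U (ball 0 1) ∧
      InvOn ψ φ U (ball 0 1) ∧ (∀ w ∈ ball (0 : ℂ) 1, deriv ψ w ≠ 0) ∧ ψ 0 = z₀ ∧
      ∃ t : ℝ, r ≤ t ∧ deriv ψ 0 = t := by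
  have h0 : z₀ ∈ U := hrU (mem_ball_self hr)
  obtain ⟨φ, hφ, hφ0, hφs, t, ht, hφt⟩ := exists_surjOn_deriv_pos hU hUc h0 hne
  obtain ⟨ψ, hψU, hinv, hψd⟩ := hφ.exists_inverse hU hφs
  have hψ0 : ψ 0 = z₀ := hφ0 ▸ hinv.1 h0
  refine ⟨ψ, φ, hφ.differentiableOn.continuousOn, hψU, hφ.mapsTo, hinv, fun w hw => ?_, hψ0,
    t⁻¹, ?_, ?_⟩
  · rw [(hψd w hw).deriv]
    exact inv_ne_zero (hφ.deriv_ne _ (hψU hw))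
  · have hle := hφ.norm_deriv_le_one_div hφ0 hr hrU
    rwa [hφt, norm_real, Real.norm_of_nonneg ht.le, one_div, le_inv_comm₀ ht hr] at hle
  · rw [(hψd 0 (mem_ball_self one_pos)).deriv, hψ0, hφt, ofReal_inv]

/-! ### Exhaustion of a convex image -/

open scoped Pointwise in
theorem exists_convex_between_isCompact_isOpen {E : Type*} [NormedAddCommGroup E]
    [NormedSpace ℝ E] [ProperSpace E] {K Ω : Set E} (hK : IsCompact K) (hΩ : IsOpen Ω)
    (hc : Convex ℝ Ω) (hKΩ : K ⊆ Ω) :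
    ∃ Ω', IsOpen Ω' ∧ Convex ℝ Ω' ∧ K ⊆ Ω' ∧ IsCompact (closure Ω') ∧ closure Ω' ⊆ Ω := by
  obtain ⟨δ, hδ, hδΩ⟩ := hK.exists_thickening_subset_open hΩ hKΩ
  have hhull : thickening δ (convexHull ℝ K) ⊆ Ω := by
    rw [← add_ball_zero, ← (convex_ball (0 : E) δ).convexHull_eq, ← convexHull_add, add_ball_zero]
    exact convexHull_min hδΩ hc
  refine ⟨thickening (δ / 2) (convexHull ℝ K), isOpen_thickening,
    (convex_convexHull ℝ K).thickening _,
    (subset_convexHull ℝ K).trans (self_subset_thickening (half_pos hδ) _),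
    isCompact_of_isClosed_isBounded isClosed_closure
      (isBounded_convexHull.2 hK.isBounded).thickening.closure, ?_⟩
  exact (closure_thickening_subset_cthickening _ _).trans
    ((cthickening_subset_thickening' hδ (half_lt_self hδ) _).trans hhull)

lemma exists_openPartialHomeomorph_of_injOn {X Y : Type*} [TopologicalSpace X]
    [TopologicalSpace Y] [Nonempty X] {f : X → Y} {U : Set X} (hU : IsOpen U) (hinj : InjOn f U)
    (hf : ∀ x ∈ U, Filter.map f (𝓝 x) = 𝓝 (f x)) :
    ∃ e : OpenPartialHomeomorph X Y, e.source = U ∧ e.target = f '' U ∧ ⇑e = f := by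
  have hcont : ContinuousOn f U := fun x hx =>
    ContinuousAt.continuousWithinAt (show Tendsto f (𝓝 x) (𝓝 (f x)) from (hf x hx).le)
  refine ⟨.ofContinuousOpenRestrict (hinj.toPartialEquiv f U) hcont ?_ hU, rfl, rfl, rfl⟩
  refine isOpenMap_iff_nhds_le.2 fun x => ?_
  change 𝓝 (f x) ≤ Filter.map (f ∘ Subtype.val) (𝓝 x)
  rw [← Filter.map_map, map_nhds_subtype_coe_eq_nhds x.2 (hU.mem_nhds x.2), hf x x.2]

lemma joinedIn_of_invOn_convex {X E : Type*} [TopologicalSpace X] [AddCommGroup E] [Module ℝ E]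
    [TopologicalSpace E] [ContinuousAdd E] [ContinuousSMul ℝ E] {A : Set X} {Ω P : Set E}
    {f : X → E} {k : E → X} (hΩ : Convex ℝ Ω) (hP : Convex ℝ P) (hf : MapsTo f A Ω)
    (hk : MapsTo k Ω A) (hkc : ContinuousOn k Ω) (hinv : InvOn k f A Ω) :
    ∀ z ∈ {x ∈ A | f x ∈ P}, ∀ w ∈ {x ∈ A | f x ∈ P}, JoinedIn {x ∈ A | f x ∈ P} z w := by
  intro z hz w hw
  have himage : {x ∈ A | f x ∈ P} = k '' (Ω ∩ P) := by
    ext x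
    constructor
    · exact fun hx => ⟨f x, ⟨hf hx.1, hx.2⟩, hinv.1 hx.1⟩
    · rintro ⟨y, hy, rfl⟩
      exact ⟨hk hy.1, (hinv.2 hy.1).symm ▸ hy.2⟩
  rw [himage] at hz hw ⊢
  exact (((hΩ.inter hP).isPathConnected (image_nonempty.1 ⟨z, hz⟩)).image'
    (hkc.mono inter_subset_left)).joinedIn z hz w hw

theorem exists_exhausting_map {E : Type*} [NormedAddCommGroup E] [NormedSpace ℝ E] [ProperSpace E]
    {e : OpenPartialHomeomorph ℂ E} (hs : e.source = ball 0 1) (hc : Convex ℝ e.target) {r : ℝ}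
    (hr0 : 0 < r) (hr1 : r < 1) :
    ∃ (ψ : ℂ → ℂ) (K : Set ℂ), IsConformalIntoDisc (ball 0 1) ψ ∧ IsCompact K ∧ K ⊆ ball 0 1 ∧
      MapsTo ψ (ball 0 1) K ∧ ψ 0 = 0 ∧ (∃ t : ℝ, r ≤ t ∧ deriv ψ 0 = t) ∧
      ∀ P : Set E, Convex ℝ P → ∀ z ∈ {x ∈ ball (0 : ℂ) 1 | e (ψ x) ∈ P},
        ∀ w ∈ {x ∈ ball (0 : ℂ) 1 | e (ψ x) ∈ P},
          JoinedIn {x ∈ ball (0 : ℂ) 1 | e (ψ x) ∈ P} z w := by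
  have hsub : closedBall 0 r ⊆ e.source := hs ▸ closedBall_subset_ball hr1
  obtain ⟨Ω, hΩo, hΩc, hrΩ, hΩcomp, hΩe⟩ := exists_convex_between_isCompact_isOpen
    ((isCompact_closedBall (0 : ℂ) r).image_of_continuousOn (e.continuousOn.mono hsub))
    e.open_target hc (e.mapsTo.mono_left hsub).image_subset
  have hΩe' : Ω ⊆ e.target := subset_closure.trans hΩe
  set U : Set ℂ := e.symm '' Ω with hU
  have hUe : U ⊆ e.source := (e.symm.mapsTo.mono_left hΩe').image_subset
  have hUΩ : MapsTo e U Ω := by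
    rintro _ ⟨w, hw, rfl⟩
    rwa [e.right_inv (hΩe' hw)]
  have hrU : closedBall 0 r ⊆ U := fun z hz =>
    ⟨e z, hrΩ (mem_image_of_mem e hz), e.left_inv (hsub hz)⟩
  have hUsc : IsSimplyConnected U := by
    have := hΩc.contractibleSpace ⟨e 0, hUΩ (hrU (mem_closedBall_self hr0.le))⟩
    have := (e.symm.homeomorphOfImageSubsetSource hΩe' hU.symm).symm.contractibleSpace
    exact inferInstanceAs (SimplyConnectedSpace U)
  obtain ⟨ψ, φ, hφc, hψU, hφU, hinv, hψd, hψ0, ht⟩ := exists_riemann_map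
    (e.symm.isOpen_image_of_subset_source hΩo hΩe') hUsc
    ⟨id, fun z hz => hs ▸ hUe hz, injOn_id _, fun z _ => by simp⟩ hr0
    (ball_subset_closedBall.trans hrU)
  refine ⟨ψ, e.symm '' closure Ω, ⟨fun w hw => hs ▸ hUe (hψU hw), hinv.2.injOn, hψd⟩,
    hΩcomp.image_of_continuousOn (e.symm.continuousOn.mono hΩe),
    hs ▸ (e.symm.mapsTo.mono_left hΩe).image_subset,
    fun w hw => image_mono subset_closure (hψU hw), hψ0, ht, fun P hP => ?_⟩
  have he : InvOn e.symm e U Ω :=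
    ⟨fun z hz => e.left_inv (hUe hz), fun y hy => e.right_inv (hΩe' hy)⟩
  exact joinedIn_of_invOn_convex hΩc hP (hUΩ.comp hψU) (hφU.comp (mapsTo_image _ _))
    (hφc.comp (e.symm.continuousOn.mono hΩe') (mapsTo_image _ _)) (hinv.symm.comp he hψU
      (mapsTo_image _ _))

/-! ### Radial limits and Schwarz' formula -/

lemma ofReal_mul_exp_mem_ball {r : ℝ} (hr : r ∈ Ioo (0 : ℝ) 1) (θ : ℝ) :
    r * exp (θ * I) ∈ ball (0 : ℂ) 1 := by
  rw [mem_ball_zero_iff, norm_mul, norm_exp_ofReal_mul_I, norm_real, Real.norm_of_nonneg hr.1.le,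
    mul_one]
  exact hr.2

lemma eventually_radius_mem_Ioo : ∀ᶠ r : ℝ in 𝓝[<] 1, r ∈ Ioo (0 : ℝ) 1 :=
  Ioo_mem_nhdsLT one_pos

lemma exp_add_two_pi_mul_I (θ : ℝ) : exp ((θ + 2 * Real.pi : ℝ) * I) = exp (θ * I) := by
  rw [← exp_periodic (θ * I)]
  congr 1
  push_cast
  ring

lemma one_sub_norm_le_norm_exp_mul_I_sub (z : ℂ) (θ : ℝ) : 1 - ‖z‖ ≤ ‖exp (θ * I) - z‖ := by
  simpa only [norm_exp_ofReal_mul_I] using norm_sub_norm_le (exp (θ * I)) z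

lemma exp_mul_I_sub_ne_zero {z : ℂ} (hz : ‖z‖ < 1) (θ : ℝ) : exp (θ * I) - z ≠ 0 :=
  norm_pos_iff.1 ((sub_pos.2 hz).trans_le (one_sub_norm_le_norm_exp_mul_I_sub z θ))

namespace HasRadialLimit
variable {X : Type*} [TopologicalSpace X]

lemma add_two_pi_iff {u : ℂ → X} {θ : ℝ} {y : X} :
    HasRadialLimit u (θ + 2 * Real.pi) y ↔ HasRadialLimit u θ y := by
  simp only [HasRadialLimit, exp_add_two_pi_mul_I]

lemma mem_of_isClosed {u : ℂ → X} {θ : ℝ} {y : X} (h : HasRadialLimit u θ y) {s : Set X}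
    (hs : IsClosed s) (hus : MapsTo u (ball 0 1) s) : y ∈ s :=
  hs.mem_of_tendsto h (eventually_radius_mem_Ioo.mono fun _ hr =>
    hus (ofReal_mul_exp_mem_ball hr θ))

end HasRadialLimit

open MeasureTheory in
lemma aestronglyMeasurable_of_hasRadialLimit {X : Type*} [TopologicalSpace X]
    [TopologicalSpace.PseudoMetrizableSpace X] [Nonempty X] {u : ℂ → X}
    (hu : ContinuousOn u (ball 0 1)) {v : ℝ → X} (hv : ∀ᵐ θ, HasRadialLimit u θ (v θ)) :
    AEStronglyMeasurable v := by
  classical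
  let F : ℝ → ℝ → X := fun r θ =>
    if r ∈ Ioo (0 : ℝ) 1 then u (r * exp (θ * I)) else Classical.arbitrary X
  refine aestronglyMeasurable_of_tendsto_ae (𝓝[<] (1 : ℝ)) (f := F) (fun r => ?_) ?_
  · by_cases hr : r ∈ Ioo (0 : ℝ) 1
    · simp only [F, if_pos hr]
      exact (hu.comp_continuous (by fun_prop)
        (ofReal_mul_exp_mem_ball hr)).aestronglyMeasurable
    · simp only [F, if_neg hr]
      exact aestronglyMeasurable_const
  · filter_upwards [hv] with θ hθ
    refine hθ.congr' ?_
    filter_upwards [eventually_radius_mem_Ioo] with r hr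
    simp only [F, if_pos hr]

/-- The kernel of Schwarz' formula for the derivative of a holomorphic function in terms of the
boundary values of its real part. -/
noncomputable def schwarzKernel (z : ℂ) (θ : ℝ) : ℂ := 2 * exp (θ * I) / (exp (θ * I) - z) ^ 2

lemma continuous_schwarzKernel {z : ℂ} (hz : ‖z‖ < 1) : Continuous (schwarzKernel z) :=
  Continuous.div (by fun_prop) (by fun_prop) fun θ => pow_ne_zero _ (exp_mul_I_sub_ne_zero hz θ)

lemma norm_schwarzKernel_le {z : ℂ} (hz : ‖z‖ < 1) (θ : ℝ) :
    ‖schwarzKernel z θ‖ ≤ 2 / (1 - ‖z‖) ^ 2 := by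
  have : 0 < 1 - ‖z‖ := sub_pos.2 hz
  rw [schwarzKernel, norm_div, norm_mul, norm_exp_ofReal_mul_I, norm_pow, norm_ofNat, mul_one]
  gcongr
  exact one_sub_norm_le_norm_exp_mul_I_sub z θ

lemma deriv_eq_circleAverage_re {G : ℂ → ℂ} {R : ℝ} (hR : 1 < R)
    (hG : DifferentiableOn ℂ G (ball 0 R)) {z : ℂ} (hz : z ∈ ball (0 : ℂ) 1) :
    deriv G z = Real.circleAverage
      (fun ζ => (2 * ζ / (ζ - z) ^ 2) • (((G ζ).re : ℝ) : ℂ)) 0 1 := by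
  have hsub : closedBall (0 : ℂ) 1 ⊆ ball 0 R := closedBall_subset_ball hR
  have hGa : AnalyticOnNhd ℂ G (ball 0 R) := hG.analyticOnNhd isOpen_ball
  have hharmonic : InnerProductSpace.HarmonicOnNhd (fun w => (G w).re) (closedBall 0 1) :=
    fun w hw => (hGa w (hsub hw)).harmonicAt_re
  have hcont : ContinuousOn (fun w => (G w).re) (sphere 0 |1|) := by
    rw [abs_one]
    exact continuous_re.comp_continuousOn
      (hG.continuousOn.mono (sphere_subset_closedBall.trans hsub))
  have hint : CircleIntegrable (fun w => (((G w).re : ℝ) : ℂ)) 0 1 :=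
    (continuous_ofReal.comp_continuousOn hcont).circleIntegrable'
  let K : ℂ → ℂ := fun w => Real.circleAverage
    (fun ζ => herglotzRieszKernel 0 w ζ • (((G ζ).re : ℝ) : ℂ)) 0 1
  have hKa : AnalyticOnNhd ℂ K (ball 0 1) :=
    analyticOnNhd_circleAverage_herglotzRieszKernel_smul hint
  have hre : ∀ w ∈ ball (0 : ℂ) 1, (G w - K w).re = 0 := fun w hw => by
    rw [sub_re, re_circleAverage_herglotzRieszKernel_smul hcont.circleIntegrable' hw,
      hharmonic.circleAverage_re_herglotzRieszKernel_smul hw, sub_self]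
  obtain ⟨c, hc⟩ := ((hGa.mono (ball_subset_closedBall.trans hsub)).sub
    hKa).eq_const_of_re_eq_const hre isOpen_ball
    ⟨nonempty_ball.2 one_pos, (convex_ball (0 : ℂ) 1).isPreconnected⟩
  have heq : G =ᶠ[𝓝 z] fun w => K w + c := by
    filter_upwards [isOpen_ball.mem_nhds hz] with w hw
    exact sub_eq_iff_eq_add'.1 (hc w hw)
  rw [heq.deriv_eq]
  exact ((hasDerivAt_circleAverage_herglotzRieszKernel_smul hint hz).add_const c).deriv

lemma mul_deriv_mul_eq_integral_re {G : ℂ → ℂ} (hG : DifferentiableOn ℂ G (ball 0 1)) {z : ℂ}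
    (hz : z ∈ ball (0 : ℂ) 1) {r : ℝ} (hr : r ∈ Ioo (0 : ℝ) 1) :
    r * deriv G (r * z) = (2 * Real.pi)⁻¹ •
      ∫ θ in (0 : ℝ)..2 * Real.pi, schwarzKernel z θ * ((G (r * exp (θ * I))).re : ℂ) := by
  have hR : 1 < 1 / r := (one_lt_div hr.1).2 hr.2
  have hmaps : MapsTo (fun w : ℂ => r * w) (ball 0 (1 / r)) (ball 0 1) := fun w hw => by
    rw [mem_ball_zero_iff, lt_div_iff₀ hr.1] at hw
    rwa [mem_ball_zero_iff, norm_mul, norm_real, Real.norm_of_nonneg hr.1.le, mul_comm]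
  have hformula := deriv_eq_circleAverage_re hR (hG.comp (by fun_prop) hmaps) hz
  have hderiv : HasDerivAt (G ∘ fun w : ℂ => r * w) (deriv G (r * z) * r) z := by
    have hGz := (hG.differentiableAt (isOpen_ball.mem_nhds
      (hmaps (ball_subset_ball hR.le hz)))).hasDerivAt
    simpa using HasDerivAt.comp z hGz ((hasDerivAt_id z).const_mul (r : ℂ))
  rw [hderiv.deriv, mul_comm] at hformula
  rw [hformula, Real.circleAverage_def]
  simp [circleMap, schwarzKernel]

lemma deriv_eq_integral_radial_limit {G : ℂ → ℂ} (hG : DifferentiableOn ℂ G (ball 0 1)) {M : ℝ}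
    (hM : ∀ z ∈ ball (0 : ℂ) 1, |(G z).re| ≤ M) {v : ℝ → ℝ}
    (hv : ∀ᵐ θ, HasRadialLimit (fun z => (G z).re) θ (v θ)) {z : ℂ} (hz : z ∈ ball (0 : ℂ) 1) :
    deriv G z = (2 * Real.pi)⁻¹ •
      ∫ θ in (0 : ℝ)..2 * Real.pi, schwarzKernel z θ * (v θ : ℂ) := by
  have hz1 : ‖z‖ < 1 := mem_ball_zero_iff.1 hz
  have hlhs : Tendsto (fun r : ℝ => r * deriv G (r * z)) (𝓝[<] 1) (𝓝 (deriv G z)) := by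
    have hone : Tendsto (fun r : ℝ => (r : ℂ)) (𝓝[<] 1) (𝓝 1) :=
      tendsto_nhdsWithin_of_tendsto_nhds (continuous_ofReal.tendsto' 1 1 ofReal_one)
    have hcont : ContinuousAt (deriv G) z :=
      (hG.deriv isOpen_ball).continuousOn.continuousAt (isOpen_ball.mem_nhds hz)
    simpa using hone.mul (hcont.tendsto.comp (by simpa using hone.mul_const z))
  have hrhs : Tendsto (fun r : ℝ => (2 * Real.pi)⁻¹ •
      ∫ θ in (0 : ℝ)..2 * Real.pi, schwarzKernel z θ * ((G (r * exp (θ * I))).re : ℂ)) (𝓝[<] 1)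
      (𝓝 ((2 * Real.pi)⁻¹ • ∫ θ in (0 : ℝ)..2 * Real.pi, schwarzKernel z θ * (v θ : ℂ))) := by
    refine Tendsto.const_smul (intervalIntegral.tendsto_integral_filter_of_dominated_convergence
      (fun _ => 2 / (1 - ‖z‖) ^ 2 * M) ?_ ?_ intervalIntegrable_const ?_) _
    · filter_upwards [eventually_radius_mem_Ioo] with r hr
      have hcont : Continuous fun θ : ℝ => G (r * exp (θ * I)) :=
        hG.continuousOn.comp_continuous (by fun_prop) (ofReal_mul_exp_mem_ball hr)
      exact ((continuous_schwarzKernel hz1).mul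
        (continuous_ofReal.comp (continuous_re.comp hcont))).aestronglyMeasurable
    · filter_upwards [eventually_radius_mem_Ioo] with r hr
      refine .of_forall fun θ _ => ?_
      rw [norm_mul, norm_real]
      gcongr
      · exact norm_schwarzKernel_le hz1 θ
      · exact hM _ (ofReal_mul_exp_mem_ball hr θ)
    · filter_upwards [hv] with θ hθ _
      exact ((continuous_ofReal.tendsto _).comp hθ).const_mul _
  refine tendsto_nhds_unique (hlhs.congr' ?_) hrhs
  filter_upwards [eventually_radius_mem_Ioo] with r hr using mul_deriv_mul_eq_integral_re hG hz hr

/-! ### Integrals against monotone functions -/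

section MonotoneIntegral
open MeasureTheory
variable {a b : ℝ} {W W' g : ℝ → ℝ}

lemma setIntegral_deriv_superlevel_nonpos (hW : ∀ x, HasDerivAt W (W' x) x)
    (hW' : Continuous W') (hb : W b = 0) (hpos : ∀ x ∈ Icc a b, 0 ≤ W x) (hg : Monotone g)
    (c : ℝ) : ∫ x in Ioc a b ∩ {x | c < g x}, W' x ≤ 0 := by
  set T := Ioc a b ∩ {x | c < g x}
  rcases T.eq_empty_or_nonempty with hempty | hne
  · simp [hempty]
  have hbdd : BddBelow T := ⟨a, fun x hx => hx.1.1.le⟩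
  have hat : a ≤ sInf T := le_csInf hne fun x hx => hx.1.1.le
  have htb : sInf T ≤ b := (csInf_le hbdd hne.some_mem).trans hne.some_mem.1.2
  have hIoc : Ioc (sInf T) b ⊆ T := fun x hx => by
    obtain ⟨y, hy, hyx⟩ := exists_lt_of_csInf_lt hne hx.1
    exact ⟨⟨hat.trans_lt hx.1, hx.2⟩, hy.2.trans_le (hg hyx.le)⟩
  have hIcc : T ⊆ Icc (sInf T) b := fun x hx => ⟨csInf_le hbdd hx, hx.1.2⟩
  have hae : T =ᵐ[volume] Ioc (sInf T) b :=
    (hIcc.eventuallyLE.trans (Ioc_ae_eq_Icc (μ := volume)).symm.le).antisymm hIoc.eventuallyLE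
  rw [setIntegral_congr_set hae, ← intervalIntegral.integral_of_le htb,
    intervalIntegral.integral_eq_sub_of_hasDerivAt (fun x _ => hW x)
      (hW'.intervalIntegrable _ _), hb, zero_sub]
  exact neg_nonpos.2 (hpos _ ⟨hat, htb⟩)

lemma setIntegral_indicator_lt {A B y : ℝ} (hA : A ≤ y) (hB : y ≤ B) :
    ∫ c in Ioc A B, {x | c < x}.indicator (fun _ => (1 : ℝ)) y = y - A := by
  have hswap : (fun c => {x | c < x}.indicator (fun _ => (1 : ℝ)) y) =
      (Iio y).indicator fun _ => 1 := rfl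
  have hinter : Ioc A B ∩ Iio y = Ioo A y := by
    ext c
    simp only [mem_inter_iff, mem_Ioc, mem_Iio, mem_Ioo]
    exact ⟨fun h => ⟨h.1.1, h.2⟩, fun h => ⟨⟨h.1, h.2.le.trans hB⟩, h.2⟩⟩
  rw [hswap, setIntegral_indicator measurableSet_Iio, hinter]
  simp [measureReal_def, hA]

lemma integrable_uncurry_mul_indicator_lt {k : ℝ → ℝ} (hk : Continuous k) (hg : Measurable g)
    (A B : ℝ) :
    Integrable (Function.uncurry fun x c => k x * {y | c < y}.indicator (fun _ => (1 : ℝ)) (g x))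
      ((volume.restrict (Ioc a b)).prod (volume.restrict (Ioc A B))) := by
  obtain ⟨C, hC⟩ := (isCompact_Icc (a := a) (b := b)).exists_bound_of_continuousOn hk.continuousOn
  have hsuper : MeasurableSet {p : ℝ × ℝ | p.2 < g p.1} :=
    measurableSet_lt measurable_snd (hg.comp measurable_fst)
  have hm : Measurable (Function.uncurry fun x c =>
      k x * {y | c < y}.indicator (fun _ => (1 : ℝ)) (g x)) :=
    (hk.measurable.comp measurable_fst).mul (measurable_const.indicator hsuper)
  rw [Measure.prod_restrict]
  refine Measure.integrableOn_of_bounded (M := C) ?_ hm.aestronglyMeasurable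
    (ae_restrict_of_forall_mem (measurableSet_Ioc.prod measurableSet_Ioc) ?_)
  · rw [Measure.prod_prod]
    exact ENNReal.mul_ne_top (by simp) (by simp)
  · rintro ⟨x, c⟩ ⟨hx, -⟩
    have hCx := hC x (Ioc_subset_Icc_self hx)
    by_cases h : c < g x
    · simpa [h] using hCx
    · simpa [h] using (norm_nonneg _).trans hCx

lemma integral_deriv_mul_monotone_nonpos (hab : a ≤ b) (hW : ∀ x, HasDerivAt W (W' x) x)
    (hW' : Continuous W') (ha : W a = 0) (hb : W b = 0) (hpos : ∀ x ∈ Icc a b, 0 ≤ W x)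
    (hg : Monotone g) : ∫ x in a..b, W' x * g x ≤ 0 := by
  let layer : ℝ → ℝ → ℝ := fun x c => W' x * {y | c < y}.indicator (fun _ => (1 : ℝ)) (g x)
  have hlayer : ∀ c, ∫ x in Ioc a b, layer x c ≤ 0 := fun c => by
    refine le_of_eq_of_le ?_ (setIntegral_deriv_superlevel_nonpos hW hW' hb hpos hg c)
    rw [← setIntegral_indicator (measurableSet_lt measurable_const hg.measurable)]
    exact integral_congr_ae (.of_forall fun x => by by_cases h : c < g x <;> simp [layer, h])
  have hint := integrable_uncurry_mul_indicator_lt (a := a) (b := b) hW' hg.measurable (g a) (g b)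
  have hmean : ∫ x in a..b, W' x * g a = 0 := by
    rw [intervalIntegral.integral_mul_const, intervalIntegral.integral_eq_sub_of_hasDerivAt
      (fun x _ => hW x) (hW'.intervalIntegrable _ _), ha, hb, sub_zero, zero_mul]
  calc ∫ x in a..b, W' x * g x = ∫ x in a..b, W' x * (g x - g a) := by
        simp only [mul_sub]
        rw [intervalIntegral.integral_sub (hg.intervalIntegrable.continuousOn_mul hW'.continuousOn)
          (Continuous.intervalIntegrable (by fun_prop) _ _), hmean, sub_zero]
    _ = ∫ x in Ioc a b, ∫ c in Ioc (g a) (g b), layer x c := by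
        rw [intervalIntegral.integral_of_le hab]
        refine setIntegral_congr_fun measurableSet_Ioc fun x hx => ?_
        simp only [layer]
        rw [integral_const_mul, setIntegral_indicator_lt (hg hx.1.le) (hg hx.2)]
    _ = ∫ c in Ioc (g a) (g b), ∫ x in Ioc a b, layer x c := integral_integral_swap hint
    _ ≤ 0 := integral_nonpos hlayer

end MonotoneIntegral

/-! ### Holomorphic vector fields tangent to the circle -/

/-- `z ↦ -i * tangentField l b z` is a holomorphic vector field which at a point `ζ` of the unit
circle is tangent to the circle, with speed `2 Re (conj l * ζ) + 2 b` in the negative direction. -/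
noncomputable def tangentField (l : ℂ) (b : ℝ) (z : ℂ) : ℂ := l + 2 * b * z + conj l * z ^ 2

/-- The product of the speed of `tangentField l b` on the circle with the Herglotz kernel. -/
noncomputable def herglotzWeight (l : ℂ) (b : ℝ) (z : ℂ) (θ : ℝ) : ℂ :=
  ((2 * (conj l * exp (θ * I)).re + 2 * b : ℝ) : ℂ) * ((exp (θ * I) + z) / (exp (θ * I) - z))

/-- The derivative of the real part of `herglotzWeight`, see `hasDerivAt_herglotzWeight_re`. -/
noncomputable def weightDeriv (l : ℂ) (b : ℝ) (z : ℂ) (θ : ℝ) : ℝ :=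
  -(I * tangentField l b z * schwarzKernel z θ).re

lemma tangentField_neg (l : ℂ) (b : ℝ) (z : ℂ) :
    tangentField (-l) (-b) z = -tangentField l b z := by
  simp only [tangentField, map_neg, ofReal_neg]
  ring

lemma norm_tangentField_le (l : ℂ) {b : ℝ} (hb : |b| ≤ 1) {z : ℂ} (hz : ‖z‖ ≤ 1) :
    ‖tangentField l b z‖ ≤ 2 * (‖l‖ + 1) := by
  refine norm_add₃_le.trans ?_
  simp only [norm_mul, norm_pow, RCLike.norm_conj, norm_real, norm_ofNat, Real.norm_eq_abs]
  have hbz : |b| * ‖z‖ ≤ 1 := mul_le_one₀ hb (norm_nonneg _) hz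
  have hlz : ‖l‖ * ‖z‖ ^ 2 ≤ ‖l‖ :=
    mul_le_of_le_one_right (norm_nonneg _) (pow_le_one₀ (norm_nonneg _) hz)
  linarith

lemma hasDerivAt_herglotzWeight (l : ℂ) (b : ℝ) {z : ℂ} (hz : ‖z‖ < 1) (θ : ℝ) :
    HasDerivAt (herglotzWeight l b z)
      (-(I * tangentField l b z * schwarzKernel z θ) +
        ((2 * (conj l * exp (θ * I)).re : ℝ) : ℂ) * I) θ := by
  have hre : ∀ t : ℝ, ((2 * (conj l * exp (t * I)).re : ℝ) : ℂ) =
      conj l * exp (t * I) + l * (exp (t * I))⁻¹ := fun t => by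
    rw [← add_conj (conj l * exp (t * I)), map_mul, conj_conj, ← exp_conj, ← exp_neg]
    simp
  have hweight : herglotzWeight l b z = fun t : ℝ =>
      (conj l * exp (t * I) + l * (exp (t * I))⁻¹ + 2 * b) *
        ((exp (t * I) + z) / (exp (t * I) - z)) := by
    ext t
    rw [herglotzWeight, ofReal_add, hre]
    push_cast
    ring
  have hexp : HasDerivAt (fun t : ℝ => exp (t * I)) (exp (θ * I) * I) θ := by
    simpa using ((hasDerivAt_id (θ : ℂ)).mul_const I).cexp.comp_ofReal
  have hne := exp_mul_I_sub_ne_zero hz θ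
  have hexp0 := exp_ne_zero (θ * I)
  have hspeed :=
    ((hexp.const_mul (conj l)).add ((hexp.inv hexp0).const_mul l)).add_const (2 * b : ℂ)
  have hkernel := (hexp.add_const z).div (hexp.sub_const z) hne
  rw [hweight, hre]
  refine (hspeed.mul hkernel).congr_deriv ?_
  simp only [Pi.add_apply, Pi.div_apply, Pi.inv_apply, schwarzKernel, tangentField]
  generalize exp (θ * I) = E at *
  field_simp
  ring

lemma hasDerivAt_herglotzWeight_re (l : ℂ) (b : ℝ) {z : ℂ} (hz : ‖z‖ < 1) (θ : ℝ) :
    HasDerivAt (fun t => (herglotzWeight l b z t).re) (weightDeriv l b z θ) θ := by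
  refine (reCLM.hasFDerivAt.comp_hasDerivAt θ
    (hasDerivAt_herglotzWeight l b hz θ)).congr_deriv ?_
  rw [reCLM_apply, add_re, re_ofReal_mul, I_re, mul_zero, add_zero, neg_re, weightDeriv]

lemma re_herglotz_kernel_pos {z : ℂ} (hz : ‖z‖ < 1) (θ : ℝ) :
    0 < ((exp (θ * I) + z) / (exp (θ * I) - z)).re := by
  rw [div_re, ← add_div]
  refine div_pos ?_ (normSq_pos.2 (exp_mul_I_sub_ne_zero hz θ))
  have hE : ‖exp (θ * I)‖ ^ 2 = 1 := by rw [norm_exp_ofReal_mul_I, one_pow]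
  have hz2 : ‖z‖ ^ 2 < 1 := pow_lt_one₀ (norm_nonneg z) hz two_ne_zero
  rw [← normSq_eq_norm_sq, normSq_apply] at hE hz2
  simp only [add_re, sub_re, add_im, sub_im]
  linarith

/-- The field is written in terms of its zeros `exp (p * I)` and `exp (q * I)` on the circle. -/
lemma herglotzWeight_re_eq_sin_mul_sin (p q : ℝ) (z : ℂ) (θ : ℝ) :
    (herglotzWeight (exp (((p + q) / 2 : ℝ) * I)) (-Real.cos ((q - p) / 2)) z θ).re =
      4 * (Real.sin ((θ - p) / 2) * Real.sin ((q - θ) / 2)) *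
        ((exp (θ * I) + z) / (exp (θ * I) - z)).re := by
  have hsum : θ - (p + q) / 2 = (θ - p) / 2 - (q - θ) / 2 := by ring
  have hdiff : (q - p) / 2 = (θ - p) / 2 + (q - θ) / 2 := by ring
  rw [herglotzWeight, re_ofReal_mul, conj_exp_mul_exp_mul_I, exp_ofReal_mul_I_re, hsum, hdiff,
    Real.cos_sub, Real.cos_add]
  ring

lemma continuous_weightDeriv (l : ℂ) (b : ℝ) {z : ℂ} (hz : ‖z‖ < 1) :
    Continuous (weightDeriv l b z) :=
  (continuous_re.comp (continuous_const.mul (continuous_schwarzKernel hz))).neg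

lemma weightDeriv_periodic (l : ℂ) (b : ℝ) (z : ℂ) :
    Function.Periodic (weightDeriv l b z) (2 * Real.pi) := fun θ => by
  simp only [weightDeriv, schwarzKernel, exp_add_two_pi_mul_I]

lemma abs_weightDeriv_le {l : ℂ} (hl : ‖l‖ = 1) {b : ℝ} (hb : |b| ≤ 1) {z : ℂ} (hz : ‖z‖ < 1)
    (θ : ℝ) : |weightDeriv l b z θ| ≤ 8 / (1 - ‖z‖) ^ 2 := by
  have hfield : ‖tangentField l b z‖ ≤ 4 := by
    have := norm_tangentField_le l hb hz.le
    rw [hl] at this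
    linarith
  calc |weightDeriv l b z θ| ≤ ‖tangentField l b z‖ * ‖schwarzKernel z θ‖ := by
        rw [weightDeriv, abs_neg]
        refine (abs_re_le_norm _).trans_eq ?_
        rw [norm_mul, norm_mul, norm_I, one_mul]
    _ ≤ 4 * (2 / (1 - ‖z‖) ^ 2) := by
        gcongr
        exact norm_schwarzKernel_le hz θ
    _ = 8 / (1 - ‖z‖) ^ 2 := by ring

lemma integral_weightDeriv (l : ℂ) (b : ℝ) {z : ℂ} (hz : ‖z‖ < 1) :
    ∫ θ in (0 : ℝ)..2 * Real.pi, weightDeriv l b z θ = 0 := by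
  rw [intervalIntegral.integral_eq_sub_of_hasDerivAt
    (fun θ _ => hasDerivAt_herglotzWeight_re l b hz θ)
    ((continuous_weightDeriv l b hz).intervalIntegrable _ _), sub_eq_zero]
  simp [herglotzWeight]

open MeasureTheory in
lemma im_tangentField_mul_deriv_eq_integral {G : ℂ → ℂ} (hG : DifferentiableOn ℂ G (ball 0 1))
    {M : ℝ} (hM : ∀ z ∈ ball (0 : ℂ) 1, |(G z).re| ≤ M) {v : ℝ → ℝ}
    (hv : ∀ᵐ θ, HasRadialLimit (fun z => (G z).re) θ (v θ)) {z : ℂ} (hz : z ∈ ball (0 : ℂ) 1)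
    (l : ℂ) (b : ℝ) :
    (tangentField l b z * deriv G z).im =
      (2 * Real.pi)⁻¹ * ∫ θ in (0 : ℝ)..2 * Real.pi, weightDeriv l b z θ * v θ := by
  have hz1 := mem_ball_zero_iff.1 hz
  have hvm : AEStronglyMeasurable v :=
    aestronglyMeasurable_of_hasRadialLimit (continuous_re.comp_continuousOn hG.continuousOn) hv
  have hvM : ∀ᵐ θ, ‖(v θ : ℂ)‖ ≤ M := hv.mono fun θ hθ => by
    have hmem : v θ ∈ Icc (-M) M := hθ.mem_of_isClosed isClosed_Icc fun z hz => abs_le.1 (hM z hz)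
    simpa using abs_le.2 hmem
  have hvi : IntervalIntegrable (fun θ => (v θ : ℂ)) volume 0 (2 * Real.pi) := by
    rw [intervalIntegrable_iff]
    exact Measure.integrableOn_of_bounded measure_Ioc_lt_top.ne
      (continuous_ofReal.comp_aestronglyMeasurable hvm) (ae_restrict_of_ae hvM)
  have hint := (hvi.continuousOn_mul
    (continuous_schwarzKernel hz1).continuousOn).const_mul (I * tangentField l b z)
  have hrot : (tangentField l b z * deriv G z).im = -(I * tangentField l b z * deriv G z).re := by
    rw [mul_assoc, mul_comm I, mul_I_re, neg_neg]
  rw [hrot, deriv_eq_integral_radial_limit hG hM hv hz, mul_smul_comm,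
    ← intervalIntegral.integral_const_mul, smul_re, ← reCLM_apply,
    ← reCLM.intervalIntegral_comp_comm hint, smul_eq_mul, ← mul_neg,
    ← intervalIntegral.integral_neg]
  congr 2 with θ
  rw [reCLM_apply, weightDeriv, ← mul_assoc, re_mul_ofReal, neg_mul]

/-! ### Boundary values without interlacing -/

section Clamp
variable {A B x y ε : ℝ}

lemma exists_between_of_clamp_lt_clamp (h : max A (min y B) < max A (min x B)) :
    ∃ c, A < c ∧ y < c ∧ c < x ∧ c < B := by
  have hlt : max A y < min x B := by grind
  obtain ⟨c, hc, hc'⟩ := exists_between hlt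
  exact ⟨c, (max_lt_iff.1 hc).1, (max_lt_iff.1 hc).2, (lt_min_iff.1 hc').1, (lt_min_iff.1 hc').2⟩

lemma abs_sub_clamp_le (hAB : A ≤ B) (hε : 0 ≤ ε) (hA : A - ε ≤ x) (hB : x ≤ B + ε) :
    |x - max A (min x B)| ≤ ε := by
  grind

end Clamp

section MonotoneOn
open MeasureTheory
variable {a b A B : ℝ} {W W' w : ℝ → ℝ} {S : Set ℝ}

lemma intervalIntegrable_of_ae_mem_Icc (hwm : AEStronglyMeasurable w)
    (hw : ∀ᵐ x, w x ∈ Icc A B) : IntervalIntegrable w volume a b := by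
  rw [intervalIntegrable_iff]
  exact Measure.integrableOn_of_bounded measure_Ioc_lt_top.ne hwm
    (ae_restrict_of_ae (hw.mono fun _ hx => abs_le_max_abs_abs hx.1 hx.2))

lemma integral_deriv_mul_nonpos_of_monotoneOn (hab : a ≤ b) (hW : ∀ x, HasDerivAt W (W' x) x)
    (hW' : Continuous W') (ha : W a = 0) (hb : W b = 0) (hpos : ∀ x ∈ Icc a b, 0 ≤ W x)
    (hS : ∀ᵐ x, x ∈ S) (hw : ∀ x, w x ∈ Icc A B) (hm : MonotoneOn w (S ∩ Icc a b)) :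
    ∫ x in a..b, W' x * w x ≤ 0 := by
  obtain ⟨g, hg, hgw⟩ := hm.exists_monotone_extension
    ⟨A, forall_mem_image.2 fun x _ => (hw x).1⟩ ⟨B, forall_mem_image.2 fun x _ => (hw x).2⟩
  refine (intervalIntegral.integral_congr_ae ?_).trans_le
    (integral_deriv_mul_monotone_nonpos hab hW hW' ha hb hpos hg)
  filter_upwards [hS] with x hxS hx
  rw [uIoc_of_le hab] at hx
  rw [hgw ⟨hxS, Ioc_subset_Icc_self hx⟩]

lemma integral_deriv_mul_nonpos_of_antitoneOn (hab : a ≤ b) (hW : ∀ x, HasDerivAt W (W' x) x)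
    (hW' : Continuous W') (ha : W a = 0) (hb : W b = 0) (hneg : ∀ x ∈ Icc a b, W x ≤ 0)
    (hS : ∀ᵐ x, x ∈ S) (hw : ∀ x, w x ∈ Icc A B) (hm : AntitoneOn w (S ∩ Icc a b)) :
    ∫ x in a..b, W' x * w x ≤ 0 := by
  simpa using integral_deriv_mul_nonpos_of_monotoneOn (w := fun x => -w x) (A := -B) (B := -A) hab
    (fun x => (hW x).neg) hW'.neg (by simpa using ha) (by simpa using hb)
    (fun x hx => neg_nonneg.2 (hneg x hx)) hS
    (fun x => ⟨neg_le_neg (hw x).2, neg_le_neg (hw x).1⟩) hm.neg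

end MonotoneOn

lemma herglotzWeight_re_nonneg {p q θ : ℝ} (hpq : q ≤ p + 2 * Real.pi) (hθ : θ ∈ Icc p q) {z : ℂ}
    (hz : ‖z‖ < 1) :
    0 ≤ (herglotzWeight (exp (((p + q) / 2 : ℝ) * I)) (-Real.cos ((q - p) / 2)) z θ).re := by
  have hp : 0 ≤ Real.sin ((θ - p) / 2) :=
    Real.sin_nonneg_of_nonneg_of_le_pi (by linarith [hθ.1]) (by linarith [hθ.2])
  have hq : 0 ≤ Real.sin ((q - θ) / 2) :=
    Real.sin_nonneg_of_nonneg_of_le_pi (by linarith [hθ.2]) (by linarith [hθ.1])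
  rw [herglotzWeight_re_eq_sin_mul_sin]
  exact mul_nonneg (mul_nonneg zero_le_four (mul_nonneg hp hq)) (re_herglotz_kernel_pos hz θ).le

lemma herglotzWeight_re_nonpos {p q θ : ℝ} (hpq : p ≤ q) (hθ : θ ∈ Icc q (p + 2 * Real.pi)) {z : ℂ}
    (hz : ‖z‖ < 1) :
    (herglotzWeight (exp (((p + q) / 2 : ℝ) * I)) (-Real.cos ((q - p) / 2)) z θ).re ≤ 0 := by
  have hp : 0 ≤ Real.sin ((θ - p) / 2) :=
    Real.sin_nonneg_of_nonneg_of_le_pi (by linarith [hθ.1]) (by linarith [hθ.2])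
  have hq : Real.sin ((q - θ) / 2) ≤ 0 :=
    Real.sin_nonpos_of_nonpos_of_neg_pi_le (by linarith [hθ.1]) (by linarith [hθ.2])
  rw [herglotzWeight_re_eq_sin_mul_sin]
  exact mul_nonpos_of_nonpos_of_nonneg (mul_nonpos_of_nonneg_of_nonpos zero_le_four
    (mul_nonpos_of_nonneg_of_nonpos hp hq)) (re_herglotz_kernel_pos hz θ).le

/-- A `2π`-periodic function `v`, considered on a periodic set `S` of full measure, for which no
four cyclically ordered points of `S` carry values alternately above and below a level. -/
structure NoInterlacing (S : Set ℝ) (v : ℝ → ℝ) : Prop where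
  ae_mem : ∀ᵐ θ, θ ∈ S
  mem_periodic : Function.Periodic (fun θ => θ ∈ S) (2 * Real.pi)
  periodic : Function.Periodic v (2 * Real.pi)
  not_interlacing : ∀ c, ∀ θ₁ ∈ S, ∀ θ₂ ∈ S, ∀ θ₃ ∈ S, ∀ θ₄ ∈ S, θ₁ < θ₂ → θ₂ < θ₃ → θ₃ < θ₄ →
    θ₄ < θ₁ + 2 * Real.pi → c < v θ₁ → v θ₂ < c → c < v θ₃ → v θ₄ < c → False

namespace NoInterlacing
open MeasureTheory
variable {S : Set ℝ} {v : ℝ → ℝ} {p q : ℝ}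

lemma add_two_pi_mem (h : NoInterlacing S v) (hp : p ∈ S) : p + 2 * Real.pi ∈ S :=
  (h.mem_periodic p).mpr hp

lemma monotoneOn_clamp (h : NoInterlacing S v) (hp : p ∈ S) (hq : q ∈ S)
    (hqp : q < p + 2 * Real.pi) :
    MonotoneOn (fun θ => max (v p) (min (v θ) (v q))) (S ∩ Icc p q) := by
  intro x hx y hy hxy
  by_contra hlt
  obtain ⟨c, hpc, hyc, hcx, hcq⟩ := exists_between_of_clamp_lt_clamp (not_le.1 hlt)
  have hxy' : x < y := lt_of_le_of_ne hxy (by rintro rfl; exact lt_asymm hyc hcx)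
  have hpx : p < x := lt_of_le_of_ne hx.2.1 (by rintro rfl; exact lt_asymm hpc hcx)
  have hyq : y < q := lt_of_le_of_ne hy.2.2 (by rintro rfl; exact lt_asymm hyc hcq)
  exact h.not_interlacing c x hx.1 y hy.1 q hq _ (h.add_two_pi_mem hp) hxy' hyq hqp
    (by linarith) hcx hyc hcq (by rwa [h.periodic])

lemma antitoneOn_clamp (h : NoInterlacing S v) (hp : p ∈ S) (hq : q ∈ S) (hpq : p < q) :
    AntitoneOn (fun θ => max (v p) (min (v θ) (v q))) (S ∩ Icc q (p + 2 * Real.pi)) := by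
  intro x hx y hy hxy
  by_contra hlt
  obtain ⟨c, hpc, hxc, hcy, hcq⟩ := exists_between_of_clamp_lt_clamp (not_le.1 hlt)
  have hxy' : x < y := lt_of_le_of_ne hxy (by rintro rfl; exact lt_asymm hxc hcy)
  have hqx : q < x := lt_of_le_of_ne hx.2.1 (by rintro rfl; exact lt_asymm hxc hcq)
  have hyp : y < p + 2 * Real.pi := lt_of_le_of_ne hy.2.2 (by
    rintro rfl
    rw [h.periodic] at hcy
    exact lt_asymm hpc hcy)
  exact h.not_interlacing c q hq x hx.1 y hy.1 _ (h.add_two_pi_mem hp) hqx hxy' hyp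
    (by linarith) hcq hxc hcy (by rwa [h.periodic])

lemma integral_weightDeriv_mul_clamp_nonpos (h : NoInterlacing S v)
    (hvm : AEStronglyMeasurable v) (hp : p ∈ S) (hq : q ∈ S) (hpq : p < q)
    (hqp : q < p + 2 * Real.pi) (hv : v p < v q) {z : ℂ} (hz : ‖z‖ < 1) :
    ∫ θ in p..p + 2 * Real.pi, weightDeriv (exp (((p + q) / 2 : ℝ) * I))
      (-Real.cos ((q - p) / 2)) z θ * max (v p) (min (v θ) (v q)) ≤ 0 := by
  set l := exp (((p + q) / 2 : ℝ) * I)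
  set b := -Real.cos ((q - p) / 2)
  have hderiv := hasDerivAt_herglotzWeight_re l b hz
  have hcont := continuous_weightDeriv l b hz
  have hclamp : ∀ θ, max (v p) (min (v θ) (v q)) ∈ Icc (v p) (v q) := fun θ =>
    ⟨le_max_left _ _, max_le hv.le (min_le_right _ _)⟩
  have hint : ∀ s t, IntervalIntegrable (fun θ => weightDeriv l b z θ *
      max (v p) (min (v θ) (v q))) volume s t := fun s t =>
    (intervalIntegrable_of_ae_mem_Icc (aestronglyMeasurable_const.sup
      (hvm.inf aestronglyMeasurable_const)) (.of_forall hclamp)).continuousOn_mul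
      hcont.continuousOn
  have hWp : (herglotzWeight l b z p).re = 0 := by
    rw [herglotzWeight_re_eq_sin_mul_sin]
    simp
  have hWq : (herglotzWeight l b z q).re = 0 := by
    rw [herglotzWeight_re_eq_sin_mul_sin]
    simp
  have hWp' : (herglotzWeight l b z (p + 2 * Real.pi : ℝ)).re = 0 := by
    rw [herglotzWeight_re_eq_sin_mul_sin, add_sub_cancel_left, mul_div_cancel_left₀ _ two_ne_zero,
      Real.sin_pi]
    simp
  rw [← intervalIntegral.integral_add_adjacent_intervals (hint p q) (hint q (p + 2 * Real.pi))]
  exact add_nonpos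
    (integral_deriv_mul_nonpos_of_monotoneOn hpq.le hderiv hcont hWp hWq
      (fun θ hθ => herglotzWeight_re_nonneg hqp.le hθ hz) h.ae_mem hclamp
      (h.monotoneOn_clamp hp hq hqp))
    (integral_deriv_mul_nonpos_of_antitoneOn hqp.le hderiv hcont hWq hWp'
      (fun θ hθ => herglotzWeight_re_nonpos hpq.le hθ hz) h.ae_mem hclamp
      (h.antitoneOn_clamp hp hq hpq))

lemma integral_weightDeriv_mul_le (h : NoInterlacing S v) (hvm : AEStronglyMeasurable v)
    (hp : p ∈ S) (hq : q ∈ S) (hpq : p < q) (hqp : q < p + 2 * Real.pi) (hv : v p < v q) {ε : ℝ}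
    (hvε : ∀ θ ∈ S, v θ ∈ Icc (v p - ε) (v q + ε)) {z : ℂ} (hz : ‖z‖ < 1) :
    ∫ θ in (0 : ℝ)..2 * Real.pi, weightDeriv (exp (((p + q) / 2 : ℝ) * I))
      (-Real.cos ((q - p) / 2)) z θ * v θ ≤ 2 * Real.pi * (8 / (1 - ‖z‖) ^ 2 * ε) := by
  set l := exp (((p + q) / 2 : ℝ) * I)
  set b := -Real.cos ((q - p) / 2)
  set w : ℝ → ℝ := fun θ => max (v p) (min (v θ) (v q))
  have hε : 0 ≤ ε := by linarith [(hvε p hp).1]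
  have hcont := (continuous_weightDeriv l b hz).continuousOn (s := uIcc p (p + 2 * Real.pi))
  have hvi : IntervalIntegrable v volume p (p + 2 * Real.pi) :=
    intervalIntegrable_of_ae_mem_Icc hvm (h.ae_mem.mono hvε)
  have hwi : IntervalIntegrable w volume p (p + 2 * Real.pi) :=
    intervalIntegrable_of_ae_mem_Icc
      (aestronglyMeasurable_const.sup (hvm.inf aestronglyMeasurable_const))
      (.of_forall fun θ => ⟨le_max_left _ _, max_le hv.le (min_le_right _ _)⟩)
  have herror : ∫ θ in p..p + 2 * Real.pi, weightDeriv l b z θ * (v θ - w θ) ≤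
      2 * Real.pi * (8 / (1 - ‖z‖) ^ 2 * ε) := by
    refine (Real.le_norm_self _).trans (intervalIntegral.norm_integral_le_of_norm_le_const_ae
      (C := 8 / (1 - ‖z‖) ^ 2 * ε) ?_ |>.trans_eq ?_)
    · filter_upwards [h.ae_mem] with θ hθ _
      rw [norm_mul]
      refine mul_le_mul (abs_weightDeriv_le (norm_exp_ofReal_mul_I _) ?_ hz θ)
        (abs_sub_clamp_le hv.le hε (hvε θ hθ).1 (hvε θ hθ).2) (norm_nonneg _) (by positivity)
      rw [abs_neg]
      exact Real.abs_cos_le_one _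
    · rw [add_sub_cancel_left, abs_of_pos Real.two_pi_pos, mul_comm]
  calc ∫ θ in (0 : ℝ)..2 * Real.pi, weightDeriv l b z θ * v θ
      = ∫ θ in p..p + 2 * Real.pi, weightDeriv l b z θ * v θ := by
        simpa only [zero_add, Pi.mul_apply] using
          ((weightDeriv_periodic l b z).mul h.periodic).intervalIntegral_add_eq 0 p
    _ = (∫ θ in p..p + 2 * Real.pi, weightDeriv l b z θ * w θ) +
        ∫ θ in p..p + 2 * Real.pi, weightDeriv l b z θ * (v θ - w θ) := by
      rw [← intervalIntegral.integral_add (hwi.continuousOn_mul hcont)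
        ((hvi.sub hwi).continuousOn_mul hcont)]
      simp only [← mul_add, add_sub_cancel]
    _ ≤ 0 + 2 * Real.pi * (8 / (1 - ‖z‖) ^ 2 * ε) :=
      add_le_add (h.integral_weightDeriv_mul_clamp_nonpos hvm hp hq hpq hqp hv hz) herror
    _ = _ := zero_add _

end NoInterlacing

/-! ### Directions of increase -/

/-- The real part of a primitive of `d` is nondecreasing along the flow of the vector field
`-I * tangentField l b` on the disc. -/
structure IsMonotoneDirection (l : ℂ) (b : ℝ) (d : ℂ → ℂ) : Prop where
  norm_eq : ‖l‖ = 1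
  im_nonneg : ∀ z ∈ ball (0 : ℂ) 1, 0 ≤ (tangentField l b z * d z).im

lemma exists_isMonotoneDirection_of_tendsto {D : ℕ → ℂ → ℂ} {d : ℂ → ℂ} {e : ℕ → ℂ → ℝ}
    {A : Set ℝ} (hA : IsCompact A)
    (hD : ∀ z ∈ ball (0 : ℂ) 1, Tendsto (fun n => D n z) atTop (𝓝 (d z)))
    (he : ∀ z ∈ ball (0 : ℂ) 1, Tendsto (fun n => e n z) atTop (𝓝 0))
    (h : ∀ n, ∃ l : ℂ, ‖l‖ = 1 ∧ ∃ b ∈ A, ∀ z ∈ ball (0 : ℂ) 1,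
      -e n z ≤ (tangentField l b z * D n z).im) :
    ∃ l, ∃ b ∈ A, IsMonotoneDirection l b d := by
  choose l hl b hb hlb using h
  obtain ⟨⟨l₀, b₀⟩, ⟨hl₀, hb₀⟩, φ, hφ, hlim⟩ := ((isCompact_sphere (0 : ℂ) 1).prod
    hA).tendsto_subseq (x := fun n => (l n, b n)) fun n => ⟨by simpa using hl n, hb n⟩
  refine ⟨l₀, b₀, hb₀, by simpa using hl₀, fun z hz => ?_⟩
  have hfield : Continuous fun x : ℂ × ℝ => tangentField x.1 x.2 z := by
    have : Continuous fun x : ℂ × ℝ => conj x.1 := continuous_conj.comp continuous_fst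
    unfold tangentField
    fun_prop
  have hlower : Tendsto (fun n => -e (φ n) z) atTop (𝓝 0) := by
    simpa using ((he z hz).comp hφ.tendsto_atTop).neg
  have hupper : Tendsto (fun n => (tangentField (l (φ n)) (b (φ n)) z * D (φ n) z).im) atTop
      (𝓝 (tangentField l₀ b₀ z * d z).im) :=
    (continuous_im.tendsto _).comp
      (((hfield.tendsto _).comp hlim).mul ((hD z hz).comp hφ.tendsto_atTop))
  exact le_of_tendsto_of_tendsto' hlower hupper fun n => hlb _ z hz

namespace NoInterlacing
open MeasureTheory
variable {S : Set ℝ} {v : ℝ → ℝ}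

lemma exists_mem_Ioo (h : NoInterlacing S v) {p q : ℝ} (hq : q ∈ S) (hne : v q ≠ v p) :
    ∃ q' ∈ S, v q' = v q ∧ q' ∈ Ioo p (p + 2 * Real.pi) := by
  set q' := toIocMod Real.two_pi_pos p q
  have hq' : q' = q - toIocDiv Real.two_pi_pos p q • (2 * Real.pi) :=
    (self_sub_toIocDiv_zsmul Real.two_pi_pos p q).symm
  have hvq : v q' = v q := hq' ▸ h.periodic.sub_zsmul_eq _
  obtain ⟨hlt, hle⟩ : q' ∈ Ioc p (p + 2 * Real.pi) := toIocMod_mem_Ioc Real.two_pi_pos p q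
  refine ⟨q', hq' ▸ (h.mem_periodic.sub_zsmul_eq _).mpr hq, hvq, hlt,
    lt_of_le_of_ne hle fun heq => hne ?_⟩
  rw [← hvq, heq, h.periodic]

lemma exists_nearly_extremal (h : NoInterlacing S v) {M : ℝ} (hM : ∀ θ ∈ S, |v θ| ≤ M)
    (hne : ∃ θ ∈ S, ∃ φ ∈ S, v θ ≠ v φ) {ε : ℝ} (hε : 0 < ε) :
    ∃ p ∈ S, ∃ q ∈ S, p < q ∧ q < p + 2 * Real.pi ∧ v p < v q ∧
      ∀ θ ∈ S, v θ ∈ Icc (v p - ε) (v q + ε) := by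
  obtain ⟨θ, hθ, φ, hφ, hθφ⟩ := hne
  have hbelow : BddBelow (v '' S) := ⟨-M, forall_mem_image.2 fun θ hθ => (abs_le.1 (hM θ hθ)).1⟩
  have habove : BddAbove (v '' S) := ⟨M, forall_mem_image.2 fun θ hθ => (abs_le.1 (hM θ hθ)).2⟩
  have hinf : ∀ θ ∈ S, sInf (v '' S) ≤ v θ := fun θ hθ => csInf_le hbelow (mem_image_of_mem v hθ)
  have hsup : ∀ θ ∈ S, v θ ≤ sSup (v '' S) := fun θ hθ => le_csSup habove (mem_image_of_mem v hθ)
  have hlt : sInf (v '' S) < sSup (v '' S) := by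
    rcases lt_or_gt_of_ne hθφ with hlt | hlt
    · exact (hinf θ hθ).trans_lt (hlt.trans_le (hsup φ hφ))
    · exact (hinf φ hφ).trans_lt (hlt.trans_le (hsup θ hθ))
  set δ := min ε ((sSup (v '' S) - sInf (v '' S)) / 2)
  have hδ : 0 < δ := lt_min hε (by linarith)
  have hδε : δ ≤ ε := min_le_left _ _
  have hδ2 : δ ≤ (sSup (v '' S) - sInf (v '' S)) / 2 := min_le_right _ _
  have hne : (v '' S).Nonempty := ⟨_, mem_image_of_mem v hθ⟩
  obtain ⟨_, ⟨p, hp, rfl⟩, hpv⟩ := exists_lt_of_csInf_lt hne (lt_add_of_pos_right _ hδ)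
  obtain ⟨_, ⟨q₀, hq₀, rfl⟩, hqv⟩ := exists_lt_of_lt_csSup hne (sub_lt_self _ hδ)
  obtain ⟨q, hq, hqq, hpq, hqp⟩ := h.exists_mem_Ioo (p := p) hq₀ (by linarith)
  exact ⟨p, hp, q, hq, hpq, hqp, by linarith, fun θ hθ =>
    ⟨by linarith [hinf θ hθ], by linarith [hsup θ hθ]⟩⟩

variable {G : ℂ → ℂ} {M : ℝ}

lemma exists_le_im_tangentField_mul_deriv (h : NoInterlacing S v)
    (hG : DifferentiableOn ℂ G (ball 0 1)) (hM : ∀ z ∈ ball (0 : ℂ) 1, |(G z).re| ≤ M)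
    (hS : ∀ θ ∈ S, HasRadialLimit (fun z => (G z).re) θ (v θ))
    (hne : ∃ θ ∈ S, ∃ φ ∈ S, v θ ≠ v φ) {ε : ℝ} (hε : 0 < ε) :
    ∃ l : ℂ, ‖l‖ = 1 ∧ ∃ b ∈ Icc (-1 : ℝ) 1, ∀ z ∈ ball (0 : ℂ) 1,
      -(8 / (1 - ‖z‖) ^ 2 * ε) ≤ (tangentField l b z * deriv G z).im := by
  have hbd : ∀ θ ∈ S, |v θ| ≤ M := fun θ hθ => abs_le.2 <|
    (hS θ hθ).mem_of_isClosed isClosed_Icc fun z hz => abs_le.1 (hM z hz)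
  have hv := h.ae_mem.mono hS
  obtain ⟨p, hp, q, hq, hpq, hqp, hvpq, hvε⟩ := h.exists_nearly_extremal hbd hne hε
  refine ⟨-exp (((p + q) / 2 : ℝ) * I), by rw [norm_neg, norm_exp_ofReal_mul_I],
    -(-Real.cos ((q - p) / 2)), by simpa using abs_le.1 (Real.abs_cos_le_one _), fun z hz => ?_⟩
  have hvm := aestronglyMeasurable_of_hasRadialLimit
    (continuous_re.comp_continuousOn hG.continuousOn) hv
  rw [tangentField_neg, neg_mul, neg_im, neg_le_neg_iff,
    im_tangentField_mul_deriv_eq_integral hG hM hv hz, inv_mul_le_iff₀ Real.two_pi_pos]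
  exact h.integral_weightDeriv_mul_le hvm hp hq hpq hqp hvpq hvε (mem_ball_zero_iff.1 hz)

lemma exists_isMonotoneDirection (h : NoInterlacing S v) (hG : DifferentiableOn ℂ G (ball 0 1))
    (hM : ∀ z ∈ ball (0 : ℂ) 1, |(G z).re| ≤ M)
    (hS : ∀ θ ∈ S, HasRadialLimit (fun z => (G z).re) θ (v θ)) :
    ∃ l, ∃ b ∈ Icc (-1 : ℝ) 1, IsMonotoneDirection l b (deriv G) := by
  by_cases hne : ∃ θ ∈ S, ∃ φ ∈ S, v θ ≠ v φ
  · refine exists_isMonotoneDirection_of_tendsto (D := fun _ => deriv G)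
      (e := fun n z => 8 / (1 - ‖z‖) ^ 2 * (1 / ((n : ℝ) + 1))) isCompact_Icc
      (fun z _ => tendsto_const_nhds) (fun z _ => ?_)
      fun n => h.exists_le_im_tangentField_mul_deriv hG hM hS hne (by positivity)
    simpa using (tendsto_one_div_add_atTop_nhds_zero_nat (𝕜 := ℝ)).const_mul (8 / (1 - ‖z‖) ^ 2)
  · push Not at hne
    obtain ⟨φ, hφ⟩ := h.ae_mem.exists
    refine ⟨1, 0, by simp, norm_one, fun z hz => ?_⟩
    have hconst : ∀ᵐ θ, HasRadialLimit (fun z => (G z).re) θ (v φ) :=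
      h.ae_mem.mono fun θ hθ => hne θ hθ φ hφ ▸ hS θ hθ
    rw [im_tangentField_mul_deriv_eq_integral hG hM hconst hz, intervalIntegral.integral_mul_const,
      integral_weightDeriv _ _ (mem_ball_zero_iff.1 hz), zero_mul, mul_zero]

end NoInterlacing

theorem exists_isMonotoneDirection_of_joinedIn {G : ℂ → ℂ} (hG : DifferentiableOn ℂ G (ball 0 1))
    {M : ℝ} (hM : ∀ z ∈ ball (0 : ℂ) 1, |(G z).re| ≤ M)
    (hrad : ∀ᵐ θ, ∃ y, HasRadialLimit (fun z => (G z).re) θ y)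
    (hup : ∀ c, ∀ z ∈ {x ∈ ball (0 : ℂ) 1 | c < (G x).re},
      ∀ w ∈ {x ∈ ball (0 : ℂ) 1 | c < (G x).re}, JoinedIn {x ∈ ball (0 : ℂ) 1 | c < (G x).re} z w)
    (hlo : ∀ c, ∀ z ∈ {x ∈ ball (0 : ℂ) 1 | (G x).re < c},
      ∀ w ∈ {x ∈ ball (0 : ℂ) 1 | (G x).re < c}, JoinedIn {x ∈ ball (0 : ℂ) 1 | (G x).re < c} z w) :
    ∃ l, ∃ b ∈ Icc (-1 : ℝ) 1, IsMonotoneDirection l b (deriv G) := by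
  set v : ℝ → ℝ := fun θ => limUnder (𝓝[<] (1 : ℝ)) fun r : ℝ => (G (r * exp (θ * I))).re
  set S : Set ℝ := {θ | ∃ y, HasRadialLimit (fun z => (G z).re) θ y}
  have hSv : ∀ θ ∈ S, HasRadialLimit (fun z => (G z).re) θ (v θ) := fun θ hθ =>
    tendsto_nhds_limUnder hθ
  have hS : NoInterlacing S v :=
    { ae_mem := hrad
      mem_periodic := fun θ => propext (exists_congr fun _ => HasRadialLimit.add_two_pi_iff)
      periodic := fun θ => by simp only [v, exp_add_two_pi_mul_I]
      not_interlacing := fun c θ₁ h₁ θ₂ h₂ θ₃ h₃ θ₄ h₄ h12 h23 h34 h41 => by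
        refine not_interlacing_radial_limits c (hup c) (hlo c) h12 h23 h34 h41 (v := v) ?_
        rintro θ (rfl | rfl | rfl | rfl)
        exacts [hSv _ h₁, hSv _ h₂, hSv _ h₃, hSv _ h₄] }
  exact hS.exists_isMonotoneDirection hG hM hSv

/-! ### Radial limits of conformal maps -/

section RadialLimits
open MeasureTheory

lemma ae_of_periodic {P : ℝ → Prop} {T a : ℝ} (hT : 0 < T) (hP : Function.Periodic P T)
    (h : ∀ᵐ x, x ∈ Ioc a (a + T) → P x) : ∀ᵐ x, P x := by
  refine (isAddFundamentalDomain_Ioc hT a).measure_zero_of_invariant _ ?_ ?_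
  · rintro ⟨_, k, rfl⟩
    ext x
    rw [mem_vadd_set_iff_neg_vadd_mem]
    simpa [AddSubgroup.vadd_def, neg_add_eq_sub] using
      not_congr (iff_of_eq (hP.sub_zsmul_eq (x := x) k))
  · rw [ae_iff] at h
    refine measure_mono_null (fun x hx => ?_) h
    exact fun h' => hx.1 (h' hx.2)

lemma det_smul_one_complex (c : ℂ) : (c • (1 : ℂ →L[ℝ] ℂ)).det = normSq c := by
  rw [← Algebra.norm_complex_apply, Algebra.norm_apply, ContinuousLinearMap.det]
  rfl

lemma lintegral_normSq_deriv {ψ : ℂ → ℂ} {s : Set ℂ} (hs : MeasurableSet s)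
    (hψ : ∀ z ∈ s, DifferentiableAt ℂ ψ z) (hinj : InjOn ψ s) :
    ∫⁻ z in s, ENNReal.ofReal (normSq (deriv ψ z)) = volume (ψ '' s) := by
  simpa only [det_smul_one_complex, abs_of_nonneg (normSq_nonneg _), setLIntegral_one,
    mul_one] using (lintegral_image_eq_lintegral_abs_det_fderiv_mul volume hs
      (fun z hz => (hψ z hz).hasDerivAt.complexToReal_fderiv.hasFDerivWithinAt) hinj
      fun _ => 1).symm

lemma ae_lintegral_polar_lt_top {F : ℂ → ENNReal} (hF : Measurable F) (h : ∫⁻ z, F z ≠ ⊤) :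
    ∀ᵐ θ : ℝ, ∫⁻ r in Ioi (0 : ℝ), ENNReal.ofReal r * F (r * exp (θ * I)) < ⊤ := by
  have hmeas : Measurable fun p : ℝ × ℝ => ENNReal.ofReal p.1 * F (p.1 * exp (p.2 * I)) :=
    (ENNReal.measurable_ofReal.comp measurable_fst).mul
      (hF.comp (Continuous.measurable (by fun_prop)))
  have hpolar := Complex.lintegral_comp_polarCoord_symm F
  simp only [Complex.polarCoord_symm_apply, ofReal_cos, ofReal_sin, ← exp_mul_I, smul_eq_mul,
    polarCoord_target] at hpolar
  rw [Measure.volume_eq_prod, setLIntegral_prod_symm _ hmeas.aemeasurable] at hpolar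
  have hae := ae_lt_top hmeas.lintegral_prod_left' (hpolar ▸ h)
  rw [ae_restrict_iff' measurableSet_Ioo] at hae
  refine ae_of_periodic (a := -Real.pi) Real.two_pi_pos
    (fun θ => by simp only [exp_add_two_pi_mul_I]) ?_
  filter_upwards [hae, Measure.ae_ne volume Real.pi] with θ hθ hne hmem
  exact hθ ⟨hmem.1, lt_of_le_of_ne (by linarith [hmem.2]) hne⟩

variable {E : Type*} [NormedAddCommGroup E]

lemma integrableOn_of_lintegral_mul_sq_lt_top {f : ℝ → E} {a b : ℝ} (ha : 0 < a)
    (hf : AEStronglyMeasurable f (volume.restrict (Ioo a b)))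
    (h : ∫⁻ r in Ioo a b, ENNReal.ofReal (r * ‖f r‖ ^ 2) < ⊤) : IntegrableOn f (Ioo a b) := by
  have hint : IntegrableOn (fun r => r * ‖f r‖ ^ 2) (Ioo a b) := by
    refine (lintegral_ofReal_ne_top_iff_integrable
      (aestronglyMeasurable_id.mul (hf.norm.pow 2)) ?_).1 h.ne
    filter_upwards [ae_restrict_mem measurableSet_Ioo] with r hr
    exact mul_nonneg (ha.trans hr.1).le (sq_nonneg _)
  have hone : IntegrableOn (fun _ : ℝ => (1 : ℝ)) (Ioo a b) :=
    integrableOn_const measure_Ioo_lt_top.ne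
  refine (hone.add (hint.const_mul a⁻¹)).mono' hf ?_
  filter_upwards [ae_restrict_mem measurableSet_Ioo] with r hr
  have hle : ‖f r‖ ^ 2 ≤ a⁻¹ * (r * ‖f r‖ ^ 2) := by
    rw [← mul_assoc, inv_mul_eq_div]
    exact le_mul_of_one_le_left (sq_nonneg _) ((one_le_div ha).2 hr.1.le)
  change ‖f r‖ ≤ 1 + a⁻¹ * (r * ‖f r‖ ^ 2)
  nlinarith [sq_nonneg (‖f r‖ - 1), norm_nonneg (f r)]

variable [NormedSpace ℂ E] [CompleteSpace E]

lemma exists_hasRadialLimit_of_integrableOn {ψ : ℂ → E} (hψ : DifferentiableOn ℂ ψ (ball 0 1))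
    {θ a : ℝ} (ha : a ∈ Ioo (0 : ℝ) 1)
    (h : IntegrableOn (fun r : ℝ => deriv ψ (r * exp (θ * I))) (Ioo a 1)) :
    ∃ y, HasRadialLimit ψ θ y := by
  set f : ℝ → E := fun r => exp (θ * I) • deriv ψ (r * exp (θ * I))
  have hderiv : ∀ r ∈ Ioo (0 : ℝ) 1, HasDerivAt (fun r : ℝ => ψ (r * exp (θ * I))) (f r) r := by
    intro r hr
    have hψr := (hψ.differentiableAt (isOpen_ball.mem_nhds (ofReal_mul_exp_mem_ball hr θ)))
    exact hψr.hasDerivAt.scomp r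
      (by simpa using ((hasDerivAt_id (r : ℂ)).mul_const (exp (θ * I))).comp_ofReal)
  have hint : IntervalIntegrable f volume a 1 := by
    rw [intervalIntegrable_iff_integrableOn_Ioo_of_le ha.2.le]
    exact h.smul _
  have hprim : Tendsto (fun b => ∫ x in a..b, f x) (𝓝[<] 1) (𝓝 (∫ x in a..1, f x)) := by
    have hcont := intervalIntegral.continuousOn_primitive_interval' hint left_mem_uIcc
    rw [uIcc_of_le ha.2.le] at hcont
    rw [← nhdsWithin_Ico_eq_nhdsLT ha.2]
    exact (hcont 1 (right_mem_Icc.2 ha.2.le)).mono_left (nhdsWithin_mono _ Ico_subset_Icc_self)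
  refine ⟨ψ (a * exp (θ * I)) + ∫ x in a..1, f x, (tendsto_const_nhds.add hprim).congr' ?_⟩
  filter_upwards [Ioo_mem_nhdsLT ha.2] with r hr
  have hsub : uIcc a r ⊆ Ioo 0 1 := by
    rw [uIcc_of_le hr.1.le]
    exact fun x hx => ⟨ha.1.trans_le hx.1, hx.2.trans_lt hr.2⟩
  rw [intervalIntegral.integral_eq_sub_of_hasDerivAt (fun x hx => hderiv x (hsub hx)),
    add_sub_cancel]
  exact hint.mono_set (uIcc_subset_uIcc_left (by
    rw [uIcc_of_le ha.2.le]
    exact Ioo_subset_Icc_self hr))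

end RadialLimits

open MeasureTheory in
theorem IsConformalIntoDisc.ae_exists_hasRadialLimit {ψ : ℂ → ℂ}
    (hψ : IsConformalIntoDisc (ball 0 1) ψ) : ∀ᵐ θ : ℝ, ∃ y, HasRadialLimit ψ θ y := by
  set F : ℂ → ENNReal := indicator (ball 0 1) fun z => ENNReal.ofReal (normSq (deriv ψ z))
  have hF : Measurable F := (ENNReal.measurable_ofReal.comp
    (Complex.continuous_normSq.measurable.comp (measurable_deriv ψ))).indicator measurableSet_ball
  have hfin : ∫⁻ z, F z ≠ ⊤ := by
    rw [lintegral_indicator measurableSet_ball, lintegral_normSq_deriv measurableSet_ball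
      (fun z hz => (hψ.hasDerivAt hz).differentiableAt) hψ.injOn]
    exact ((measure_mono hψ.mapsTo.image_subset).trans_lt measure_ball_lt_top).ne
  filter_upwards [ae_lintegral_polar_lt_top hF hfin] with θ hθ
  have hhalf : (1 / 2 : ℝ) ∈ Ioo (0 : ℝ) 1 := by norm_num
  refine exists_hasRadialLimit_of_integrableOn hψ.differentiableOn hhalf
    (integrableOn_of_lintegral_mul_sq_lt_top hhalf.1 ((measurable_deriv ψ).comp
      (Continuous.measurable (by fun_prop))).aestronglyMeasurable (lt_of_le_of_lt ?_ hθ))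
  refine (setLIntegral_mono' measurableSet_Ioo fun r hr => ?_).trans
    (lintegral_mono_set fun r hr => hhalf.1.trans hr.1)
  have hr0 : 0 < r := hhalf.1.trans hr.1
  rw [ENNReal.ofReal_mul hr0.le, ← normSq_eq_norm_sq]
  have hF_eq : F (r * exp (θ * I)) = ENNReal.ofReal (normSq (deriv ψ (r * exp (θ * I)))) :=
    indicator_of_mem (ofReal_mul_exp_mem_ball ⟨hr0, hr.2⟩ θ) _
  rw [hF_eq]

/-! ### Convex harmonic maps -/

lemma norm_sub_self_le_of_le_deriv {ψ : ℂ → ℂ} (hψ : DifferentiableOn ℂ ψ (ball 0 1))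
    (hm : MapsTo ψ (ball 0 1) (ball 0 1)) (h0 : ψ 0 = 0) {r t : ℝ} (hr : r < 1) (ht : r ≤ t)
    (hd : deriv ψ 0 = t) {z : ℂ} (hz : z ∈ ball (0 : ℂ) 1) :
    ‖ψ z - z‖ ≤ 4 * (1 - r) / (1 - ‖z‖) := by
  have hz1 : ‖z‖ < 1 := mem_ball_zero_iff.1 hz
  have hslope : ∀ w ∈ ball (0 : ℂ) 1, ‖dslope ψ 0 w‖ ≤ 1 := fun w hw => by
    simpa using norm_dslope_le_div_of_mapsTo_ball hψ
      (by simpa only [h0] using hm.mono_right ball_subset_closedBall) hw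
  have hslope0 : ‖dslope ψ 0 0 - 1‖ ≤ 1 - r := by
    have ht1 := hslope 0 (mem_ball_self one_pos)
    rw [dslope_same, hd, norm_real] at ht1
    rw [dslope_same, hd, ← ofReal_one, ← ofReal_sub, norm_real,
      Real.norm_of_nonpos (by linarith [Real.le_norm_self t])]
    linarith
  have hbound := borelCaratheodory (f := fun w => dslope ψ 0 w - 1) (M := 1 - r) (R := 1)
    (by linarith) (((differentiableOn_dslope (isOpen_ball.mem_nhds
      (mem_ball_self one_pos))).2 hψ).sub_const 1) (fun w hw => by
      have := (re_le_norm _).trans (hslope w hw)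
      simp only [mem_ofPred_eq, sub_re, one_re]
      linarith) one_pos hz
  have : 0 < 1 - ‖z‖ := by linarith
  have hψz : ψ z - z = z * (dslope ψ 0 z - 1) := by
    have := sub_smul_dslope ψ 0 z
    simp only [sub_zero, h0, smul_eq_mul] at this
    rw [mul_sub, this, mul_one]
  calc ‖ψ z - z‖ ≤ ‖dslope ψ 0 z - 1‖ := by
        rw [hψz, norm_mul]
        exact mul_le_of_le_one_left (norm_nonneg _) hz1.le
    _ ≤ 2 * (1 - r) * ‖z‖ / (1 - ‖z‖) + ‖dslope ψ 0 0 - 1‖ * (1 + ‖z‖) / (1 - ‖z‖) := hbound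
    _ ≤ 2 * (1 - r) * 1 / (1 - ‖z‖) + (1 - r) * 2 / (1 - ‖z‖) := by (gcongr; linarith)
    _ = _ := by ring

lemma tendstoLocallyUniformlyOn_id_of_le_deriv {ψ : ℕ → ℂ → ℂ} {r t : ℕ → ℝ}
    (hψ : ∀ n, DifferentiableOn ℂ (ψ n) (ball 0 1))
    (hm : ∀ n, MapsTo (ψ n) (ball 0 1) (ball 0 1)) (h0 : ∀ n, ψ n 0 = 0) (hr : ∀ n, r n < 1)
    (hr1 : Tendsto r atTop (𝓝 1)) (ht : ∀ n, r n ≤ t n) (hd : ∀ n, deriv (ψ n) 0 = t n) :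
    TendstoLocallyUniformlyOn ψ id atTop (ball 0 1) := by
  rw [Metric.tendstoLocallyUniformlyOn_iff]
  intro ε hε z hz
  have hz1 : ‖z‖ < 1 := mem_ball_zero_iff.1 hz
  refine ⟨ball 0 ((1 + ‖z‖) / 2), mem_nhdsWithin_of_mem_nhds
    (isOpen_ball.mem_nhds (by rw [mem_ball_zero_iff]; linarith)), ?_⟩
  have herror : Tendsto (fun n => 4 * (1 - r n)) atTop (𝓝 0) := by
    simpa using (hr1.const_sub 1).const_mul 4
  filter_upwards [herror.eventually (gt_mem_nhds (mul_pos hε (half_pos (sub_pos.2 hz1))))]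
    with n hn w hw
  rw [mem_ball_zero_iff] at hw
  rw [dist_comm, dist_eq_norm]
  refine (norm_sub_self_le_of_le_deriv (hψ n) (hm n) (h0 n) (hr n) (ht n) (hd n)
    (mem_ball_zero_iff.2 (by linarith))).trans_lt ?_
  rw [div_lt_iff₀ (by linarith)]
  refine hn.trans_le ?_
  gcongr
  linarith

/-- `h + conj g` is a sense-preserving univalent harmonic map of the disc onto a convex domain. -/
structure IsConvexHarmonic (h g : ℂ → ℂ) : Prop where
  differentiableOn_left : DifferentiableOn ℂ h (ball 0 1)
  differentiableOn_right : DifferentiableOn ℂ g (ball 0 1)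
  norm_deriv_lt : ∀ z ∈ ball (0 : ℂ) 1, ‖deriv g z‖ < ‖deriv h z‖
  injOn : InjOn (fun z => h z + conj (g z)) (ball 0 1)
  convex : Convex ℝ ((fun z => h z + conj (g z)) '' ball 0 1)

namespace IsConvexHarmonic
variable {h g : ℂ → ℂ}

lemma map_nhds (hc : IsConvexHarmonic h g) {z : ℂ} (hz : z ∈ ball (0 : ℂ) 1) :
    Filter.map (fun z => h z + conj (g z)) (𝓝 z) = 𝓝 (h z + conj (g z)) := by
  have hh := (hc.differentiableOn_left.analyticOnNhd isOpen_ball z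
    hz).hasStrictDerivAt.complexToReal_fderiv
  have hg := (hc.differentiableOn_right.analyticOnNhd isOpen_ball z
    hz).hasStrictDerivAt.complexToReal_fderiv
  refine (hh.add ((conjCLE : ℂ →L[ℝ] ℂ).hasStrictFDerivAt.comp z hg)).map_nhds_eq_of_surj
    (LinearMap.range_eq_top.2 (LinearMap.surjective_of_injective
      ((injective_iff_map_eq_zero _).2 fun v hv => ?_)))
  simp only [ContinuousLinearMap.coe_coe, add_apply, smul_apply, one_apply_eq_self, smul_eq_mul,
    ContinuousLinearMap.comp_apply, ContinuousLinearEquiv.coe_coe, conjCLE_apply] at hv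
  have hnorm := congrArg norm (eq_neg_of_add_eq_zero_left hv)
  rw [norm_neg, RCLike.norm_conj, norm_mul, norm_mul] at hnorm
  by_contra hne
  exact (hc.norm_deriv_lt z hz).ne' (mul_right_cancel₀ (norm_ne_zero_iff.2 hne) hnorm)

lemma rotate (hc : IsConvexHarmonic h g) {u : ℂ} (hu : ‖u‖ = 1) :
    IsConvexHarmonic (fun z => u * h z) (fun z => conj u * g z) := by
  have hu0 : u ≠ 0 := norm_ne_zero_iff.1 (by rw [hu]; exact one_ne_zero)
  have hmul : (fun z => u * h z + conj (conj u * g z)) = fun z => u * (h z + conj (g z)) := by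
    ext z
    rw [map_mul, conj_conj, mul_add]
  refine ⟨hc.differentiableOn_left.const_mul u, hc.differentiableOn_right.const_mul _,
    fun z hz => ?_, ?_, ?_⟩
  · rw [deriv_const_mul_field, deriv_const_mul_field, norm_mul, norm_mul, RCLike.norm_conj, hu,
      one_mul, one_mul]
    exact hc.norm_deriv_lt z hz
  · rw [hmul]
    exact fun x hx y hy hxy => hc.injOn hx hy (mul_left_cancel₀ hu0 hxy)
  · rw [hmul, ← image_image (fun w => u * w)]
    exact hc.convex.linear_image (LinearMap.mulLeft ℝ u)

/-- The composition with the conformal map `ψ` has connected level sets and radial limits, so that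
`exists_isMonotoneDirection_of_joinedIn` applies. -/
lemma exists_isMonotoneDirection_comp (hc : IsConvexHarmonic h g) {ψ : ℂ → ℂ} {K : Set ℂ}
    (hψ : IsConformalIntoDisc (ball 0 1) ψ) (hK : IsCompact K) (hKsub : K ⊆ ball 0 1)
    (hψK : MapsTo ψ (ball 0 1) K)
    (hjoin : ∀ P : Set ℂ, Convex ℝ P →
      ∀ z ∈ {x ∈ ball (0 : ℂ) 1 | h (ψ x) + conj (g (ψ x)) ∈ P},
      ∀ w ∈ {x ∈ ball (0 : ℂ) 1 | h (ψ x) + conj (g (ψ x)) ∈ P},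
      JoinedIn {x ∈ ball (0 : ℂ) 1 | h (ψ x) + conj (g (ψ x)) ∈ P} z w) :
    ∃ l, ∃ b ∈ Icc (-1 : ℝ) 1, IsMonotoneDirection l b (deriv fun z => h (ψ z) + g (ψ z)) := by
  have hd : DifferentiableOn ℂ (fun z => h z + g z) (ball 0 1) :=
    hc.differentiableOn_left.add hc.differentiableOn_right
  obtain ⟨M, hM⟩ := hK.exists_bound_of_continuousOn (hd.continuousOn.mono hKsub)
  refine exists_isMonotoneDirection_of_joinedIn (M := M) (hd.comp hψ.differentiableOn hψ.mapsTo)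
    (fun z hz => (abs_re_le_norm _).trans (hM _ (hψK hz))) ?_ (fun c => ?_) fun c => ?_
  · filter_upwards [hψ.ae_exists_hasRadialLimit] with θ ⟨y, hy⟩
    have hyK : y ∈ K := hy.mem_of_isClosed hK.isClosed hψK
    exact ⟨_, (continuous_re.tendsto _).comp ((hd.continuousOn.continuousAt
      (isOpen_ball.mem_nhds (hKsub hyK))).tendsto.comp hy)⟩
  · simpa only [mem_ofPred_eq, add_re, conj_re] using
      hjoin {x | c < x.re} (convex_halfSpace_re_gt c)
  · simpa only [mem_ofPred_eq, add_re, conj_re] using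
      hjoin {x | x.re < c} (convex_halfSpace_re_lt c)

lemma exists_exhausting_map (hc : IsConvexHarmonic h g) {r : ℝ} (hr : r ∈ Ioo (0 : ℝ) 1) :
    ∃ ψ, IsConformalIntoDisc (ball 0 1) ψ ∧ ψ 0 = 0 ∧ (∃ t : ℝ, r ≤ t ∧ deriv ψ 0 = t) ∧
      ∃ l, ∃ b ∈ Icc (-1 : ℝ) 1,
        IsMonotoneDirection l b (deriv fun z => h (ψ z) + g (ψ z)) := by
  obtain ⟨e, hsource, htarget, he⟩ := exists_openPartialHomeomorph_of_injOn isOpen_ball hc.injOn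
    fun z hz => hc.map_nhds hz
  obtain ⟨ψ, K, hψ, hK, hKsub, hψK, hψ0, ht, hjoin⟩ :=
    _root_.exists_exhausting_map hsource (htarget ▸ hc.convex) hr.1 hr.2
  exact ⟨ψ, hψ, hψ0, ht, hc.exists_isMonotoneDirection_comp hψ hK hKsub hψK (by rwa [he] at hjoin)⟩

theorem exists_isMonotoneDirection (hc : IsConvexHarmonic h g) :
    ∃ l, ∃ b ∈ Icc (-1 : ℝ) 1, IsMonotoneDirection l b fun z => deriv h z + deriv g z := by
  obtain ⟨r, -, hr, hr1⟩ := exists_seq_strictMono_tendsto' (zero_lt_one' ℝ)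
  choose ψ hψ hψ0 hψt hdir using fun n => hc.exists_exhausting_map (hr n)
  choose t hrt ht using hψt
  choose l b hb hl using hdir
  have hlim := tendstoLocallyUniformlyOn_id_of_le_deriv (fun n => (hψ n).differentiableOn)
    (fun n => (hψ n).mapsTo) hψ0 (fun n => (hr n).2) hr1 hrt ht
  have hderiv : ∀ n, ∀ z ∈ ball (0 : ℂ) 1, deriv (fun z => h (ψ n z) + g (ψ n z)) z =
      (deriv h (ψ n z) + deriv g (ψ n z)) * deriv (ψ n) z := fun n z hz => by
    have hz' := isOpen_ball.mem_nhds ((hψ n).mapsTo hz)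
    rw [add_mul]
    exact (((hc.differentiableOn_left.differentiableAt hz').hasDerivAt.comp z
      ((hψ n).hasDerivAt hz)).add ((hc.differentiableOn_right.differentiableAt hz').hasDerivAt.comp
        z ((hψ n).hasDerivAt hz))).deriv
  refine exists_isMonotoneDirection_of_tendsto (e := fun _ _ => 0) isCompact_Icc
    (D := fun n => deriv fun z => h (ψ n z) + g (ψ n z)) (fun z hz => ?_)
    (fun z _ => tendsto_const_nhds) fun n => ?_
  · have hψ' := (hlim.deriv (.of_forall fun n => (hψ n).differentiableOn) isOpen_ball).tendsto_at hz
    have hcont : ContinuousAt (fun z => deriv h z + deriv g z) z :=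
      (((hc.differentiableOn_left.deriv isOpen_ball).add
        (hc.differentiableOn_right.deriv isOpen_ball)).continuousOn).continuousAt
        (isOpen_ball.mem_nhds hz)
    have := (hcont.tendsto.comp (hlim.tendsto_at hz)).mul hψ'
    rw [deriv_id, mul_one] at this
    exact this.congr fun n => (hderiv n z hz).symm
  · exact ⟨l n, (hl n).norm_eq, b n, hb n, by simpa only [neg_zero] using (hl n).im_nonneg⟩

end IsConvexHarmonic

/-! ### Taylor coefficients -/

section Caratheodory
variable {Q : ℂ → ℂ} {r : ℝ} {n : ℕ}

lemma taylorCoeffZero_eq_circleAverage (hr : 0 < r) (hQ : DifferentiableOn ℂ Q (closedBall 0 r))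
    (n : ℕ) : taylorCoeffZero Q n = Real.circleAverage (fun z => (z ^ n)⁻¹ * Q z) 0 r := by
  have hcauchy := hQ.circleIntegral_one_div_sub_center_pow_smul hr n
  have hintegrand : ∀ z : ℂ, (1 / (z - 0) ^ (n + 1)) • Q z = (z - 0)⁻¹ • ((z ^ n)⁻¹ * Q z) :=
    fun z => by
      rw [sub_zero, smul_eq_mul, smul_eq_mul, one_div, pow_succ', mul_inv, mul_assoc]
  simp only [hintegrand] at hcauchy
  rw [Real.circleAverage_eq_circleIntegral hr.ne', hcauchy, smul_smul, smul_eq_mul,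
    taylorCoeffZero, ← mul_div_assoc, inv_mul_cancel₀ two_pi_I_ne_zero, one_div_mul_eq_div]

lemma circleAverage_inv_pow_mul_conj (hr : 0 < r) (hQ : DifferentiableOn ℂ Q (closedBall 0 r))
    (hn : n ≠ 0) : Real.circleAverage (fun z => (z ^ n)⁻¹ * conj (Q z)) 0 r = 0 := by
  have hd : DifferentiableOn ℂ (fun z => z ^ n * Q z) (closedBall 0 r) :=
    (differentiable_id.pow n).differentiableOn.mul hQ
  have hmean : Real.circleAverage (fun z => z ^ n * Q z) 0 r = 0 := by
    rw [DiffContOnCl.circleAverage, zero_pow hn, zero_mul]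
    rw [abs_of_pos hr]
    exact DifferentiableOn.diffContOnCl (by rwa [closure_ball _ hr.ne'])
  have hint : CircleIntegrable (fun z => z ^ n * Q z) 0 r :=
    (hd.continuousOn.mono sphere_subset_closedBall).circleIntegrable hr.le
  calc Real.circleAverage (fun z => (z ^ n)⁻¹ * conj (Q z)) 0 r
      = Real.circleAverage (fun z => ((r ^ 2 : ℂ) ^ n)⁻¹ • conjCLE (z ^ n * Q z)) 0 r := by
        refine Real.circleAverage_congr_sphere fun z hz => ?_
        rw [abs_of_pos hr, mem_sphere_zero_iff_norm] at hz
        have hz0 : z ^ n ≠ 0 := pow_ne_zero n (norm_pos_iff.1 (hz ▸ hr))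
        rw [← hz, ← conj_mul', mul_pow, mul_inv, conjCLE_apply, map_mul, map_pow, smul_eq_mul,
          mul_right_comm, ← mul_assoc, inv_mul_cancel₀ (by simpa using hz0)]
        ring
    _ = ((r ^ 2 : ℂ) ^ n)⁻¹ • conjCLE (Real.circleAverage (fun z => z ^ n * Q z) 0 r) := by
        rw [Real.circleAverage_fun_smul]
        exact congrArg _ ((conjCLE : ℂ →L[ℝ] ℂ).circleAverage_comp_comm hint)
    _ = 0 := by rw [hmean, map_zero, smul_zero]

lemma taylorCoeffZero_eq_circleAverage_re (hr : 0 < r)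
    (hQ : DifferentiableOn ℂ Q (closedBall 0 r)) (hn : n ≠ 0) :
    taylorCoeffZero Q n = Real.circleAverage (fun z => (z ^ n)⁻¹ * (2 * (Q z).re : ℝ)) 0 r := by
  have hinv : ContinuousOn (fun z : ℂ => (z ^ n)⁻¹) (sphere 0 r) :=
    (continuous_pow n).continuousOn.inv₀ fun z hz =>
      pow_ne_zero n (norm_pos_iff.1 (mem_sphere_zero_iff_norm.1 hz ▸ hr))
  have hQs := hQ.continuousOn.mono sphere_subset_closedBall
  calc taylorCoeffZero Q n
      = Real.circleAverage (fun z => (z ^ n)⁻¹ * Q z) 0 r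
        + Real.circleAverage (fun z => (z ^ n)⁻¹ * conj (Q z)) 0 r := by
        rw [circleAverage_inv_pow_mul_conj hr hQ hn, add_zero,
          taylorCoeffZero_eq_circleAverage hr hQ]
    _ = Real.circleAverage (fun z => (z ^ n)⁻¹ * Q z + (z ^ n)⁻¹ * conj (Q z)) 0 r :=
        (Real.circleAverage_fun_add ((hinv.mul hQs).circleIntegrable hr.le)
          ((hinv.mul (continuous_conj.comp_continuousOn hQs)).circleIntegrable hr.le)).symm
    _ = Real.circleAverage (fun z => (z ^ n)⁻¹ * (2 * (Q z).re : ℝ)) 0 r := by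
        simp only [← mul_add, add_conj]

lemma norm_taylorCoeffZero_mul_pow_le (hr : 0 < r)
    (hQ : DifferentiableOn ℂ Q (closedBall 0 r)) (hre : ∀ z ∈ closedBall (0 : ℂ) r, 0 ≤ (Q z).re)
    (hn : n ≠ 0) : ‖taylorCoeffZero Q n‖ * r ^ n ≤ 2 * (Q 0).re := by
  have hnorm : ∀ θ : ℝ, ‖(circleMap 0 r θ ^ n)⁻¹ * ((2 * (Q (circleMap 0 r θ)).re : ℝ) : ℂ)‖ =
      (r ^ n)⁻¹ * (2 * (Q (circleMap 0 r θ)).re) := fun θ => by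
    have := hre _ (circleMap_mem_closedBall 0 hr.le θ)
    rw [norm_mul, norm_inv, norm_pow, norm_circleMap_zero, abs_of_pos hr, norm_real,
      Real.norm_of_nonneg (by positivity)]
  have hmean : (Q 0).re = Real.circleAverage (fun z => (Q z).re) 0 r := by
    have hQc : DiffContOnCl ℂ Q (ball 0 |r|) :=
      DifferentiableOn.diffContOnCl (by rwa [abs_of_pos hr, closure_ball _ hr.ne'])
    rw [← hQc.circleAverage]
    exact (reCLM.circleAverage_comp_comm
      ((hQ.continuousOn.mono sphere_subset_closedBall).circleIntegrable hr.le)).symm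
  rw [← le_div_iff₀ (pow_pos hr n), taylorCoeffZero_eq_circleAverage_re hr hQ hn]
  calc ‖Real.circleAverage (fun z => (z ^ n)⁻¹ * ((2 * (Q z).re : ℝ) : ℂ)) 0 r‖
      ≤ Real.circleAverage (fun z => (r ^ n)⁻¹ * 2 * (Q z).re) 0 r := by
        rw [Real.circleAverage_def, Real.circleAverage_def, norm_smul, smul_eq_mul,
          Real.norm_of_nonneg (by positivity)]
        gcongr
        refine (intervalIntegral.norm_integral_le_integral_norm (by positivity)).trans_eq ?_
        simp only [hnorm, mul_assoc]
    _ = 2 * (Q 0).re / r ^ n := by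
        simp only [← smul_eq_mul (a := (r ^ n)⁻¹ * 2)]
        rw [Real.circleAverage_fun_smul, ← hmean, smul_eq_mul]
        ring

theorem norm_taylorCoeffZero_le_of_re_nonneg (hQ : DifferentiableOn ℂ Q (ball 0 1))
    (hre : ∀ z ∈ ball (0 : ℂ) 1, 0 ≤ (Q z).re) (hn : n ≠ 0) :
    ‖taylorCoeffZero Q n‖ ≤ 2 * (Q 0).re := by
  have hlim : Tendsto (fun r : ℝ => ‖taylorCoeffZero Q n‖ * r ^ n) (𝓝[<] 1)
      (𝓝 (‖taylorCoeffZero Q n‖ * 1 ^ n)) :=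
    ((continuous_const.mul (continuous_pow n)).tendsto 1).mono_left nhdsWithin_le_nhds
  rw [one_pow, mul_one] at hlim
  refine le_of_tendsto hlim ?_
  filter_upwards [Ioo_mem_nhdsLT (zero_lt_one' ℝ)] with r hr
  have hsub : closedBall (0 : ℂ) r ⊆ ball 0 1 := closedBall_subset_ball hr.2
  exact norm_taylorCoeffZero_mul_pow_le hr.1 (hQ.mono hsub) (fun z hz => hre z (hsub hz)) hn

end Caratheodory

section TaylorPowerSeries
variable {p q : ℂ → ℂ}

lemma taylorCoeffZero_zero (p : ℂ → ℂ) : taylorCoeffZero p 0 = p 0 := by simp [taylorCoeffZero]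

lemma taylorCoeffZero_one (p : ℂ → ℂ) : taylorCoeffZero p 1 = deriv p 0 := by
  simp [taylorCoeffZero]

lemma taylorCoeffZero_congr (h : p =ᶠ[𝓝 0] q) (n : ℕ) :
    taylorCoeffZero p n = taylorCoeffZero q n := by
  rw [taylorCoeffZero, taylorCoeffZero, h.iteratedDeriv_eq]

lemma taylorCoeffZero_const_mul (c : ℂ) (p : ℂ → ℂ) (n : ℕ) :
    taylorCoeffZero (fun z => c * p z) n = c * taylorCoeffZero p n := by
  rw [taylorCoeffZero, taylorCoeffZero, iteratedDeriv_const_mul_field, mul_div_assoc]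

lemma taylorCoeffZero_deriv (p : ℂ → ℂ) (n : ℕ) :
    taylorCoeffZero (deriv p) n = (n + 1) * taylorCoeffZero p (n + 1) := by
  have : (n : ℂ) + 1 ≠ 0 := by exact_mod_cast n.succ_ne_zero
  rw [taylorCoeffZero, taylorCoeffZero, iteratedDeriv_succ', Nat.factorial_succ, Nat.cast_mul,
    Nat.cast_succ, ← mul_div_assoc, mul_div_mul_left _ _ this]

/-- The Taylor series at the origin as a formal power series. -/
noncomputable def taylorPowerSeries (p : ℂ → ℂ) : PowerSeries ℂ :=
  PowerSeries.mk (taylorCoeffZero p)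

lemma coeff_taylorPowerSeries (p : ℂ → ℂ) (n : ℕ) :
    PowerSeries.coeff n (taylorPowerSeries p) = taylorCoeffZero p n :=
  PowerSeries.coeff_mk _ _

lemma taylorPowerSeries_congr (h : p =ᶠ[𝓝 0] q) : taylorPowerSeries p = taylorPowerSeries q := by
  ext n
  rw [coeff_taylorPowerSeries, coeff_taylorPowerSeries, taylorCoeffZero_congr h]

lemma taylorPowerSeries_mul (hp : AnalyticAt ℂ p 0) (hq : AnalyticAt ℂ q 0) :
    taylorPowerSeries (p * q) = taylorPowerSeries p * taylorPowerSeries q := by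
  ext n
  rw [coeff_taylorPowerSeries, PowerSeries.coeff_mul, taylorCoeffZero,
    iteratedDeriv_mul hp.contDiffAt hq.contDiffAt, Finset.sum_div,
    Finset.Nat.sum_antidiagonal_eq_sum_range_succ_mk]
  refine Finset.sum_congr rfl fun i hi => ?_
  simp only [coeff_taylorPowerSeries, taylorCoeffZero]
  rw [Nat.cast_choose _ (Nat.lt_succ_iff.1 (Finset.mem_range.1 hi))]
  have : (n.factorial : ℂ) ≠ 0 := by exact_mod_cast n.factorial_ne_zero
  field_simp

lemma taylorPowerSeries_add (hp : AnalyticAt ℂ p 0) (hq : AnalyticAt ℂ q 0) :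
    taylorPowerSeries (p + q) = taylorPowerSeries p + taylorPowerSeries q := by
  ext n
  simp only [map_add, coeff_taylorPowerSeries, taylorCoeffZero,
    iteratedDeriv_add hp.contDiffAt hq.contDiffAt, add_div]

lemma taylorPowerSeries_const (c : ℂ) : taylorPowerSeries (fun _ => c) = PowerSeries.C c := by
  ext n
  rw [coeff_taylorPowerSeries, taylorCoeffZero, iteratedDeriv_const, PowerSeries.coeff_C]
  split_ifs with h
  · rw [h, Nat.factorial_zero, Nat.cast_one, div_one]
  · exact zero_div _

lemma taylorPowerSeries_id : taylorPowerSeries id = PowerSeries.X := by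
  ext n
  rw [coeff_taylorPowerSeries, PowerSeries.coeff_X]
  rcases n with _ | _ | n
  · simp [taylorCoeffZero]
  · simp [taylorCoeffZero]
  · simp [taylorCoeffZero, iteratedDeriv_succ']

lemma taylorPowerSeries_tangentField_mul (l : ℂ) (b : ℝ) (hp : AnalyticAt ℂ p 0) :
    taylorPowerSeries (fun z => tangentField l b z * p z) =
      (PowerSeries.C l + PowerSeries.C (2 * (b : ℂ)) * PowerSeries.X
        + PowerSeries.C (conj l) * PowerSeries.X ^ 2) * taylorPowerSeries p := by
  have heq : (fun z => tangentField l b z * p z) =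
      ((fun _ => l) + (fun _ => 2 * (b : ℂ)) * id + (fun _ => conj l) * (id * id)) * p := by
    ext z
    simp only [tangentField, Pi.mul_apply, Pi.add_apply, id_eq]
    ring
  have hid : AnalyticAt ℂ (id : ℂ → ℂ) 0 := analyticAt_id
  have hc : ∀ c : ℂ, AnalyticAt ℂ (fun _ : ℂ => c) 0 := fun c => analyticAt_const
  rw [heq, taylorPowerSeries_mul (((hc _).add ((hc _).mul hid)).add ((hc _).mul (hid.mul hid))) hp,
    taylorPowerSeries_add ((hc _).add ((hc _).mul hid)) ((hc _).mul (hid.mul hid)),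
    taylorPowerSeries_add (hc _) ((hc _).mul hid), taylorPowerSeries_mul (hc _) hid,
    taylorPowerSeries_mul (hc _) (hid.mul hid), taylorPowerSeries_mul hid hid,
    taylorPowerSeries_const, taylorPowerSeries_const, taylorPowerSeries_const,
    taylorPowerSeries_id, pow_two]

end TaylorPowerSeries

/-! ### Rotations of a convex harmonic map -/

lemma mul_tangentField_add_mul_tangentField (s t b₁ b₂ : ℝ) (l₁ l₂ z : ℂ) :
    s * tangentField l₁ b₁ z + t * tangentField l₂ b₂ z =
      tangentField (s * l₁ + t * l₂) (s * b₁ + t * b₂) z := by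
  simp only [tangentField, map_add, map_mul, conj_ofReal, ofReal_add, ofReal_mul]
  ring

namespace IsMonotoneDirection
variable {l : ℂ} {b : ℝ} {d : ℂ → ℂ}

lemma neg (hd : IsMonotoneDirection l b d) : IsMonotoneDirection (-l) (-b) (-d) :=
  ⟨by rw [norm_neg, hd.norm_eq], fun z hz => (hd.im_nonneg z hz).trans_eq (by
    rw [tangentField_neg, Pi.neg_apply, neg_mul_neg])⟩

lemma of_ne_zero (hl : l ≠ 0) (h : ∀ z ∈ ball (0 : ℂ) 1, 0 ≤ (tangentField l b z * d z).im) :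
    IsMonotoneDirection ((‖l‖⁻¹ : ℝ) * l) (‖l‖⁻¹ * b) d := by
  refine ⟨?_, fun z hz => ?_⟩
  · rw [norm_mul, norm_real, norm_inv, norm_norm, inv_mul_cancel₀ (norm_ne_zero_iff.2 hl)]
  · have hscale := mul_tangentField_add_mul_tangentField ‖l‖⁻¹ 0 b 0 l 0 z
    simp only [ofReal_zero, zero_mul, add_zero] at hscale
    rw [← hscale, mul_assoc, im_ofReal_mul]
    exact mul_nonneg (inv_nonneg.2 (norm_nonneg l)) (h z hz)

/-- Of two directions with `b` of opposite signs, the combination which cancels `b` is a direction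
with `b = 0`, unless it vanishes identically. -/
lemma exists_zero_or_im_eq_zero {l₁ l₂ : ℂ} {b₁ b₂ : ℝ} (h₁ : IsMonotoneDirection l₁ b₁ d)
    (h₂ : IsMonotoneDirection l₂ b₂ d) (hb₁ : 0 < b₁) (hb₂ : b₂ < 0) :
    (∃ l, IsMonotoneDirection l 0 d) ∨
      ∀ z ∈ ball (0 : ℂ) 1, (tangentField l₁ b₁ z * d z).im = 0 := by
  set l : ℂ := (-b₂ : ℝ) * l₁ + b₁ * l₂
  have hcancel : ∀ z, -b₂ * (tangentField l₁ b₁ z * d z).im +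
      b₁ * (tangentField l₂ b₂ z * d z).im = (tangentField l 0 z * d z).im := fun z => by
    have hcomb := mul_tangentField_add_mul_tangentField (-b₂) b₁ b₁ b₂ l₁ l₂ z
    rw [neg_mul, mul_comm b₂, neg_add_cancel] at hcomb
    rw [← hcomb, add_mul, add_im, mul_assoc, mul_assoc, im_ofReal_mul, im_ofReal_mul]
  have hnonneg₁ := fun z hz => mul_nonneg (neg_pos.2 hb₂).le (h₁.im_nonneg z hz)
  have hnonneg₂ := fun z hz => mul_nonneg hb₁.le (h₂.im_nonneg z hz)
  rcases eq_or_ne l 0 with hl | hl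
  · refine .inr fun z hz => ?_
    have hzero := hcancel z
    simp only [hl, tangentField, ofReal_zero, map_zero, mul_zero, zero_mul, add_zero,
      zero_im] at hzero
    exact (mul_eq_zero_iff_left (neg_pos.2 hb₂).ne').1
      ((add_eq_zero_iff_of_nonneg (hnonneg₁ z hz) (hnonneg₂ z hz)).1 hzero).1
  · refine .inl ⟨_, mul_zero ‖l‖⁻¹ ▸ of_ne_zero hl fun z hz => ?_⟩
    exact (add_nonneg (hnonneg₁ z hz) (hnonneg₂ z hz)).trans_eq (hcancel z)

end IsMonotoneDirection

/-- The derivative of the holomorphic function `conj u * h + u * g`, whose real part is that of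
`conj u * (h + conj g)`. -/
noncomputable def rotatedDeriv (h g : ℂ → ℂ) (u z : ℂ) : ℂ := conj u * deriv h z + u * deriv g z

lemma rotatedDeriv_neg (h g : ℂ → ℂ) (u : ℂ) : rotatedDeriv h g (-u) = -rotatedDeriv h g u := by
  ext z
  simp only [rotatedDeriv, Pi.neg_apply, map_neg]
  ring

lemma isClosed_setOf_isMonotoneDirection_rotatedDeriv (h g : ℂ → ℂ) {A : Set ℝ}
    (hA : IsCompact A) :
    IsClosed {t : ℝ | ∃ l, ∃ b ∈ A, IsMonotoneDirection l b (rotatedDeriv h g (exp (t * I)))} := by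
  refine IsSeqClosed.isClosed fun t t₀ ht hlim => ?_
  have hu : Tendsto (fun n => exp (t n * I)) atTop (𝓝 (exp (t₀ * I))) :=
    ((by fun_prop : Continuous fun s : ℝ => exp (s * I)).tendsto t₀).comp hlim
  refine exists_isMonotoneDirection_of_tendsto (e := fun _ _ => 0)
    (D := fun n => rotatedDeriv h g (exp (t n * I))) hA
    (fun z _ => (((continuous_conj.tendsto _).comp hu).mul_const _).add (hu.mul_const _))
    (fun _ _ => tendsto_const_nhds) fun n => ?_
  obtain ⟨l, b, hb, hl⟩ := ht n
  exact ⟨l, hl.norm_eq, b, hb, by simpa only [neg_zero] using hl.im_nonneg⟩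

namespace IsConvexHarmonic
variable {h g : ℂ → ℂ}

lemma exists_isMonotoneDirection_rotatedDeriv (hc : IsConvexHarmonic h g) {u : ℂ} (hu : ‖u‖ = 1) :
    ∃ l, ∃ b ∈ Icc (-1 : ℝ) 1, IsMonotoneDirection l b (rotatedDeriv h g u) := by
  have hrot := (hc.rotate (u := conj u) (by rwa [RCLike.norm_conj])).exists_isMonotoneDirection
  simp only [deriv_const_mul_field, conj_conj] at hrot
  exact hrot

/-- Replacing `u` by `-u` changes the sign of `b`, so by connectedness some `u` allows both
signs. -/
lemma exists_isMonotoneDirection_of_both_signs (hc : IsConvexHarmonic h g) :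
    ∃ u : ℂ, ‖u‖ = 1 ∧
      (∃ l, ∃ b ∈ Icc (0 : ℝ) 1, IsMonotoneDirection l b (rotatedDeriv h g u)) ∧
      ∃ l, ∃ b ∈ Icc (-1 : ℝ) 0, IsMonotoneDirection l b (rotatedDeriv h g u) := by
  set P := {t : ℝ | ∃ l, ∃ b ∈ Icc (0 : ℝ) 1,
    IsMonotoneDirection l b (rotatedDeriv h g (exp (t * I)))}
  set N := {t : ℝ | ∃ l, ∃ b ∈ Icc (-1 : ℝ) 0,
    IsMonotoneDirection l b (rotatedDeriv h g (exp (t * I)))}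
  have hcover : ∀ t : ℝ, t ∈ P ∪ N := fun t => by
    obtain ⟨l, b, hb, hl⟩ :=
      hc.exists_isMonotoneDirection_rotatedDeriv (norm_exp_ofReal_mul_I t)
    rcases le_total 0 b with hb0 | hb0
    · exact .inl ⟨l, b, ⟨hb0, hb.2⟩, hl⟩
    · exact .inr ⟨l, b, ⟨hb.1, hb0⟩, hl⟩
  have hanti : ∀ t : ℝ, exp ((t + Real.pi : ℝ) * I) = -exp (t * I) := fun t => by
    rw [ofReal_add, add_mul, exp_add, exp_pi_mul_I, mul_neg_one]
  have hPN : ∀ t ∈ P, t + Real.pi ∈ N := by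
    rintro t ⟨l, b, hb, hl⟩
    refine ⟨-l, -b, ⟨neg_le_neg hb.2, neg_nonpos.2 hb.1⟩, ?_⟩
    rw [hanti, rotatedDeriv_neg]
    exact hl.neg
  have hNP : ∀ t ∈ N, t + Real.pi ∈ P := by
    rintro t ⟨l, b, hb, hl⟩
    refine ⟨-l, -b, ⟨neg_nonneg.2 hb.2, by linarith [hb.1]⟩, ?_⟩
    rw [hanti, rotatedDeriv_neg]
    exact hl.neg
  have hne : P.Nonempty ∧ N.Nonempty :=
    (hcover 0).elim (fun h0 => ⟨⟨_, h0⟩, ⟨_, hPN _ h0⟩⟩) fun h0 => ⟨⟨_, hNP _ h0⟩, ⟨_, h0⟩⟩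
  obtain ⟨t, -, htP, htN⟩ := isPreconnected_closed_iff.1 (isPreconnected_univ (α := ℝ)) P N
    (isClosed_setOf_isMonotoneDirection_rotatedDeriv h g isCompact_Icc)
    (isClosed_setOf_isMonotoneDirection_rotatedDeriv h g isCompact_Icc) (fun t _ => hcover t)
    (by simpa only [univ_inter] using hne.1) (by simpa only [univ_inter] using hne.2)
  exact ⟨exp (t * I), norm_exp_ofReal_mul_I t, htP, htN⟩

lemma exists_isMonotoneDirection_zero_or_im_eq_zero (hc : IsConvexHarmonic h g) :
    ∃ u : ℂ, ‖u‖ = 1 ∧ ((∃ l, IsMonotoneDirection l 0 (rotatedDeriv h g u)) ∨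
      ∃ l : ℂ, ‖l‖ = 1 ∧ ∃ b ∈ Icc (-1 : ℝ) 1,
        ∀ z ∈ ball (0 : ℂ) 1, (tangentField l b z * rotatedDeriv h g u z).im = 0) := by
  obtain ⟨u, hu, ⟨l₁, b₁, hb₁, h₁⟩, l₂, b₂, hb₂, h₂⟩ := hc.exists_isMonotoneDirection_of_both_signs
  refine ⟨u, hu, ?_⟩
  rcases hb₁.1.eq_or_lt with rfl | hpos
  · exact .inl ⟨l₁, h₁⟩
  rcases hb₂.2.eq_or_lt with rfl | hneg
  · exact .inl ⟨l₂, h₂⟩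
  exact (h₁.exists_zero_or_im_eq_zero h₂ hpos hneg).imp_right fun him =>
    ⟨l₁, h₁.norm_eq, b₁, ⟨by linarith, hb₁.2⟩, him⟩

end IsConvexHarmonic

/-! ### Coefficient bounds -/

section PowerSeries
open PowerSeries

lemma coeff_succ_one_sub_C_mul_X_mul {R : Type*} [CommRing R] (q : R) (F : PowerSeries R) (n : ℕ) :
    coeff (n + 1) ((1 - C q * X) * F) = coeff (n + 1) F - q * coeff n F := by
  rw [sub_mul, one_mul, mul_assoc, map_sub, coeff_C_mul, coeff_succ_X_mul]

lemma norm_coeff_eq_of_one_sub_C_mul_X_mul_eq_C {p k : ℂ} (hp : ‖p‖ = 1) {F : PowerSeries ℂ}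
    (hF : (1 - C p * X) * F = C k) (n : ℕ) : ‖coeff n F‖ = ‖k‖ := by
  induction n with
  | zero => simpa using congrArg (fun F => ‖coeff 0 F‖) hF
  | succ n ih =>
    have hcoeff := congrArg (coeff (n + 1)) hF
    rw [coeff_succ_one_sub_C_mul_X_mul, coeff_C, if_neg n.succ_ne_zero, sub_eq_zero] at hcoeff
    rw [hcoeff, norm_mul, hp, one_mul, ih]

lemma norm_coeff_le_of_one_sub_C_mul_X_mul_eq_C {p q k : ℂ} (hp : ‖p‖ = 1) (hq : ‖q‖ = 1)
    {F : PowerSeries ℂ} (hF : (1 - C p * X) * ((1 - C q * X) * F) = C k) (n : ℕ) :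
    ‖coeff n F‖ ≤ (n + 1) * ‖k‖ := by
  have hnorm := norm_coeff_eq_of_one_sub_C_mul_X_mul_eq_C hp hF
  induction n with
  | zero => simpa using (hnorm 0).le
  | succ n ih =>
    have hn := hnorm (n + 1)
    rw [coeff_succ_one_sub_C_mul_X_mul] at hn
    have htri := norm_le_norm_sub_add (coeff (n + 1) F) (q * coeff n F)
    rw [hn, norm_mul, hq, one_mul] at htri
    push_cast
    linarith

lemma norm_coeff_le_of_norm_coeff_C_add_C_mul_X_sq_mul_le {p q : ℂ} (hp : ‖p‖ = 1) (hq : ‖q‖ = 1)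
    {F : PowerSeries ℂ} {M : ℝ} (h0 : ‖coeff 0 F‖ ≤ M)
    (h : ∀ m, m ≠ 0 → ‖coeff m ((C p + C q * X ^ 2) * F)‖ ≤ 2 * M) (n : ℕ) :
    ‖coeff n F‖ ≤ (n + 1) * M := by
  induction n using Nat.twoStepInduction with
  | zero => simpa using h0
  | one =>
    have h1 := h 1 one_ne_zero
    rw [add_mul, map_add, coeff_C_mul, mul_assoc, coeff_C_mul, coeff_X_pow_mul',
      if_neg (by norm_num), mul_zero, add_zero, norm_mul, hp, one_mul] at h1
    push_cast
    linarith
  | more m ih _ =>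
    have hm := h (m + 2) (by lia)
    rw [add_mul, map_add, coeff_C_mul, mul_assoc, coeff_C_mul, coeff_X_pow_mul] at hm
    have htri := norm_sub_le_norm_add (p * coeff (m + 2) F) (q * coeff m F)
    rw [norm_mul, norm_mul, hp, hq, one_mul, one_mul] at htri
    push_cast
    linarith

lemma norm_coeff_mul_le {R : Type*} [NormedCommRing R] {S T : PowerSeries R} {c : ℝ}
    (hS : ∀ n, ‖coeff n S‖ ≤ n + 1) (hT : ∀ n, ‖coeff n T‖ ≤ c) (n : ℕ) :
    ‖coeff n (S * T)‖ ≤ c * ((n + 1) * (n + 2) / 2) := by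
  have hgauss : ∀ m : ℕ, ∑ i ∈ Finset.range (m + 1), ((i : ℝ) + 1) = (m + 1) * (m + 2) / 2 := by
    intro m
    induction m with
    | zero => norm_num
    | succ m ih =>
      rw [Finset.sum_range_succ, ih]
      push_cast
      ring
  rw [coeff_mul, Finset.Nat.sum_antidiagonal_eq_sum_range_succ_mk]
  calc ‖∑ k ∈ Finset.range (n + 1), coeff k S * coeff (n - k) T‖
      ≤ ∑ k ∈ Finset.range (n + 1), ((k : ℝ) + 1) * c := norm_sum_le_of_le _ fun k _ =>
        (norm_mul_le _ _).trans (mul_le_mul (hS k) (hT _) (norm_nonneg _) (by positivity))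
    _ = c * ((n + 1) * (n + 2) / 2) := by rw [← Finset.sum_mul, hgauss, mul_comm]

end PowerSeries

section DirectionBounds
variable {l : ℂ} {b : ℝ} {F : ℂ → ℂ}

/-- The roots of `tangentField l b` lie on the unit circle. -/
lemma exists_taylorPowerSeries_tangentField_mul_eq (hl : ‖l‖ = 1) (hb : b ∈ Icc (-1 : ℝ) 1)
    (hF : AnalyticAt ℂ F 0) : ∃ p q : ℂ, ‖p‖ = 1 ∧ ‖q‖ = 1 ∧
      taylorPowerSeries (fun z => tangentField l b z * F z) =
        PowerSeries.C l * ((1 - PowerSeries.C p * PowerSeries.X) *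
          ((1 - PowerSeries.C q * PowerSeries.X) * taylorPowerSeries F)) := by
  set t := Real.arccos (-b)
  have hcos : exp (t * I) + exp (-t * I) = -(2 * b) := by
    rw [← two_cos, ← ofReal_cos, Real.cos_arccos (by linarith [hb.2]) (by linarith [hb.1]),
      ofReal_neg, mul_neg]
  have hexp : exp (t * I) * exp (-t * I) = 1 := by
    rw [← exp_add, neg_mul, add_neg_cancel, exp_zero]
  have hconj : l * conj l = 1 := by
    rw [mul_conj', hl, ofReal_one, one_pow]
  have hsum : -(l * (conj l * exp (t * I) + conj l * exp (-t * I))) = 2 * b := by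
    linear_combination -(exp (t * I) + exp (-t * I)) * hconj - hcos
  have hprod : l * ((conj l * exp (t * I)) * (conj l * exp (-t * I))) = conj l := by
    linear_combination conj l * exp (t * I) * exp (-t * I) * hconj + conj l * hexp
  refine ⟨conj l * exp (t * I), conj l * exp (-t * I), ?_, ?_, ?_⟩
  · rw [norm_mul, RCLike.norm_conj, hl, norm_exp_ofReal_mul_I, one_mul]
  · rw [norm_mul, RCLike.norm_conj, hl, ← ofReal_neg, norm_exp_ofReal_mul_I, one_mul]
  · have hprodC := congrArg PowerSeries.C hprod
    simp only [map_mul] at hprodC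
    rw [taylorPowerSeries_tangentField_mul l b hF, ← hsum]
    simp only [map_mul, map_neg, map_add]
    linear_combination -(PowerSeries.X ^ 2 * taylorPowerSeries F) * hprodC

lemma norm_taylorCoeffZero_le_of_eventuallyEq_const (hl : ‖l‖ = 1) (hb : b ∈ Icc (-1 : ℝ) 1)
    (hF : AnalyticAt ℂ F 0) {k : ℂ} (hk : (fun z => tangentField l b z * F z) =ᶠ[𝓝 0] fun _ => k)
    (n : ℕ) : ‖taylorCoeffZero F n‖ ≤ (n + 1) * ‖F 0‖ := by
  have hk0 : ‖k‖ = ‖F 0‖ := by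
    have hk' : tangentField l b 0 * F 0 = k := hk.self_of_nhds
    rw [← hk', norm_mul]
    simp [tangentField, hl]
  obtain ⟨p, q, hp, hq, heq⟩ := exists_taylorPowerSeries_tangentField_mul_eq hl hb hF
  rw [taylorPowerSeries_congr hk, taylorPowerSeries_const] at heq
  have hl0 : l ≠ 0 := norm_ne_zero_iff.1 (hl ▸ one_ne_zero)
  have hC : PowerSeries.C (l⁻¹ * k) = PowerSeries.C l⁻¹ * PowerSeries.C k := map_mul _ _ _
  rw [heq, ← mul_assoc, ← map_mul, inv_mul_cancel₀ hl0, map_one, one_mul] at hC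
  have hbound := norm_coeff_le_of_one_sub_C_mul_X_mul_eq_C hp hq hC.symm n
  rwa [coeff_taylorPowerSeries, norm_mul, norm_inv, hl, inv_one, one_mul, hk0] at hbound

lemma norm_taylorCoeffZero_le_of_im_nonneg {Q : ℂ → ℂ} (hQ : DifferentiableOn ℂ Q (ball 0 1))
    (him : ∀ z ∈ ball (0 : ℂ) 1, 0 ≤ (Q z).im) {n : ℕ} (hn : n ≠ 0) :
    ‖taylorCoeffZero Q n‖ ≤ 2 * (Q 0).im := by
  have hbound := norm_taylorCoeffZero_le_of_re_nonneg (hQ.const_mul (-I))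
    (fun z hz => by simpa using him z hz) hn
  rw [taylorCoeffZero_const_mul, norm_mul, norm_neg, norm_I, one_mul] at hbound
  simpa using hbound

lemma IsMonotoneDirection.norm_taylorCoeffZero_le (hl : IsMonotoneDirection l 0 F)
    (hF : DifferentiableOn ℂ F (ball 0 1)) (n : ℕ) :
    ‖taylorCoeffZero F n‖ ≤ (n + 1) * ‖F 0‖ := by
  have hQ : DifferentiableOn ℂ (fun z => tangentField l 0 z * F z) (ball 0 1) := by
    unfold tangentField
    fun_prop
  have hbound : ∀ m, m ≠ 0 → ‖PowerSeries.coeff m ((PowerSeries.C l +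
      PowerSeries.C (conj l) * PowerSeries.X ^ 2) * taylorPowerSeries F)‖ ≤ 2 * ‖F 0‖ := by
    intro m hm
    have hseries := taylorPowerSeries_tangentField_mul l 0
      (hF.analyticAt (isOpen_ball.mem_nhds (mem_ball_self one_pos)))
    rw [ofReal_zero, mul_zero, map_zero, zero_mul, add_zero] at hseries
    rw [← hseries, coeff_taylorPowerSeries]
    refine (norm_taylorCoeffZero_le_of_im_nonneg hQ hl.im_nonneg hm).trans ?_
    refine mul_le_mul_of_nonneg_left ((im_le_norm _).trans_eq ?_) zero_le_two
    simp [tangentField, hl.norm_eq]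
  rw [← coeff_taylorPowerSeries]
  exact norm_coeff_le_of_norm_coeff_C_add_C_mul_X_sq_mul_le hl.norm_eq
    (by rw [RCLike.norm_conj, hl.norm_eq])
    (by rw [coeff_taylorPowerSeries, taylorCoeffZero_zero]) hbound n

end DirectionBounds

section DominatedPair

lemma re_sub_div_add_nonneg {a b : ℂ} (h : ‖b‖ ≤ ‖a‖) : 0 ≤ ((a - b) / (a + b)).re := by
  have hsq := mul_self_le_mul_self (norm_nonneg _) h
  rw [norm_mul_self_eq_normSq, norm_mul_self_eq_normSq, normSq_apply, normSq_apply] at hsq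
  rw [div_eq_mul_inv, inv_def, ← mul_assoc, re_mul_ofReal]
  refine mul_nonneg ?_ (inv_nonneg.2 (normSq_nonneg _))
  simp only [mul_re, sub_re, sub_im, map_add, add_re, add_im, conj_re, conj_im]
  linarith

variable {A B : ℂ → ℂ}

lemma taylorPowerSeries_add_mul_one_add (hA : AnalyticAt ℂ A 0) (hB : AnalyticAt ℂ B 0)
    (h0 : A 0 + B 0 ≠ 0) :
    taylorPowerSeries (A + B) * (1 + taylorPowerSeries ((A - B) / (A + B))) =
      PowerSeries.C 2 * taylorPowerSeries A := by
  have hcont : ContinuousAt (A + B) 0 := (hA.add hB).continuousAt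
  have heq : A + B + (A + B) * ((A - B) / (A + B)) =ᶠ[𝓝 0] fun z => 2 * A z := by
    filter_upwards [hcont.eventually_ne h0] with z hz
    simp only [Pi.add_apply, Pi.mul_apply, Pi.div_apply, Pi.sub_apply] at hz ⊢
    rw [mul_div_cancel₀ _ hz]
    ring
  have hdiv := (hA.sub hB).div (hA.add hB) h0
  rw [mul_add, mul_one, ← taylorPowerSeries_mul (hA.add hB) hdiv,
    ← taylorPowerSeries_add (hA.add hB) ((hA.add hB).mul hdiv), taylorPowerSeries_congr heq]
  ext n
  rw [coeff_taylorPowerSeries, PowerSeries.coeff_C_mul, coeff_taylorPowerSeries,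
    taylorCoeffZero_const_mul]

lemma taylorPowerSeries_add_mul_one_sub (hA : AnalyticAt ℂ A 0) (hB : AnalyticAt ℂ B 0)
    (h0 : A 0 + B 0 ≠ 0) :
    taylorPowerSeries (A + B) * (1 - taylorPowerSeries ((A - B) / (A + B))) =
      PowerSeries.C 2 * taylorPowerSeries B := by
  have hadd := taylorPowerSeries_add_mul_one_add hA hB h0
  rw [map_ofNat] at hadd ⊢
  linear_combination 2 * taylorPowerSeries_add hA hB - hadd

variable (hA : DifferentiableOn ℂ A (ball 0 1)) (hB : DifferentiableOn ℂ B (ball 0 1))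
  (hlt : ∀ z ∈ ball (0 : ℂ) 1, ‖B z‖ < ‖A z‖) (hB0 : B 0 = 0)
include hA hB hlt hB0

lemma norm_taylorCoeffZero_sub_div_add_le {n : ℕ} (hn : n ≠ 0) :
    ‖taylorCoeffZero ((A - B) / (A + B)) n‖ ≤ 2 := by
  have hne : ∀ z ∈ ball (0 : ℂ) 1, A z + B z ≠ 0 := fun z hz h0 =>
    (hlt z hz).ne' (by rw [eq_neg_of_add_eq_zero_left h0, norm_neg])
  have hA0 : A 0 ≠ 0 := norm_pos_iff.1 ((norm_nonneg _).trans_lt (hlt 0 (mem_ball_self one_pos)))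
  refine (norm_taylorCoeffZero_le_of_re_nonneg ((hA.sub hB).div (hA.add hB) hne)
    (fun z hz => re_sub_div_add_nonneg (hlt z hz).le) hn).trans_eq ?_
  simp [hB0, hA0]

/-- With `Q = (A - B) / (A + B)`, of positive real part, `2 A = (A + B) (1 + Q)` and
`2 B = (A + B) (1 - Q)`. -/
lemma norm_taylorCoeffZero_le_of_norm_taylorCoeffZero_add_le
    (hS : ∀ n, ‖taylorCoeffZero (A + B) n‖ ≤ n + 1) (n : ℕ) :
    ‖taylorCoeffZero A n‖ ≤ (n + 1) * (n + 2) / 2 ∧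
      ‖taylorCoeffZero B n‖ ≤ n * (n + 1) / 2 := by
  have hnhds := isOpen_ball.mem_nhds (mem_ball_self (x := (0 : ℂ)) one_pos)
  have hA0 : A 0 ≠ 0 := norm_pos_iff.1 ((norm_nonneg _).trans_lt (hlt 0 (mem_ball_self one_pos)))
  set S := taylorPowerSeries (A + B)
  set T := taylorPowerSeries ((A - B) / (A + B))
  have h0 : A 0 + B 0 ≠ 0 := by rwa [hB0, add_zero]
  have hAT : S * (1 + T) = PowerSeries.C 2 * taylorPowerSeries A :=
    taylorPowerSeries_add_mul_one_add (hA.analyticAt hnhds) (hB.analyticAt hnhds) h0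
  have hBT : S * (1 - T) = PowerSeries.C 2 * taylorPowerSeries B :=
    taylorPowerSeries_add_mul_one_sub (hA.analyticAt hnhds) (hB.analyticAt hnhds) h0
  have hT0 : PowerSeries.coeff 0 T = 1 := by
    simp [T, coeff_taylorPowerSeries, taylorCoeffZero_zero, hB0, hA0]
  have hT : ∀ m, ‖PowerSeries.coeff (m + 1) T‖ ≤ 2 := fun m => by
    rw [coeff_taylorPowerSeries]
    exact norm_taylorCoeffZero_sub_div_add_le hA hB hlt hB0 m.succ_ne_zero
  have hSn : ∀ m, ‖PowerSeries.coeff m S‖ ≤ m + 1 := fun m => by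
    simpa only [S, coeff_taylorPowerSeries] using hS m
  constructor
  · have hle := norm_coeff_mul_le hSn (T := 1 + T) (c := 2) (fun m => ?_) n
    · rw [hAT, PowerSeries.coeff_C_mul, norm_mul, norm_ofNat, coeff_taylorPowerSeries] at hle
      linarith
    · rcases m with _ | m
      · rw [map_add, hT0, PowerSeries.coeff_one, if_pos rfl]
        norm_num
      · simpa [PowerSeries.coeff_one] using hT m
  · obtain ⟨R, hR⟩ : PowerSeries.X ∣ 1 - T := PowerSeries.X_dvd_iff.2 (by
      simpa [sub_eq_zero] using hT0.symm)
    have hRn : ∀ m, ‖PowerSeries.coeff m R‖ ≤ 2 := fun m => by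
      rw [← PowerSeries.coeff_succ_X_mul, ← hR]
      simpa [PowerSeries.coeff_one] using hT m
    rcases n with _ | n
    · simp [taylorCoeffZero_zero, hB0]
    · have hle := norm_coeff_mul_le hSn hRn n
      rw [← PowerSeries.coeff_succ_X_mul, mul_left_comm, ← hR, hBT, PowerSeries.coeff_C_mul,
        norm_mul, norm_ofNat, coeff_taylorPowerSeries] at hle
      push_cast
      linarith

end DominatedPair

namespace IsConvexHarmonic
variable {h g : ℂ → ℂ}

lemma exists_norm_taylorCoeffZero_rotatedDeriv_le (hc : IsConvexHarmonic h g) :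
    ∃ u : ℂ, ‖u‖ = 1 ∧
      ∀ n, ‖taylorCoeffZero (rotatedDeriv h g u) n‖ ≤ (n + 1) * ‖rotatedDeriv h g u 0‖ := by
  obtain ⟨u, hu, hdir⟩ := hc.exists_isMonotoneDirection_zero_or_im_eq_zero
  refine ⟨u, hu, ?_⟩
  have hF : DifferentiableOn ℂ (rotatedDeriv h g u) (ball 0 1) :=
    ((hc.differentiableOn_left.deriv isOpen_ball).const_mul _).add
      ((hc.differentiableOn_right.deriv isOpen_ball).const_mul _)
  rcases hdir with ⟨l, hl⟩ | ⟨l, hl, b, hb, him⟩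
  · exact hl.norm_taylorCoeffZero_le hF
  · have hd : DifferentiableOn ℂ (fun z => tangentField l b z * rotatedDeriv h g u z)
        (ball 0 1) := by
      unfold tangentField
      fun_prop
    obtain ⟨k, hk⟩ := (hd.analyticOnNhd isOpen_ball).eq_const_of_im_eq_const him isOpen_ball
      ⟨nonempty_ball.2 one_pos, (convex_ball (0 : ℂ) 1).isPreconnected⟩
    have hnhds := isOpen_ball.mem_nhds (mem_ball_self (x := (0 : ℂ)) one_pos)
    exact norm_taylorCoeffZero_le_of_eventuallyEq_const hl hb (hF.analyticAt hnhds)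
      (eventually_of_mem hnhds hk)

lemma norm_taylorCoeffZero_deriv_le (hc : IsConvexHarmonic h g) (hh : deriv h 0 = 1)
    (hg : deriv g 0 = 0) (n : ℕ) :
    ‖taylorCoeffZero (deriv h) n‖ ≤ (n + 1) * (n + 2) / 2 ∧
      ‖taylorCoeffZero (deriv g) n‖ ≤ n * (n + 1) / 2 := by
  obtain ⟨u, hu, hS⟩ := hc.exists_norm_taylorCoeffZero_rotatedDeriv_le
  have hnorm0 : ‖rotatedDeriv h g u 0‖ = 1 := by simp [rotatedDeriv, hh, hg, hu]
  have hpair := norm_taylorCoeffZero_le_of_norm_taylorCoeffZero_add_le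
    ((hc.differentiableOn_left.deriv isOpen_ball).const_mul (conj u))
    ((hc.differentiableOn_right.deriv isOpen_ball).const_mul u)
    (fun z hz => by simpa [hu] using hc.norm_deriv_lt z hz) (by rw [hg, mul_zero])
    (fun m => (hS m).trans_eq (by rw [hnorm0, mul_one])) n
  simpa only [taylorCoeffZero_const_mul, norm_mul, RCLike.norm_conj, hu, one_mul] using hpair

theorem norm_taylorCoeffZero_le (hc : IsConvexHarmonic h g) (hh : deriv h 0 = 1)
    (hg : deriv g 0 = 0) {n : ℕ} (hn : n ≠ 0) :
    ‖taylorCoeffZero h n‖ ≤ ((n : ℝ) + 1) / 2 ∧ ‖taylorCoeffZero g n‖ ≤ ((n : ℝ) - 1) / 2 := by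
  obtain ⟨m, rfl⟩ := Nat.exists_eq_succ_of_ne_zero hn
  have hm : (0 : ℝ) < m + 1 := by positivity
  have hderiv : ∀ p : ℂ → ℂ,
      ‖taylorCoeffZero (deriv p) m‖ = (m + 1) * ‖taylorCoeffZero p (m + 1)‖ := fun p => by
    rw [taylorCoeffZero_deriv, norm_mul, ← Nat.cast_succ, norm_natCast, Nat.cast_succ]
  have hle := hc.norm_taylorCoeffZero_deriv_le hh hg m
  rw [hderiv, hderiv] at hle
  push_cast
  constructor
  · exact le_of_mul_le_mul_left (hle.1.trans_eq (by ring)) hm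
  · exact le_of_mul_le_mul_left (hle.2.trans_eq (by ring)) hm

end IsConvexHarmonic

/-! ### Entire functions and Hadamard products -/

/-- The power series with coefficients `c` converges on the whole plane. -/
def IsEntireSeries (c : ℕ → ℂ) : Prop :=
  ∀ r : ℝ, 0 ≤ r → Summable fun n => ‖c n‖ * r ^ n

namespace IsEntireSeries
variable {c : ℕ → ℂ}

lemma hasFPowerSeriesOnBall (hc : IsEntireSeries c) :
    HasFPowerSeriesOnBall (fun z => ∑' n, c n * z ^ n)
      (FormalMultilinearSeries.ofScalars ℂ c) 0 ⊤ := by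
  have hradius : (FormalMultilinearSeries.ofScalars ℂ c).radius = ⊤ :=
    FormalMultilinearSeries.radius_eq_top_of_summable_norm _ fun r => by
      simpa only [FormalMultilinearSeries.ofScalars_norm] using hc r r.2
  have hsum := (FormalMultilinearSeries.ofScalars ℂ c).hasFPowerSeriesOnBall
    (by rw [hradius]; exact ENNReal.zero_lt_top)
  rw [hradius] at hsum
  exact hsum.congr fun z _ => FormalMultilinearSeries.ofScalars_sum_eq c z

lemma differentiable_tsum (hc : IsEntireSeries c) :
    Differentiable ℂ fun z => ∑' n, c n * z ^ n := fun z =>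
  (hc.hasFPowerSeriesOnBall.differentiableOn z (by simp)).differentiableAt (by simp)

lemma taylorCoeffZero_tsum (hc : IsEntireSeries c) (n : ℕ) :
    taylorCoeffZero (fun z => ∑' n, c n * z ^ n) n = c n := by
  have hn : (n.factorial : ℂ) ≠ 0 := Nat.cast_ne_zero.2 n.factorial_ne_zero
  rw [taylorCoeffZero, iteratedDeriv_eq_iteratedFDeriv, div_eq_iff hn,
    ← hc.hasFPowerSeriesOnBall.factorial_smul 1 n]
  simp [FormalMultilinearSeries.ofScalars, mul_comm]

lemma mul_of_norm_le (hc : IsEntireSeries c) {d : ℕ → ℂ} {C q : ℝ} (hq : 0 ≤ q)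
    (hd : ∀ n, ‖d n‖ ≤ C * q ^ n) : IsEntireSeries (d * c) := fun r hr => by
  refine Summable.of_nonneg_of_le (fun n => by positivity) (fun n => ?_)
    ((hc (q * r) (by positivity)).mul_left C)
  calc ‖(d * c) n‖ * r ^ n = ‖d n‖ * (‖c n‖ * r ^ n) := by rw [Pi.mul_apply, norm_mul, mul_assoc]
    _ ≤ C * q ^ n * (‖c n‖ * r ^ n) := by gcongr; exact hd n
    _ = C * (‖c n‖ * (q * r) ^ n) := by ring

end IsEntireSeries

section Hadamard
variable {p q : ℂ → ℂ}

lemma hasSum_taylorCoeffZero_mul_pow {r : ℝ} (hp : DifferentiableOn ℂ p (ball 0 r)) {z : ℂ}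
    (hz : z ∈ ball (0 : ℂ) r) : HasSum (fun n => taylorCoeffZero p n * z ^ n) (p z) := by
  simpa only [taylorCoeffZero, smul_eq_mul, sub_zero, div_eq_inv_mul, mul_assoc, mul_comm,
    mul_left_comm] using hasSum_taylorSeries_on_ball hp hz

lemma isEntireSeries_taylorCoeffZero (hp : Differentiable ℂ p) :
    IsEntireSeries (taylorCoeffZero p) := fun r hr => by
  have hsum := (hasSum_taylorCoeffZero_mul_pow (r := r + 1) (z := r) hp.differentiableOn
    (by simp [abs_of_nonneg hr])).summable.norm
  simpa [abs_of_nonneg hr] using hsum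

lemma exists_norm_taylorCoeffZero_le (hp : AnalyticAt ℂ p 0) :
    ∃ C q : ℝ, 0 ≤ q ∧ ∀ n, ‖taylorCoeffZero p n‖ ≤ C * q ^ n := by
  obtain ⟨C, q, -, hq, hle⟩ :=
    FormalMultilinearSeries.le_mul_pow_of_radius_pos _ hp.hasFPowerSeriesAt.radius_pos
  exact ⟨C, q, hq.le, fun n => by simpa [taylorCoeffZero] using hle n⟩

variable (hp : AnalyticAt ℂ p 0) (hq : Differentiable ℂ q)
include hp hq

lemma isEntireSeries_taylorCoeffZero_mul :
    IsEntireSeries (taylorCoeffZero p * taylorCoeffZero q) := by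
  obtain ⟨C, r, hr, hle⟩ := exists_norm_taylorCoeffZero_le hp
  exact (isEntireSeries_taylorCoeffZero hq).mul_of_norm_le hr hle

lemma differentiable_hadamardConv : Differentiable ℂ (hadamardConv p q) :=
  (isEntireSeries_taylorCoeffZero_mul hp hq).differentiable_tsum

lemma taylorCoeffZero_hadamardConv (n : ℕ) :
    taylorCoeffZero (hadamardConv p q) n = taylorCoeffZero p n * taylorCoeffZero q n :=
  (isEntireSeries_taylorCoeffZero_mul hp hq).taylorCoeffZero_tsum n

lemma hadamardConv_zero : hadamardConv p q 0 = p 0 * q 0 := by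
  simpa only [taylorCoeffZero_zero] using taylorCoeffZero_hadamardConv hp hq 0

lemma deriv_hadamardConv_zero : deriv (hadamardConv p q) 0 = deriv p 0 * deriv q 0 := by
  simpa only [taylorCoeffZero_one] using taylorCoeffZero_hadamardConv hp hq 1

end Hadamard

section Derivatives
variable {p : ℂ → ℂ} {r : ℝ}

lemma differentiableOn_iteratedDeriv (hp : DifferentiableOn ℂ p (ball 0 r)) (k : ℕ) :
    DifferentiableOn ℂ (iteratedDeriv k p) (ball 0 r) := by
  induction k with
  | zero => rwa [iteratedDeriv_zero]
  | succ k ih =>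
    rw [iteratedDeriv_succ]
    exact ih.deriv isOpen_ball

lemma taylorCoeffZero_iteratedDeriv (p : ℂ → ℂ) (k n : ℕ) :
    taylorCoeffZero (iteratedDeriv k p) n =
      ((n + k).descFactorial k : ℂ) * taylorCoeffZero p (n + k) := by
  induction k generalizing n with
  | zero => simp
  | succ k ih =>
    rw [iteratedDeriv_succ, taylorCoeffZero_deriv, ih, ← mul_assoc, ← add_assoc,
      Nat.descFactorial_succ, add_right_comm n k 1, Nat.add_sub_cancel, Nat.cast_mul,
      Nat.cast_succ]

lemma hasSum_descFactorial_mul_taylorCoeffZero (hp : DifferentiableOn ℂ p (ball 0 r)) (k : ℕ)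
    {z : ℂ} (hz : z ∈ ball (0 : ℂ) r) :
    HasSum (fun n : ℕ => (n.descFactorial k : ℂ) * taylorCoeffZero p n * z ^ n)
      (z ^ k * iteratedDeriv k p z) := by
  have hsum := (hasSum_taylorCoeffZero_mul_pow (differentiableOn_iteratedDeriv hp k) hz).mul_left
    (z ^ k)
  have hlow : ∑ i ∈ Finset.range k, (i.descFactorial k : ℂ) * taylorCoeffZero p i * z ^ i = 0 :=
    Finset.sum_eq_zero fun i hi => by
      rw [Nat.descFactorial_eq_zero_iff_lt.2 (Finset.mem_range.1 hi), Nat.cast_zero, zero_mul,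
        zero_mul]
  rw [← hasSum_nat_add_iff' k, hlow, sub_zero]
  simpa only [taylorCoeffZero_iteratedDeriv, pow_add, mul_comm, mul_left_comm,
    mul_assoc] using hsum

/-- The operator `z d/dz`, which multiplies the `n`-th Taylor coefficient by `n` and describes
differentiation along the circles around the origin. -/
noncomputable def eulerDeriv (p : ℂ → ℂ) (z : ℂ) : ℂ :=
  z * deriv p z

lemma differentiableOn_eulerDeriv (hp : DifferentiableOn ℂ p (ball 0 r)) :
    DifferentiableOn ℂ (eulerDeriv p) (ball 0 r) :=
  differentiableOn_id.mul (hp.deriv isOpen_ball)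

lemma taylorCoeffZero_eulerDeriv (hp : AnalyticAt ℂ p 0) (n : ℕ) :
    taylorCoeffZero (eulerDeriv p) n = n * taylorCoeffZero p n := by
  rcases n with _ | n
  · simp [taylorCoeffZero_zero, eulerDeriv]
  · have hseries : taylorPowerSeries (eulerDeriv p) =
        PowerSeries.X * taylorPowerSeries (deriv p) := by
      rw [← taylorPowerSeries_id]
      exact taylorPowerSeries_mul analyticAt_id hp.deriv
    rw [← coeff_taylorPowerSeries, hseries, PowerSeries.coeff_succ_X_mul, coeff_taylorPowerSeries,
      taylorCoeffZero_deriv, Nat.cast_succ]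

end Derivatives

/-! ### Harmonic convexity of order `a` -/

section Argument
variable {T T' : ℝ → ℂ} (hT : ∀ θ, HasDerivAt T (T' θ) θ) (hT' : Continuous T')
  (hne : ∀ θ, T θ ≠ 0)
include hT hT' hne

lemma exists_hasDerivAt_exp_eq :
    ∃ Φ : ℝ → ℂ, (∀ θ, HasDerivAt Φ (T' θ / T θ) θ) ∧ ∀ θ, T θ = exp (Φ θ) := by
  have hcont : Continuous fun θ => T' θ / T θ :=
    hT'.div (continuous_iff_continuousAt.2 fun θ => (hT θ).continuousAt) hne
  set Φ : ℝ → ℂ := fun θ => log (T 0) + ∫ t in (0 : ℝ)..θ, T' t / T t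
  have hΦ : ∀ θ, HasDerivAt Φ (T' θ / T θ) θ := fun θ =>
    (hcont.integral_hasStrictDerivAt 0 θ).hasDerivAt.const_add _
  have hΦ0 : exp (Φ 0) = T 0 := by
    simp only [Φ, intervalIntegral.integral_same, add_zero, exp_log (hne 0)]
  have hderiv : ∀ θ, HasDerivAt (fun θ => T θ * exp (-Φ θ)) 0 θ := fun θ => by
    refine ((hT θ).mul (hΦ θ).neg.cexp).congr_deriv ?_
    have := hne θ
    simp only [Pi.neg_apply]
    field_simp
    ring
  refine ⟨Φ, hΦ, fun θ => ?_⟩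
  have hconst := is_const_of_deriv_eq_zero (fun t => (hderiv t).differentiableAt)
    (fun t => (hderiv t).deriv) θ 0
  rwa [exp_neg, exp_neg, hΦ0, mul_inv_cancel₀ (hne 0),
    mul_inv_eq_one₀ (exp_ne_zero _)] at hconst

lemma exists_differentiable_argument :
    ∃ φ : ℝ → ℝ, Differentiable ℝ φ ∧ (∀ θ, T θ = ‖T θ‖ * exp (φ θ * I)) ∧
      ∀ θ, deriv φ θ = (T' θ / T θ).im := by
  obtain ⟨Φ, hΦ, hexp⟩ := exists_hasDerivAt_exp_eq hT hT' hne
  have him : ∀ θ, HasDerivAt (fun θ => (Φ θ).im) (T' θ / T θ).im θ := fun θ =>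
    imCLM.hasFDerivAt.comp_hasDerivAt θ (hΦ θ)
  refine ⟨_, fun θ => (him θ).differentiableAt, fun θ => ?_, fun θ => (him θ).deriv⟩
  rw [hexp, norm_exp, ofReal_exp, ← exp_add, re_add_im]

end Argument

/-- The condition says that `Y / X` avoids the closed half-plane `Re ≤ a`, on which the Möbius
transformation `w ↦ (w - 1) / (w + 1 - 2 * a)` has modulus at least one. -/
lemma lt_re_div_of_norm_sub_lt {a : ℝ} (ha : a < 1) {X Y : ℂ}
    (h : ‖Y - X‖ < ‖Y + ((1 - 2 * a : ℝ) : ℂ) * X‖) : X ≠ 0 ∧ a < (Y / X).re := by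
  have hX : X ≠ 0 := by
    rintro rfl
    simp at h
  refine ⟨hX, ?_⟩
  have hlt : ‖Y / X - 1‖ < ‖Y / X + ((1 - 2 * a : ℝ) : ℂ)‖ := by
    rw [div_sub_one hX, div_add' _ _ _ hX, norm_div, norm_div]
    exact div_lt_div_of_pos_right h (norm_pos_iff.2 hX)
  have hsq := mul_self_lt_mul_self (norm_nonneg _) hlt
  rw [norm_mul_self_eq_normSq, norm_mul_self_eq_normSq, normSq_apply, normSq_apply] at hsq
  simp only [sub_re, sub_im, add_re, add_im, one_re, one_im, ofReal_re, ofReal_im] at hsq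
  nlinarith

lemma hasDerivAt_comp_circle {p : ℂ → ℂ} {r : ℝ} (hp : DifferentiableOn ℂ p (ball 0 1))
    (hr : r ∈ Ioo (0 : ℝ) 1) (θ : ℝ) : HasDerivAt (fun t : ℝ => p (r * exp (t * I)))
      (I * eulerDeriv p (r * exp (θ * I))) θ := by
  have hcircle : HasDerivAt (fun w : ℂ => (r : ℂ) * exp (w * I)) (r * (exp (θ * I) * I)) θ := by
    simpa using (((hasDerivAt_id (θ : ℂ)).mul_const I).cexp).const_mul (r : ℂ)
  have hpd := (hp.differentiableAt (isOpen_ball.mem_nhds (ofReal_mul_exp_mem_ball hr θ))).hasDerivAt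
  refine (hpd.comp (θ : ℂ) hcircle).comp_ofReal.congr_deriv ?_
  rw [eulerDeriv]
  ring

lemma hasSum_mul_taylorCoeffZero_mul_pow {p : ℂ → ℂ} {r : ℝ} (hp : DifferentiableOn ℂ p (ball 0 r))
    {z : ℂ} (hz : z ∈ ball (0 : ℂ) r) :
    HasSum (fun n : ℕ => n * taylorCoeffZero p n * z ^ n) (eulerDeriv p z) := by
  simpa only [Nat.descFactorial_one, pow_one, iteratedDeriv_one, eulerDeriv] using
    hasSum_descFactorial_mul_taylorCoeffZero hp 1 hz

section CircleTangent
variable {f h g : ℂ → ℂ} (hd : IsHarmonicDecomposition f h g) {r : ℝ} (hr : r ∈ Ioo (0 : ℝ) 1)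
include hd hr

lemma circleTangent_eq (θ : ℝ) :
    circleTangent f r θ = I * (eulerDeriv h (r * exp (θ * I)) -
      conj (eulerDeriv g (r * exp (θ * I)))) := by
  have hf : (fun t : ℝ => f (r * exp (t * I))) = fun t : ℝ =>
      h (r * exp (t * I)) + conj (g (r * exp (t * I))) := funext fun t =>
    hd.eq_on_disc _ (ofReal_mul_exp_mem_ball hr t)
  rw [circleTangent, hf]
  refine ((hasDerivAt_comp_circle hd.analytic_h hr θ).add
    (hasDerivAt_comp_circle hd.analytic_g hr θ).star).deriv.trans ?_
  simp only [star_def, map_mul, conj_I]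
  ring

lemma hasDerivAt_circleTangent (θ : ℝ) :
    HasDerivAt (circleTangent f r) (-(eulerDeriv (eulerDeriv h) (r * exp (θ * I)) +
      conj (eulerDeriv (eulerDeriv g) (r * exp (θ * I))))) θ := by
  rw [funext (circleTangent_eq hd hr)]
  refine (((hasDerivAt_comp_circle (differentiableOn_eulerDeriv hd.analytic_h) hr θ).sub
    (hasDerivAt_comp_circle (differentiableOn_eulerDeriv hd.analytic_g) hr θ).star).const_mul
      I).congr_deriv ?_
  simp only [star_def, map_mul, conj_I]
  linear_combination (eulerDeriv (eulerDeriv h) (r * exp (θ * I)) +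
      conj (eulerDeriv (eulerDeriv g) (r * exp (θ * I)))) * I_mul_I

end CircleTangent

section CoefficientCriterion
variable {h g : ℂ → ℂ}

lemma hasSum_eulerDeriv_eulerDeriv_add (hh : DifferentiableOn ℂ h (ball 0 1))
    (hg : DifferentiableOn ℂ g (ball 0 1)) (t : ℝ) {z : ℂ} (hz : z ∈ ball (0 : ℂ) 1) :
    HasSum (fun n : ℕ => ((n * (n + t) : ℝ) : ℂ) * taylorCoeffZero h n * z ^ n +
        conj (((n * (n - t) : ℝ) : ℂ) * taylorCoeffZero g n * z ^ n))
      (eulerDeriv (eulerDeriv h) z + conj (eulerDeriv (eulerDeriv g) z) +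
        t * (eulerDeriv h z - conj (eulerDeriv g z))) := by
  have hcoeff₂ : ∀ {p : ℂ → ℂ}, DifferentiableOn ℂ p (ball 0 1) →
      HasSum (fun n : ℕ => n * (n * taylorCoeffZero p n) * z ^ n)
        (eulerDeriv (eulerDeriv p) z) := fun {p} hp => by
    simpa only [taylorCoeffZero_eulerDeriv
      (hp.analyticAt (isOpen_ball.mem_nhds (mem_ball_self one_pos)))] using
      hasSum_mul_taylorCoeffZero_mul_pow (differentiableOn_eulerDeriv hp) hz
  have hsum := ((hcoeff₂ hh).add (hasSum_conj'.2 (hcoeff₂ hg))).add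
    (((hasSum_mul_taylorCoeffZero_mul_pow hh hz).sub
      (hasSum_conj'.2 (hasSum_mul_taylorCoeffZero_mul_pow hg hz))).mul_left (t : ℂ))
  refine hsum.congr_fun fun n => ?_
  simp only [map_mul, map_sub, conj_ofReal, map_natCast, map_pow, ofReal_mul, ofReal_add,
    ofReal_sub, ofReal_natCast]
  ring

lemma norm_mul_pow_add_conj_le {x y R : ℝ} (hx : 0 ≤ x) (hy : 0 ≤ y) {c d w : ℂ} (hw : ‖w‖ ≤ R) :
    ‖(x : ℂ) * c * w + conj ((y : ℂ) * d * w)‖ ≤ R * (x * ‖c‖ + y * ‖d‖) := by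
  refine (norm_add_le _ _).trans ?_
  rw [RCLike.norm_conj, norm_mul, norm_mul, norm_mul, norm_mul, norm_real, norm_real,
    Real.norm_of_nonneg hx, Real.norm_of_nonneg hy, ← add_mul, mul_comm]
  exact mul_le_mul_of_nonneg_right hw (by positivity)

lemma summable_mul_add_mul_norm {c : ℕ → ℂ} (hc : Summable fun n : ℕ => (n : ℝ) ^ 2 * ‖c n‖)
    (t : ℝ) : Summable fun n : ℕ => n * (n + t) * ‖c n‖ := by
  have hlin : Summable fun n : ℕ => n * ‖c n‖ :=
    hc.of_nonneg_of_le (fun n => by positivity) fun n => by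
      gcongr
      exact_mod_cast Nat.le_self_pow two_ne_zero n
  exact (hc.add (hlin.mul_left t)).congr fun n => by ring

variable {f : ℂ → ℂ} (hd : IsHarmonicDecomposition f h g) (hg : deriv g 0 = 0)
include hd hg

lemma norm_eulerDeriv_eulerDeriv_add_sub_le {t M : ℝ} (ht : |t| ≤ 2)
    (hM : HasSum (fun n : ℕ => n * (n + t) * ‖taylorCoeffZero h n‖ +
      n * (n - t) * ‖taylorCoeffZero g n‖) M) {z : ℂ} (hz : z ∈ ball (0 : ℂ) 1) :
    ‖eulerDeriv (eulerDeriv h) z + conj (eulerDeriv (eulerDeriv g) z) +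
        t * (eulerDeriv h z - conj (eulerDeriv g z)) - (1 + t) * z‖ ≤ ‖z‖ ^ 2 * (M - (1 + t)) := by
  obtain ⟨ht₁, ht₂⟩ := abs_le.1 ht
  have hsum := (hasSum_nat_add_iff' 2).2
    (hasSum_eulerDeriv_eulerDeriv_add hd.analytic_h hd.analytic_g t hz)
  have hM' := (hasSum_nat_add_iff' 2).2 hM
  simp only [Finset.sum_range_succ, Finset.sum_range_zero, taylorCoeffZero_zero,
    taylorCoeffZero_one, hd.h_zero, hd.deriv_h_zero, hd.g_zero, hg, Nat.cast_zero, Nat.cast_one,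
    mul_zero, zero_mul, map_zero, norm_zero, norm_one, add_zero, zero_add, one_mul, mul_one,
    pow_one, ofReal_add, ofReal_one] at hsum hM'
  refine hsum.norm_le_of_bounded (hM'.mul_left (‖z‖ ^ 2)) fun n => ?_
  have hn : (2 : ℝ) ≤ (n + 2 : ℕ) := by exact_mod_cast Nat.le_add_left 2 n
  refine norm_mul_pow_add_conj_le (mul_nonneg (by linarith) (by linarith))
    (mul_nonneg (by linarith) (by linarith)) ?_
  rw [norm_pow]
  exact pow_le_pow_of_le_one (norm_nonneg z) (mem_ball_zero_iff.1 hz).le (Nat.le_add_left 2 n)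

variable {a : ℝ} (ha : -(1 / 2) ≤ a) (ha1 : a < 1)
  (hh_sum : Summable fun n : ℕ => (n : ℝ) ^ 2 * ‖taylorCoeffZero h n‖)
  (hg_sum : Summable fun n : ℕ => (n : ℝ) ^ 2 * ‖taylorCoeffZero g n‖)
  (hle : ∑' n : ℕ, (n * (n - a) * ‖taylorCoeffZero h n‖ + n * (n + a) * ‖taylorCoeffZero g n‖) ≤
    2 * (1 - a))
include ha ha1 hh_sum hg_sum hle

lemma lt_re_eulerDeriv_eulerDeriv_div {z : ℂ} (hz : z ∈ ball (0 : ℂ) 1) (hz0 : z ≠ 0) :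
    eulerDeriv h z - conj (eulerDeriv g z) ≠ 0 ∧
      a < ((eulerDeriv (eulerDeriv h) z + conj (eulerDeriv (eulerDeriv g) z)) /
        (eulerDeriv h z - conj (eulerDeriv g z))).re := by
  have hsummable : ∀ t : ℝ, Summable fun n : ℕ =>
      n * (n + t) * ‖taylorCoeffZero h n‖ + n * (n - t) * ‖taylorCoeffZero g n‖ := fun t =>
    (summable_mul_add_mul_norm hh_sum t).add (by
      simpa only [sub_eq_add_neg] using summable_mul_add_mul_norm hg_sum (-t))
  have hsub := norm_eulerDeriv_eulerDeriv_add_sub_le hd hg (t := -1) (by norm_num)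
    (hsummable (-1)).hasSum hz
  have hadd := norm_eulerDeriv_eulerDeriv_add_sub_le hd hg (t := 1 - 2 * a)
    (abs_le.2 ⟨by linarith, by linarith⟩) (hsummable _).hasSum hz
  have hsum : ∑' n : ℕ, (n * (n + -1) * ‖taylorCoeffZero h n‖ +
        n * (n - -1) * ‖taylorCoeffZero g n‖) +
      ∑' n : ℕ, (n * (n + (1 - 2 * a)) * ‖taylorCoeffZero h n‖ +
        n * (n - (1 - 2 * a)) * ‖taylorCoeffZero g n‖) ≤ 2 * (2 * (1 - a)) := by
    rw [← (hsummable _).tsum_add (hsummable _)]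
    refine le_trans (le_of_eq ?_) (mul_le_mul_of_nonneg_left hle zero_le_two)
    rw [← tsum_mul_left]
    exact tsum_congr fun n => by ring
  set X := eulerDeriv h z - conj (eulerDeriv g z)
  set Y := eulerDeriv (eulerDeriv h) z + conj (eulerDeriv (eulerDeriv g) z)
  have hlin : ‖((1 + (1 - 2 * a : ℝ)) * z : ℂ)‖ = 2 * (1 - a) * ‖z‖ := by
    rw [norm_mul, ← ofReal_one, ← ofReal_add, norm_real, Real.norm_of_nonneg (by linarith)]
    ring
  have hrev := norm_sub_norm_le ((1 + (1 - 2 * a : ℝ)) * z : ℂ) (Y + (1 - 2 * a : ℝ) * X)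
  rw [norm_sub_rev, hlin] at hrev
  rw [ofReal_neg, ofReal_one, neg_one_mul, add_neg_cancel, zero_mul, sub_zero, ← sub_eq_add_neg,
    add_neg_cancel, sub_zero] at hsub
  have hz1 : ‖z‖ < 1 := mem_ball_zero_iff.1 hz
  refine lt_re_div_of_norm_sub_lt ha1 ?_
  nlinarith [norm_pos_iff.2 hz0, mul_le_mul_of_nonneg_left hsum (sq_nonneg ‖z‖),
    mul_pos (mul_pos (sub_pos.2 ha1) (norm_pos_iff.2 hz0)) (sub_pos.2 hz1)]

theorem mem_classHK_of_tsum_le : f ∈ ClassHK a := by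
  refine ⟨⟨h, g, hd⟩, fun r hr0 hr1 => ?_⟩
  have hr : r ∈ Ioo (0 : ℝ) 1 := ⟨hr0, hr1⟩
  have hquot := fun θ : ℝ => lt_re_eulerDeriv_eulerDeriv_div hd hg ha ha1 hh_sum hg_sum hle
    (ofReal_mul_exp_mem_ball hr θ) (mul_ne_zero (ofReal_ne_zero.2 hr0.ne') (exp_ne_zero _))
  have hne : ∀ θ, circleTangent f r θ ≠ 0 := fun θ => by
    rw [circleTangent_eq hd hr]
    exact mul_ne_zero I_ne_zero (hquot θ).1
  have hcont : ∀ {p : ℂ → ℂ}, DifferentiableOn ℂ p (ball 0 1) →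
      Continuous fun θ : ℝ => p (r * exp (θ * I)) := fun hp =>
    continuous_iff_continuousAt.2 fun θ => (hasDerivAt_comp_circle hp hr θ).continuousAt
  obtain ⟨φ, hφ, hexp, hderiv⟩ := exists_differentiable_argument (hasDerivAt_circleTangent hd hr)
    ((hcont (differentiableOn_eulerDeriv (differentiableOn_eulerDeriv hd.analytic_h))).add
      (hcont (differentiableOn_eulerDeriv
        (differentiableOn_eulerDeriv hd.analytic_g))).star).neg hne
  refine ⟨hne, φ, hφ, hexp, fun θ => ?_⟩
  rw [hderiv, circleTangent_eq hd hr, ← neg_one_mul, ← I_mul_I, mul_assoc,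
    mul_div_mul_left _ _ I_ne_zero, mul_div_assoc, I_mul_im]
  exact (hquot θ).2

end CoefficientCriterion

/-! ### The Wright function -/

lemma rpow_mul_exp_le_Gamma_of_one_le {x S : ℝ} (hx : 1 ≤ x) (hS : 0 < S) :
    S ^ (x - 1) * Real.exp (-(S + 1)) ≤ Real.Gamma x := by
  have hint := Real.GammaIntegral_convergent (one_pos.trans_le hx)
  have hsub : Icc S (S + 1) ⊆ Ioi (0 : ℝ) := fun t ht => hS.trans_le ht.1
  calc S ^ (x - 1) * Real.exp (-(S + 1))
      = ∫ _ in Icc S (S + 1), S ^ (x - 1) * Real.exp (-(S + 1)) := by simp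
    _ ≤ ∫ t in Icc S (S + 1), Real.exp (-t) * t ^ (x - 1) := by
        refine MeasureTheory.setIntegral_mono_on (MeasureTheory.integrableOn_const (by simp))
          (hint.mono_set hsub) measurableSet_Icc fun t ht => ?_
        rw [mul_comm]
        exact mul_le_mul (Real.exp_le_exp.2 (neg_le_neg ht.2))
          (Real.rpow_le_rpow hS.le ht.1 (sub_nonneg.2 hx)) (by positivity) (by positivity)
    _ ≤ ∫ t in Ioi 0, Real.exp (-t) * t ^ (x - 1) := by
        refine MeasureTheory.setIntegral_mono_set hint ?_ hsub.eventuallyLE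
        filter_upwards [MeasureTheory.self_mem_ae_restrict measurableSet_Ioi] with t ht
        exact mul_nonneg (Real.exp_nonneg _) (Real.rpow_nonneg (le_of_lt ht) _)
    _ = Real.Gamma x := (Real.Gamma_eq_integral (one_pos.trans_le hx)).symm

lemma rpow_mul_exp_le_Gamma {x S : ℝ} (hx : 0 < x) (hS : 1 ≤ S) :
    S ^ (x - 1) * Real.exp (-(S + 1)) ≤ Real.Gamma x := by
  have hS0 := one_pos.trans_le hS
  rcases le_or_gt 1 x with hx1 | hx1
  · exact rpow_mul_exp_le_Gamma_of_one_le hx1 hS0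
  · calc S ^ (x - 1) * Real.exp (-(S + 1)) ≤ S ^ (x + 1 - 1) * Real.exp (-(S + 1)) := by
          gcongr
          linarith
      _ ≤ Real.Gamma (x + 1) := rpow_mul_exp_le_Gamma_of_one_le (by linarith) hS0
      _ = x * Real.Gamma x := Real.Gamma_add_one hx.ne'
      _ ≤ Real.Gamma x := mul_le_of_le_one_left (Real.Gamma_pos_of_pos hx).le hx1.le

/-- The Taylor coefficients of the normalized Wright function, whose factor `z` shifts those of
`wright` by one. -/
noncomputable def wrightCoeff (α β γ δ : ℝ) : ℕ → ℝ
  | 0 => 0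
  | n + 1 => Real.Gamma α * Real.Gamma γ / (Real.Gamma (α + n * β) * Real.Gamma (γ + n * δ))

section Wright
variable {α β γ δ : ℝ} (hα : 0 < α) (hγ : 0 < γ)
include hα hγ

lemma wrightCoeff_one : wrightCoeff α β γ δ 1 = 1 := by
  simp [wrightCoeff, (Real.Gamma_pos_of_pos hα).ne', (Real.Gamma_pos_of_pos hγ).ne']

variable (hβ : 0 ≤ β) (hδ : 0 ≤ δ)
include hβ hδ

lemma wrightCoeff_nonneg (n : ℕ) : 0 ≤ wrightCoeff α β γ δ n := by
  rcases n with _ | n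
  · exact le_rfl
  · have hΓ : ∀ x y : ℝ, 0 < x → 0 ≤ y → 0 < Real.Gamma (x + n * y) := fun x y hx hy =>
      Real.Gamma_pos_of_pos (by positivity)
    exact div_nonneg
      (mul_pos (Real.Gamma_pos_of_pos hα) (Real.Gamma_pos_of_pos hγ)).le
      (mul_pos (hΓ α β hα hβ) (hΓ γ δ hγ hδ)).le

lemma mul_rpow_pow_le_Gamma_mul_Gamma {S : ℝ} (hS : 1 ≤ S) (n : ℕ) :
    S ^ (α - 1) * S ^ (γ - 1) * Real.exp (-(S + 1)) ^ 2 * (S ^ (β + δ)) ^ n ≤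
      Real.Gamma (α + n * β) * Real.Gamma (γ + n * δ) := by
  have hS0 := one_pos.trans_le hS
  have hsplit : ∀ x y : ℝ, S ^ (x + n * y - 1) = S ^ (x - 1) * (S ^ y) ^ n := fun x y => by
    rw [← Real.rpow_mul_natCast hS0.le, ← Real.rpow_add hS0]
    ring_nf
  have hα' := rpow_mul_exp_le_Gamma (x := α + n * β) (by positivity) hS
  have hγ' := rpow_mul_exp_le_Gamma (x := γ + n * δ) (by positivity) hS
  rw [hsplit] at hα' hγ'
  refine le_trans (le_of_eq ?_)
    (mul_le_mul hα' hγ' (by positivity) (Real.Gamma_pos_of_pos (by positivity)).le)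
  rw [Real.rpow_add hS0]
  ring

variable (hβδ : 0 < β + δ)
include hβδ

lemma isEntireSeries_wrightCoeff : IsEntireSeries fun n => (wrightCoeff α β γ δ n : ℂ) := by
  intro r hr
  obtain ⟨S, hSr, hS⟩ := (((tendsto_rpow_atTop hβδ).eventually_ge_atTop (2 * r)).and
    (eventually_ge_atTop 1)).exists
  have hS0 : 0 < S := one_pos.trans_le hS
  have hSp : 0 < S ^ (β + δ) := Real.rpow_pos_of_pos hS0 _
  set K : ℝ := S ^ (α - 1) * S ^ (γ - 1) * Real.exp (-(S + 1)) ^ 2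
  have hK0 : 0 < K := by positivity
  have := Real.Gamma_pos_of_pos hα
  have := Real.Gamma_pos_of_pos hγ
  rw [← summable_nat_add_iff 1]
  refine Summable.of_nonneg_of_le (fun n => by positivity) (fun n => ?_)
    (summable_geometric_two.mul_left (Real.Gamma α * Real.Gamma γ * r / K))
  rw [norm_real, Real.norm_of_nonneg (wrightCoeff_nonneg hα hγ hβ hδ _), wrightCoeff]
  calc Real.Gamma α * Real.Gamma γ / (Real.Gamma (α + n * β) * Real.Gamma (γ + n * δ)) * r ^ (n + 1)
      ≤ Real.Gamma α * Real.Gamma γ / (K * (S ^ (β + δ)) ^ n) * r ^ (n + 1) := by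
        gcongr _ / ?_ * _
        exact mul_rpow_pow_le_Gamma_mul_Gamma hα hγ hβ hδ hS n
    _ = Real.Gamma α * Real.Gamma γ * r / K * (r / S ^ (β + δ)) ^ n := by
        rw [div_pow, pow_succ]
        field_simp
    _ ≤ Real.Gamma α * Real.Gamma γ * r / K * (1 / 2) ^ n := by
        gcongr _ * ?_ ^ n
        rw [div_le_div_iff₀ hSp two_pos]
        linarith

lemma wrightNormalized_eq_tsum :
    wrightNormalized α β γ δ = fun z => ∑' n, (wrightCoeff α β γ δ n : ℂ) * z ^ n := by
  ext z
  have hsum : Summable fun n => (wrightCoeff α β γ δ n : ℂ) * z ^ n := .of_norm (by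
    simpa only [norm_mul, norm_pow] using
      isEntireSeries_wrightCoeff hα hγ hβ hδ hβδ ‖z‖ (norm_nonneg z))
  rw [hsum.tsum_eq_zero_add, wrightNormalized, wright, ← tsum_mul_left]
  simp only [wrightCoeff, ofReal_zero, zero_mul, zero_add]
  refine tsum_congr fun n => ?_
  push_cast
  ring

lemma differentiable_wrightNormalized : Differentiable ℂ (wrightNormalized α β γ δ) := by
  rw [wrightNormalized_eq_tsum hα hγ hβ hδ hβδ]
  exact (isEntireSeries_wrightCoeff hα hγ hβ hδ hβδ).differentiable_tsum

lemma taylorCoeffZero_wrightNormalized (n : ℕ) :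
    taylorCoeffZero (wrightNormalized α β γ δ) n = wrightCoeff α β γ δ n := by
  rw [wrightNormalized_eq_tsum hα hγ hβ hδ hβδ]
  exact (isEntireSeries_wrightCoeff hα hγ hβ hδ hβδ).taylorCoeffZero_tsum n

lemma taylorCoeffZero_wrightNormalized_nonneg (n : ℕ) :
    0 ≤ taylorCoeffZero (wrightNormalized α β γ δ) n := by
  rw [taylorCoeffZero_wrightNormalized hα hγ hβ hδ hβδ, zero_le_real]
  exact wrightCoeff_nonneg hα hγ hβ hδ n

lemma deriv_wrightNormalized_zero : deriv (wrightNormalized α β γ δ) 0 = 1 := by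
  rw [← taylorCoeffZero_one, taylorCoeffZero_wrightNormalized hα hγ hβ hδ hβδ,
    wrightCoeff_one hα hγ, ofReal_one]

end Wright

/-! ### Convolution with nonnegative entire series -/

namespace IsHarmonicDecomposition
variable {f h g : ℂ → ℂ}

lemma eqOn {h' g' : ℂ → ℂ} (hd : IsHarmonicDecomposition f h g)
    (hd' : IsHarmonicDecomposition f h' g') : EqOn h h' (ball 0 1) ∧ EqOn g g' (ball 0 1) := by
  have h0 : (0 : ℂ) ∈ ball (0 : ℂ) 1 := mem_ball_self one_pos
  have hconn : IsConnected (ball (0 : ℂ) 1) := ⟨⟨0, h0⟩, (convex_ball (0 : ℂ) 1).isPreconnected⟩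
  set u : ℂ → ℂ := h - h' with hu
  set v : ℂ → ℂ := g' - g with hv
  have huv : ∀ z ∈ ball (0 : ℂ) 1, u z = conj (v z) := fun z hz => by
    rw [hu, hv, Pi.sub_apply, Pi.sub_apply, map_sub, sub_eq_sub_iff_add_eq_add,
      ← hd.eq_on_disc z hz, hd'.eq_on_disc z hz, add_comm]
  have hu_diff : DifferentiableOn ℂ u (ball 0 1) := hd.analytic_h.sub hd'.analytic_h
  have hv_diff : DifferentiableOn ℂ v (ball 0 1) := hd'.analytic_g.sub hd.analytic_g
  have hu0 : u 0 = 0 := by rw [hu, Pi.sub_apply, hd.h_zero, hd'.h_zero, sub_zero]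
  have hv0 : v 0 = 0 := by rw [hv, Pi.sub_apply, hd.g_zero, hd'.g_zero, sub_zero]
  obtain ⟨c, hc⟩ := ((hu_diff.add hv_diff).analyticOnNhd isOpen_ball).eq_const_of_im_eq_const
    (c₀ := 0) (fun z hz => by
      rw [Pi.add_apply, huv z hz, add_im, conj_im, neg_add_cancel]) isOpen_ball hconn
  obtain ⟨d, hd⟩ := ((hu_diff.sub hv_diff).analyticOnNhd isOpen_ball).eq_const_of_re_eq_const
    (c₀ := 0) (fun z hz => by
      rw [Pi.sub_apply, huv z hz, sub_re, conj_re, sub_self]) isOpen_ball hconn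
  have hadd : ∀ z ∈ ball (0 : ℂ) 1, u z + v z = 0 := fun z hz => by
    rw [← Pi.add_apply, hc z hz, ← hc 0 h0, Pi.add_apply, hu0, hv0, add_zero]
  have hsub : ∀ z ∈ ball (0 : ℂ) 1, u z - v z = 0 := fun z hz => by
    rw [← Pi.sub_apply, hd z hz, ← hd 0 h0, Pi.sub_apply, hu0, hv0, sub_zero]
  refine ⟨fun z hz => sub_eq_zero.1 ?_, fun z hz => (sub_eq_zero.1 ?_).symm⟩
  · change u z = 0
    linear_combination (hadd z hz + hsub z hz) / 2
  · change v z = 0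
    linear_combination (hadd z hz - hsub z hz) / 2

lemma isConvexHarmonic (hd : IsHarmonicDecomposition f h g) (hf : f ∈ ClassKHo) :
    IsConvexHarmonic h g ∧ deriv g 0 = 0 := by
  obtain ⟨⟨hinj, h', g', hd', hlt, hg'⟩, hconv⟩ := hf
  obtain ⟨hh, hg⟩ := hd.eqOn hd'
  have hfe : EqOn f (fun z => h z + conj (g z)) (ball 0 1) := hd.eq_on_disc
  refine ⟨⟨hd.analytic_h, hd.analytic_g, fun z hz => ?_, hinj.congr hfe, hfe.image_eq ▸ hconv⟩, ?_⟩
  · rw [hh.deriv isOpen_ball hz, hg.deriv isOpen_ball hz]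
    exact hlt z hz
  · rw [hg.deriv isOpen_ball (mem_ball_self one_pos), hg']

lemma convOperator {W₁ W₂ : ℂ → ℂ} {σ : ℂ} (hd : IsHarmonicDecomposition f h g)
    (hg : deriv g 0 = 0) (hW₁ : Differentiable ℂ W₁) (hW₂ : Differentiable ℂ W₂)
    (hW₁' : deriv W₁ 0 = 1) :
    IsHarmonicDecomposition (convOperator W₁ W₂ σ h g) (hadamardConv h W₁)
      (fun z => σ * hadamardConv g W₂ z) := by
  have h0 := isOpen_ball.mem_nhds (mem_ball_self (x := (0 : ℂ)) one_pos)
  have hh_an := hd.analytic_h.analyticAt h0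
  have hg_an := hd.analytic_g.analyticAt h0
  have hdiff := differentiable_hadamardConv hg_an hW₂
  refine ⟨(differentiable_hadamardConv hh_an hW₁).differentiableOn,
    (hdiff.const_mul σ).differentiableOn, ?_, ?_, ?_, ?_, fun z _ => rfl⟩
  · rw [hadamardConv_zero hh_an hW₁, hd.h_zero, zero_mul]
  · rw [deriv_hadamardConv_zero hh_an hW₁, hd.deriv_h_zero, hW₁', one_mul]
  · rw [hadamardConv_zero hg_an hW₂, hd.g_zero, zero_mul, mul_zero]
  · rw [deriv_const_mul _ (hdiff 0), deriv_hadamardConv_zero hg_an hW₂, hg, zero_mul, mul_zero,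
      norm_zero]
    exact one_pos

end IsHarmonicDecomposition

lemma summable_sq_mul_norm_taylorCoeffZero {p : ℂ → ℂ} (hp : Differentiable ℂ p) :
    Summable fun n : ℕ => (n : ℝ) ^ 2 * ‖taylorCoeffZero p n‖ := by
  have hsum := (hasSum_mul_taylorCoeffZero_mul_pow
    (differentiableOn_eulerDeriv (r := 2) hp.differentiableOn) (z := 1) (by simp)).summable.norm
  simpa only [taylorCoeffZero_eulerDeriv (hp.analyticAt 0), one_pow, mul_one, ← mul_assoc, ← sq,
    norm_mul, norm_pow, norm_natCast] using hsum

lemma natCast_descFactorial_three (n : ℕ) :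
    (n.descFactorial 3 : ℝ) = n * (n - 1) * (n - 2) := by
  rw [← descPochhammer_eval_eq_descFactorial, descPochhammer_succ_eval, descPochhammer_succ_eval,
    descPochhammer_one, Polynomial.eval_X, Nat.cast_one, Nat.cast_ofNat]

section NonnegativeCoefficients
variable {W : ℂ → ℂ} (hW : Differentiable ℂ W) (hW_nonneg : ∀ n, 0 ≤ taylorCoeffZero W n)
include hW hW_nonneg

lemma hasSum_descFactorial_mul_norm_taylorCoeffZero (k : ℕ) :
    HasSum (fun n : ℕ => n.descFactorial k * ‖taylorCoeffZero W n‖) (iteratedDeriv k W 1).re := by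
  have hsum := hasSum_re (hasSum_descFactorial_mul_taylorCoeffZero (r := 2) hW.differentiableOn k
    (z := 1) (by simp))
  simpa only [one_pow, mul_one, one_mul, ← ofReal_natCast, re_ofReal_mul,
    re_eq_norm.2 (hW_nonneg _)] using hsum

lemma hasSum_mul_succ_mul_sub_mul_norm_taylorCoeffZero (a : ℝ) :
    HasSum (fun n : ℕ => n * (n + 1) * (n - a) * ‖taylorCoeffZero W n‖)
      ((iteratedDeriv 3 W 1).re + (4 - a) * (iteratedDeriv 2 W 1).re +
        2 * (1 - a) * (deriv W 1).re) := by
  have hsum := hasSum_descFactorial_mul_norm_taylorCoeffZero hW hW_nonneg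
  rw [← iteratedDeriv_one]
  refine (((hsum 3).add ((hsum 2).mul_left (4 - a))).add
    ((hsum 1).mul_left (2 * (1 - a)))).congr_fun fun n => ?_
  rw [Nat.descFactorial_one, Nat.cast_descFactorial_two, natCast_descFactorial_three]
  ring

lemma hasSum_mul_pred_mul_add_mul_norm_taylorCoeffZero (a : ℝ) :
    HasSum (fun n : ℕ => n * (n - 1) * (n + a) * ‖taylorCoeffZero W n‖)
      ((iteratedDeriv 3 W 1).re + (2 + a) * (iteratedDeriv 2 W 1).re) := by
  have hsum := hasSum_descFactorial_mul_norm_taylorCoeffZero hW hW_nonneg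
  refine ((hsum 3).add ((hsum 2).mul_left (2 + a))).congr_fun fun n => ?_
  rw [Nat.cast_descFactorial_two, natCast_descFactorial_three]
  ring

end NonnegativeCoefficients

section Criterion
variable {f h g W₁ W₂ : ℂ → ℂ} {a : ℝ} {σ : ℂ}

lemma norm_convOperator_coeffs_le (hc : IsConvexHarmonic h g) (hh : deriv h 0 = 1)
    (hg : deriv g 0 = 0) (hW₁ : Differentiable ℂ W₁) (hW₂ : Differentiable ℂ W₂)
    (ha : -1 ≤ a) (ha1 : a ≤ 1) (n : ℕ) :
    n * (n - a) * ‖taylorCoeffZero (hadamardConv h W₁) n‖ +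
        n * (n + a) * ‖taylorCoeffZero (fun z => σ * hadamardConv g W₂ z) n‖ ≤
      (n * (n + 1) * (n - a) * ‖taylorCoeffZero W₁ n‖ +
        ‖σ‖ * (n * (n - 1) * (n + a) * ‖taylorCoeffZero W₂ n‖)) / 2 := by
  rcases eq_or_ne n 0 with rfl | hn
  · simp
  have hn1 : (1 : ℝ) ≤ n := Nat.one_le_cast.2 (Nat.one_le_iff_ne_zero.2 hn)
  have h0 := isOpen_ball.mem_nhds (mem_ball_self (x := (0 : ℂ)) one_pos)
  obtain ⟨hcoeff_h, hcoeff_g⟩ := hc.norm_taylorCoeffZero_le hh hg hn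
  rw [taylorCoeffZero_const_mul, norm_mul,
    taylorCoeffZero_hadamardConv (hc.differentiableOn_left.analyticAt h0) hW₁,
    taylorCoeffZero_hadamardConv (hc.differentiableOn_right.analyticAt h0) hW₂, norm_mul, norm_mul]
  calc n * (n - a) * (‖taylorCoeffZero h n‖ * ‖taylorCoeffZero W₁ n‖) +
        n * (n + a) * (‖σ‖ * (‖taylorCoeffZero g n‖ * ‖taylorCoeffZero W₂ n‖))
      ≤ n * (n - a) * ((n + 1) / 2 * ‖taylorCoeffZero W₁ n‖) +
        n * (n + a) * (‖σ‖ * ((n - 1) / 2 * ‖taylorCoeffZero W₂ n‖)) := by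
        have : 0 ≤ n - a := by linarith
        have : 0 ≤ n + a := by linarith
        gcongr
    _ = _ := by ring

theorem mainTheorem5_general (ha : -(1 / 2) ≤ a) (ha1 : a < 1)
    (hW₁ : Differentiable ℂ W₁) (hW₁_nonneg : ∀ n, 0 ≤ taylorCoeffZero W₁ n)
    (hW₁_deriv : deriv W₁ 0 = 1)
    (hW₂ : Differentiable ℂ W₂) (hW₂_nonneg : ∀ n, 0 ≤ taylorCoeffZero W₂ n)
    (hfhg : IsHarmonicDecomposition f h g) (hf : f ∈ ClassKHo)
    (hineq :
      ((iteratedDeriv 3 W₁ 1).re + (4 - a) * (iteratedDeriv 2 W₁ 1).re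
          + 2 * (1 - a) * ((deriv W₁ 1).re - 1))
        + ‖σ‖ * ((iteratedDeriv 3 W₂ 1).re + (2 + a) * (iteratedDeriv 2 W₂ 1).re)
      ≤ 2 * (1 - a)) :
    convOperator W₁ W₂ σ h g ∈ ClassHK a := by
  obtain ⟨hc, hg⟩ := hfhg.isConvexHarmonic hf
  have h0 := isOpen_ball.mem_nhds (mem_ball_self (x := (0 : ℂ)) one_pos)
  have hg_an := hfhg.analytic_g.analyticAt h0
  have hsum_h := summable_sq_mul_norm_taylorCoeffZero
    (differentiable_hadamardConv (hfhg.analytic_h.analyticAt h0) hW₁)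
  have hsum_g := summable_sq_mul_norm_taylorCoeffZero
    ((differentiable_hadamardConv hg_an hW₂).const_mul σ)
  have hsum := (summable_mul_add_mul_norm hsum_h (-a)).add (summable_mul_add_mul_norm hsum_g a)
  have hmajorant := ((hasSum_mul_succ_mul_sub_mul_norm_taylorCoeffZero hW₁ hW₁_nonneg a).add
    ((hasSum_mul_pred_mul_add_mul_norm_taylorCoeffZero hW₂ hW₂_nonneg a).mul_left ‖σ‖)).div_const 2
  simp only [← sub_eq_add_neg] at hsum
  refine mem_classHK_of_tsum_le (hfhg.convOperator hg hW₁ hW₂ hW₁_deriv) ?_ ha ha1 hsum_h hsum_g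
    ((hasSum_le (norm_convOperator_coeffs_le hc hfhg.deriv_h_zero hg hW₁ hW₂ (by linarith) ha1.le)
      hsum.hasSum hmajorant).trans (by linarith))
  rw [deriv_const_mul_field, deriv_hadamardConv_zero hg_an hW₂, hg, zero_mul, mul_zero]

end Criterion

theorem mainTheorem5
    (a : ℝ) (ha0 : 0 ≤ a) (ha1 : a < 1)
    (α₁ β₁ γ₁ δ₁ α₂ β₂ γ₂ δ₂ : ℝ)
    (hα₁ : 0 < α₁) (hγ₁ : 0 < γ₁) (hα₂ : 0 < α₂) (hγ₂ : 0 < γ₂)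
    (hβ₁ : 0 ≤ β₁) (hδ₁ : 0 ≤ δ₁) (hβ₂ : 0 ≤ β₂) (hδ₂ : 0 ≤ δ₂)
    -- the two Wright series converge on all of `ℂ`
    (hβδ₁ : 0 < β₁ + δ₁) (hβδ₂ : 0 < β₂ + δ₂)
    (σ : ℂ) (hσ : ‖σ‖ < 1)
    (W₁ W₂ : ℂ → ℂ)
    (hW₁ : W₁ = wrightNormalized α₁ β₁ γ₁ δ₁)
    (hW₂ : W₂ = wrightNormalized α₂ β₂ γ₂ δ₂)
    (f h g : ℂ → ℂ) (hfhg : IsHarmonicDecomposition f h g) (hf : f ∈ ClassKHo)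
    -- the derivatives of `W₁` and `W₂` at `1` are real numbers
    (hineq :
      ((iteratedDeriv 3 W₁ 1).re + (4 - a) * (iteratedDeriv 2 W₁ 1).re
          + 2 * (1 - a) * ((deriv W₁ 1).re - 1))
        + ‖σ‖ * ((iteratedDeriv 3 W₂ 1).re + (2 + a) * (iteratedDeriv 2 W₂ 1).re)
      ≤ 2 * (1 - a)) :
    convOperator W₁ W₂ σ h g ∈ ClassHK a := by
  subst hW₁ hW₂
  exact mainTheorem5_general (by linarith) ha1
    (differentiable_wrightNormalized hα₁ hγ₁ hβ₁ hδ₁ hβδ₁)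
    (taylorCoeffZero_wrightNormalized_nonneg hα₁ hγ₁ hβ₁ hδ₁ hβδ₁)
    (deriv_wrightNormalized_zero hα₁ hγ₁ hβ₁ hδ₁ hβδ₁)
    (differentiable_wrightNormalized hα₂ hγ₂ hβ₂ hδ₂ hβδ₂)
    (taylorCoeffZero_wrightNormalized_nonneg hα₂ hγ₂ hβ₂ hδ₂ hβδ₂) hfhg hf hineq
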